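/- **Setting.** Let $M$ be a smooth manifold (finite-dimensional, Hausdorff, $\sigma$-compact, without boundary). An *almost Lie algebroid* over $M$ is a smooth real vector bundle $A\to M$ of finite rank with an $\mathbb R$-bilinear skew-symmetric bracket $[\cdot,\cdot]$ on $\Gamma(A)$ and a smooth vector bundle morphism $\rho\colon A\to TM$ (the anchor) such that $$[\phi,f\psi]=\rho(\phi)[f]\,\psi+f[\phi,\psi],\qquad \rho[\phi,\psi]=[\rho(\phi),\rho(\psi)]$$ for all $\phi,\psi\in\Gamma(A)$, $f\in C^\infty(M)$. It is *regular* if $L:=\operatorname{im}\rho\subset TM$ is a smooth vector subbundle. Let $F:=\ker\rho$, with inclusion $t\colon F\hookrightarrow A$, and let $$J(\phi,\psi,\chi)=[\phi,[\psi,\chi]]+[\psi,[\chi,\phi]]+[\chi,[\phi,\psi]]$$ be the Jacobiator, which takes values in $F$. Put $$C^n:=\bigoplus_{p+2q=n}\Gamma(\wedge^pA^*\otimes S^qF^*),$$ where sections of $\wedge^pA^*\otimes S^qF^*$ are regarded as $C^\infty(M)$-multilinear maps $\Gamma(A)^p\times\Gamma(F)^q\to C^\infty(M)$, alternating in the first $p$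 and symmetric in the last $q$ arguments. Let $d:=D+\hat J+\hat\delta$ on $C^\bullet$, where * $D$ is the exterior covariant derivative $$D\alpha(\psi_0,\dots,\psi_p)=\sum_{i}(-1)^i\nabla_{\psi_i}\big(\alpha(\dots,\hat\psi_i,\dots)\big)+\sum_{i<j}(-1)^{i+j}\alpha([\psi_i,\psi_j],\dots,\hat\psi_i,\dots,\hat\psi_j,\dots)$$ for the $A$-connection on $S^\bullet F^*$ induced by $\nabla_\phi v=[\phi,v]$ on $F$ (on functions $\nabla_\phi f=\rho(\phi)[f]$); * $\hat\delta$ is the odd derivation with $\hat\delta\alpha=t^*\alpha\in\Gamma(F^*)$ for $\alpha\in\Gamma(A^*)$, vanishing on functions and on $\Gamma(F^*)$; * $\hat J$ is the odd derivation with $\hat J\beta=\langle\beta,J(\cdot,\cdot,\cdot)\rangle\in\Gamma(\wedge^3A^*)$ for $\beta\in\Gamma(F^*)$, vanishing on functions and on $\Gamma(A^*)$. For an involutive distribution $L\subset TM$ let $H_l^\bullet(L)$ be the leafwise cohomology, i.e. the Lie algebroid cohomology of $L$: the cohomology of $\Gamma(\wedge^\bullet L^*)$ with the differential given by the formula for $D$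 above, where the bracket is the commutator of vector fields and $\nabla_X f=X[f]$. **Proposition.** Let $(A,\rho,[\cdot,\cdot])$ be a regular almost Lie algebroid over $M$ and $L=\operatorname{im}\rho$. Then $d$ maps $C^n$ to $C^{n+1}$ and $d^2=0$; the distribution $L$ is involutive (hence integrable); and for every $n\ge 0$ the cohomology $H^n(A,d)$ of $(C^\bullet,d)$ satisfies $$H^n(A,d)\cong H_l^n(L),$$ the isomorphism being induced by the pullback $\rho^*\colon\Gamma(\wedge^nL^*)\to\Gamma(\wedge^nA^*)\subset C^n$. As a special case, for $A=TM$ with $\rho=\mathrm{id}$ and the commutator bracket, the inclusion of the differential forms into $C^\bullet$ induces $H^n(TM,d)\cong H^n_{dR}(M)$ for every $n\ge0$. -/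

import Mathlib

open Bundle Filter VectorField
open scoped Manifold ContDiff Topology

noncomputable section

/-! ### The algebra `C^∞(M)`, sections, vector fields -/

/-- The algebra `C^∞(M)` of smooth real functions on `M`. -/
abbrev SmoothFun (E : Type*) [NormedAddCommGroup E] [NormedSpace ℝ E]
    (M : Type*) [TopologicalSpace M] [ChartedSpace E M] : Type _ :=
  C^∞⟮𝓘(ℝ, E), M; ℝ⟯

/-- The smooth sections `Γ(A)` of a vector bundle `A → M` with typical fibre `B`. -/
abbrev Sec (E : Type*) [NormedAddCommGroup E] [NormedSpace ℝ E]
    {M : Type*} [TopologicalSpace M] [ChartedSpace E M]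
    (B : Type*) [NormedAddCommGroup B] [NormedSpace ℝ B]
    (A : M → Type*) [TopologicalSpace (TotalSpace B A)] [∀ x, TopologicalSpace (A x)]
    [FiberBundle B A] : Type _ :=
  Cₛ^∞⟮𝓘(ℝ, E); B, A⟯

/-- The smooth vector fields `Γ(TM)`. -/
abbrev VecField (E : Type*) [NormedAddCommGroup E] [NormedSpace ℝ E]
    (M : Type*) [TopologicalSpace M] [ChartedSpace E M] [IsManifold 𝓘(ℝ, E) ∞ M] : Type _ :=
  Sec E E (fun x : M => TangentSpace 𝓘(ℝ, E) x)

section Module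

variable {E : Type*} [NormedAddCommGroup E] [NormedSpace ℝ E]
  {M : Type*} [TopologicalSpace M] [ChartedSpace E M]
  {B : Type*} [NormedAddCommGroup B] [NormedSpace ℝ B]
  {A : M → Type*} [TopologicalSpace (TotalSpace B A)] [∀ x, TopologicalSpace (A x)]
  [FiberBundle B A] [∀ x, AddCommGroup (A x)] [∀ x, Module ℝ (A x)] [VectorBundle ℝ B A]

instance Sec.instSMulSmoothFun : SMul (SmoothFun E M) (Sec E B A) where
  smul f s := ⟨fun x => f x • s x, f.contMDiff.smul_section s.contMDiff⟩

@[simp] theorem Sec.smul_apply (f : SmoothFun E M) (s : Sec E B A) (x : M) :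
    (f • s) x = f x • s x := rfl

/-- `Γ(A)` is a `C^∞(M)`-module under pointwise multiplication. -/
instance Sec.instModuleSmoothFun : Module (SmoothFun E M) (Sec E B A) where
  one_smul s := ContMDiffSection.ext fun x => one_smul ℝ (s x)
  mul_smul f g s := ContMDiffSection.ext fun x => mul_smul (f x) (g x) (s x)
  smul_zero f := ContMDiffSection.ext fun x => smul_zero (f x)
  smul_add f s t := ContMDiffSection.ext fun x => smul_add (f x) (s x) (t x)
  add_smul f g s := ContMDiffSection.ext fun x => add_smul (f x) (g x) (s x)
  zero_smul s := ContMDiffSection.ext fun x => zero_smul ℝ (s x)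

end Module

theorem minSmoothness_natCast_le (k : ℕ) : minSmoothness ℝ (k : ℕ∞ω) ≤ (∞ : ℕ∞ω) := by
  rw [minSmoothness_of_isRCLikeNormedField]
  exact WithTop.coe_le_coe.2 (le_top : (k : ℕ∞) ≤ ⊤)

namespace VecField

variable {E : Type*} [NormedAddCommGroup E] [NormedSpace ℝ E] [FiniteDimensional ℝ E]
  {M : Type*} [TopologicalSpace M] [ChartedSpace E M] [IsManifold 𝓘(ℝ, E) ∞ M]

/-- The derivative `X[f]` of a smooth function along a smooth vector field, linear in `f`. -/
def lieD (X : VecField E M) : SmoothFun E M →ₗ[ℝ] SmoothFun E M where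
  toFun f := ⟨fun x => mvfderiv 𝓘(ℝ, E) f x (X x),
    ((contMDiff_snd_tangentBundle_modelSpace ℝ 𝓘(ℝ, ℝ)).comp
      (f.contMDiff.contMDiff_tangentMap (m := ∞) le_rfl)).comp X.contMDiff⟩
  map_add' f g := by
    ext x
    have h := mvfderiv_add (f.mdifferentiableAt (x := x)) (g.mdifferentiableAt (x := x))
    exact congrArg (fun l => l (X x)) h
  map_smul' c f := by
    ext x
    have h := mvfderiv_smul (mdifferentiableAt_const (c := c)) (f.mdifferentiableAt (x := x))
    simpa [mvfderiv_const] using! congrArg (fun l => l (X x)) h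

/-- The commutator bracket `[X, Y]` of smooth vector fields. -/
def bracket (X Y : VecField E M) : VecField E M :=
  ⟨mlieBracket 𝓘(ℝ, E) X Y, by
    have : IsManifold 𝓘(ℝ, E) (minSmoothness ℝ 2) M :=
      IsManifold.of_le (n := ∞) (minSmoothness_natCast_le 2)
    have : IsManifold 𝓘(ℝ, E) (((⊤ : ℕ∞) : ℕ∞ω) + 1) M := ‹IsManifold 𝓘(ℝ, E) ∞ M›
    exact ContDiff.mlieBracket_vectorField (m := ⊤) (n := ⊤) X.contMDiff Y.contMDiff (by
      rw [minSmoothness_of_isRCLikeNormedField]; exact le_rfl)⟩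

theorem bracket_swap (X Y : VecField E M) : bracket X Y = -bracket Y X :=
  ContMDiffSection.ext fun _ => mlieBracket_swap_apply

theorem bracket_add_left (X X' Y : VecField E M) :
    bracket (X + X') Y = bracket X Y + bracket X' Y :=
  ContMDiffSection.ext fun _ => mlieBracket_add_left X.mdifferentiableAt X'.mdifferentiableAt

theorem bracket_smul_left (c : ℝ) (X Y : VecField E M) :
    bracket (c • X) Y = c • bracket X Y :=
  ContMDiffSection.ext fun _ => mlieBracket_const_smul_left X.mdifferentiableAt

theorem bracket_add_right (X Y Y' : VecField E M) :
    bracket X (Y + Y') = bracket X Y + bracket X Y' :=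
  ContMDiffSection.ext fun _ => mlieBracket_add_right Y.mdifferentiableAt Y'.mdifferentiableAt

theorem bracket_smul_right (c : ℝ) (X Y : VecField E M) :
    bracket X (c • Y) = c • bracket X Y :=
  ContMDiffSection.ext fun _ => mlieBracket_const_smul_right Y.mdifferentiableAt

theorem bracket_fun_smul_right (X : VecField E M) (f : SmoothFun E M) (Y : VecField E M) :
    bracket X (f • Y) = lieD X f • Y + f • bracket X Y :=
  ContMDiffSection.ext fun _ => mlieBracket_smul_right f.mdifferentiableAt Y.mdifferentiableAt

/-- The Jacobi identity for vector fields. -/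
theorem bracket_jacobi (X Y Z : VecField E M) :
    bracket X (bracket Y Z) + bracket Y (bracket Z X) + bracket Z (bracket X Y) = 0 := by
  have h : bracket X (bracket Y Z) =
      bracket (bracket X Y) Z + bracket Y (bracket X Z) := by
    have : IsManifold 𝓘(ℝ, E) (minSmoothness ℝ 3) M :=
      IsManifold.of_le (n := ∞) (minSmoothness_natCast_le 3)
    refine ContMDiffSection.ext fun x => ?_
    have h2 : (minSmoothness ℝ 2) ≤ (∞ : ℕ∞ω) := minSmoothness_natCast_le 2
    exact leibniz_identity_mlieBracket_apply
      ((X.contMDiff x).of_le h2) ((Y.contMDiff x).of_le h2) ((Z.contMDiff x).of_le h2)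
  have h1 : bracket Y (bracket Z X) = -bracket Y (bracket X Z) := by
    rw [bracket_swap Z X, ← neg_one_smul ℝ, bracket_smul_right, neg_one_smul]
  rw [h, h1, bracket_swap Z (bracket X Y)]
  abel

end VecField

/-! ### The Koszul formula and the cohomology of forms -/

section Koszul

variable {𝒜 : Type*}

/-- The formula
`(Dα)(ψ₀,…,ψₚ) = ∑ᵢ (-1)ⁱ ∇_{ψᵢ}(α(…,ψ̂ᵢ,…)) + ∑_{i<j} (-1)^{i+j} α([ψᵢ,ψⱼ],…,ψ̂ᵢ,…,ψ̂ⱼ,…)`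
for maps `α` of `p` arguments with values in `V`. In the second sum the pair of positions `i < j`
is written `(i.castSucc, j.succ)` with `i ≤ j`; this sum is empty for `p = 0`. -/
def koszul {V : Type*} [AddCommGroup V] [Module ℝ V] (nabla : 𝒜 → V →ₗ[ℝ] V)
    (br : 𝒜 → 𝒜 → 𝒜) : (p : ℕ) → ((Fin p → 𝒜) → V) →ₗ[ℝ] ((Fin (p + 1) → 𝒜) → V)
  | 0 =>
    { toFun := fun α ψ => ∑ i : Fin 1, (-1 : ℝ) ^ (i : ℕ) • nabla (ψ i) (α (i.removeNth ψ))
      map_add' := fun α β => by ext ψ; simp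
      map_smul' := fun c α => by ext ψ; simp }
  | p + 1 =>
    { toFun := fun α ψ =>
        ∑ i : Fin (p + 2), (-1 : ℝ) ^ (i : ℕ) • nabla (ψ i) (α (i.removeNth ψ)) +
        ∑ i : Fin (p + 1), ∑ j : Fin (p + 1), if i ≤ j then
          (-1 : ℝ) ^ ((i.castSucc : ℕ) + (j.succ : ℕ)) •
            α (Fin.cons (br (ψ i.castSucc) (ψ j.succ)) (i.removeNth (j.succ.removeNth ψ)))
        else 0
      map_add' := fun α β => by
        ext ψ
        simp only [Pi.add_apply, map_add, smul_add, ite_add_zero, Finset.sum_add_distrib]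
        abel
      map_smul' := fun c α => by
        ext ψ
        simp only [Pi.smul_apply, map_smul, RingHom.id_apply, smul_add, Finset.smul_sum, smul_ite,
          smul_zero, smul_comm c] }

variable (R : Type*) [CommRing R] [Algebra ℝ R]

/-- `p`-forms: the alternating `R`-multilinear maps `𝒜ᵖ → R`. For `R = C^∞(M)` and
`𝒜 = Γ(A)` this is `Γ(⋀ᵖ A*)`. -/
def Forms (𝒜 : Type*) [AddCommGroup 𝒜] [Module R 𝒜] (p : ℕ) :
    Submodule ℝ ((Fin p → 𝒜) → R) where
  carrier := {α | ∃ a : 𝒜 [⋀^Fin p]→ₗ[R] R, ⇑a = α}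
  add_mem' := by rintro _ _ ⟨a, rfl⟩ ⟨b, rfl⟩; exact ⟨a + b, rfl⟩
  zero_mem' := ⟨0, rfl⟩
  smul_mem' := by
    rintro c _ ⟨a, rfl⟩
    exact ⟨algebraMap ℝ R c • a, by ext; simp [Algebra.smul_def]⟩

variable {R} [AddCommGroup 𝒜] [Module R 𝒜] (act : 𝒜 → R →ₗ[ℝ] R) (br : 𝒜 → 𝒜 → 𝒜)

/-- Closed `p`-forms. -/
def closedForms (p : ℕ) : Submodule ℝ ((Fin p → 𝒜) → R) :=
  Forms R 𝒜 p ⊓ LinearMap.ker (koszul act br p)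

/-- Exact `p`-forms. -/
def exactForms : (p : ℕ) → Submodule ℝ ((Fin p → 𝒜) → R)
  | 0 => ⊥
  | p + 1 => (Forms R 𝒜 p).map (koszul act br p)

/-- The cohomology in degree `p` of the forms on `𝒜` with the differential given by the Koszul
formula, for an action `act` on `R` and a bracket `br`. -/
abbrev FormCohomology (p : ℕ) : Type _ :=
  closedForms act br p ⧸ (exactForms act br p).submoduleOf (closedForms act br p)

end Koszul

/-! ### De Rham cohomology, distributions and leafwise cohomology -/

section Distribution

variable {E : Type*} [NormedAddCommGroup E] [NormedSpace ℝ E] [FiniteDimensional ℝ E]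
  {M : Type*} [TopologicalSpace M] [ChartedSpace E M] [IsManifold 𝓘(ℝ, E) ∞ M]

/-- The closed differential `p`-forms on `M`, as alternating `C^∞(M)`-multilinear maps on
vector fields; the exterior derivative is given by the invariant formula. -/
abbrev deRhamClosed (E : Type*) [NormedAddCommGroup E] [NormedSpace ℝ E] [FiniteDimensional ℝ E]
    (M : Type*) [TopologicalSpace M] [ChartedSpace E M] [IsManifold 𝓘(ℝ, E) ∞ M] (p : ℕ) :
    Submodule ℝ ((Fin p → VecField E M) → SmoothFun E M) :=
  closedForms VecField.lieD VecField.bracket p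

/-- The de Rham cohomology `H_dR^p(M)`. -/
abbrev DeRhamCohomology (E : Type*) [NormedAddCommGroup E] [NormedSpace ℝ E]
    [FiniteDimensional ℝ E]
    (M : Type*) [TopologicalSpace M] [ChartedSpace E M] [IsManifold 𝓘(ℝ, E) ∞ M] (p : ℕ) :
    Type _ :=
  FormCohomology (R := SmoothFun E M) (𝒜 := VecField E M) VecField.lieD VecField.bracket p

/-- `L ⊂ TM` is a smooth vector subbundle: locally it is spanned by a smooth frame. -/
def IsSubbundle (L : ∀ x : M, Submodule ℝ (TangentSpace 𝓘(ℝ, E) x)) : Prop :=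
  ∀ x₀ : M, ∃ U : Set M, IsOpen U ∧ x₀ ∈ U ∧
    ∃ (k : ℕ) (X : Fin k → ∀ x : M, TangentSpace 𝓘(ℝ, E) x),
      (∀ i, ContMDiffOn 𝓘(ℝ, E) 𝓘(ℝ, E).tangent ∞
        (fun x => (⟨x, X i x⟩ : TangentBundle 𝓘(ℝ, E) M)) U) ∧
      ∀ x ∈ U, LinearIndependent ℝ (fun i => X i x) ∧
        Submodule.span ℝ (Set.range fun i => X i x) = L x

/-- The smooth sections `Γ(L)` of `L ⊂ TM`. -/
def distSec (L : ∀ x : M, Submodule ℝ (TangentSpace 𝓘(ℝ, E) x)) :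
    Submodule (SmoothFun E M) (VecField E M) where
  carrier := {X | ∀ x, X x ∈ L x}
  add_mem' hX hY x := (L x).add_mem (hX x) (hY x)
  zero_mem' x := (L x).zero_mem
  smul_mem' f _ hX x := (L x).smul_mem (f x) (hX x)

/-- `Γ(L)` is closed under the commutator bracket, i.e. `L` is integrable in the sense of
Frobenius. -/
def Involutive (L : ∀ x : M, Submodule ℝ (TangentSpace 𝓘(ℝ, E) x)) : Prop :=
  ∀ X ∈ distSec L, ∀ Y ∈ distSec L, VecField.bracket X Y ∈ distSec L

variable {L : ∀ x : M, Submodule ℝ (TangentSpace 𝓘(ℝ, E) x)}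

/-- The action of `Γ(L)` on functions, i.e. the anchor of the Lie algebroid `L`. -/
def leafAct (X : distSec L) : SmoothFun E M →ₗ[ℝ] SmoothFun E M := VecField.lieD X.1

/-- The bracket of the Lie algebroid `L`. -/
def leafBracket (hL : Involutive L) (X Y : distSec L) : distSec L :=
  ⟨VecField.bracket X.1 Y.1, hL X.1 X.2 Y.1 Y.2⟩

/-- The closed leafwise `p`-forms in `Γ(⋀ᵖ L*)`. -/
abbrev leafClosed (hL : Involutive L) (p : ℕ) :
    Submodule ℝ ((Fin p → distSec L) → SmoothFun E M) :=
  closedForms leafAct (leafBracket hL) p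

/-- The leafwise cohomology `H_l^p(L)`: the Lie algebroid cohomology of `L`. -/
abbrev LeafCohomology (hL : Involutive L) (p : ℕ) : Type _ :=
  FormCohomology (R := SmoothFun E M) (𝒜 := distSec L) leafAct (leafBracket hL) p

end Distribution

/-! ### Almost Lie algebroids -/

/-- An almost Lie algebroid structure on the vector bundle `A → M`. -/
structure AlmostLieAlgebroid (E : Type*) [NormedAddCommGroup E] [NormedSpace ℝ E]
    [FiniteDimensional ℝ E]
    {M : Type*} [TopologicalSpace M] [ChartedSpace E M] [IsManifold 𝓘(ℝ, E) ∞ M]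
    (B : Type*) [NormedAddCommGroup B] [NormedSpace ℝ B]
    (A : M → Type*) [TopologicalSpace (TotalSpace B A)] [∀ x, TopologicalSpace (A x)]
    [FiberBundle B A] [∀ x, AddCommGroup (A x)] [∀ x, Module ℝ (A x)] [VectorBundle ℝ B A] where
  /-- the anchor, fibrewise -/
  anchor : ∀ x : M, A x →ₗ[ℝ] TangentSpace 𝓘(ℝ, E) x
  /-- the anchor is a smooth map of total spaces -/
  contMDiff_anchor : ContMDiff (𝓘(ℝ, E).prod 𝓘(ℝ, B)) 𝓘(ℝ, E).tangent ∞
    (fun a : TotalSpace B A => (⟨a.1, anchor a.1 a.2⟩ : TangentBundle 𝓘(ℝ, E) M))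
  /-- the bracket on sections -/
  bracket : Sec E B A →ₗ[ℝ] Sec E B A →ₗ[ℝ] Sec E B A
  skew : ∀ φ ψ : Sec E B A, bracket φ ψ = -bracket ψ φ
  leibniz : ∀ (φ : Sec E B A) (f : SmoothFun E M) (ψ : Sec E B A) (x : M),
    bracket φ (f • ψ) x =
      mvfderiv 𝓘(ℝ, E) f x (anchor x (φ x)) • ψ x + f x • bracket φ ψ x
  anchor_bracket : ∀ (φ ψ : Sec E B A) (x : M),
    anchor x (bracket φ ψ x) =
      mlieBracket 𝓘(ℝ, E) (fun y => anchor y (φ y)) (fun y => anchor y (ψ y)) x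

namespace AlmostLieAlgebroid

variable {E : Type*} [NormedAddCommGroup E] [NormedSpace ℝ E] [FiniteDimensional ℝ E]
  {M : Type*} [TopologicalSpace M] [ChartedSpace E M] [IsManifold 𝓘(ℝ, E) ∞ M]
  {B : Type*} [NormedAddCommGroup B] [NormedSpace ℝ B]
  {A : M → Type*} [TopologicalSpace (TotalSpace B A)] [∀ x, TopologicalSpace (A x)]
  [FiberBundle B A] [∀ x, AddCommGroup (A x)] [∀ x, Module ℝ (A x)] [VectorBundle ℝ B A]
  (𝔸 : AlmostLieAlgebroid E B A)

/-- The anchor on sections, `ρ : Γ(A) → Γ(TM)`. -/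
def rho : Sec E B A →ₗ[SmoothFun E M] VecField E M where
  toFun φ := ⟨fun x => 𝔸.anchor x (φ x), 𝔸.contMDiff_anchor.comp φ.contMDiff⟩
  map_add' φ ψ := ContMDiffSection.ext fun x => map_add (𝔸.anchor x) (φ x) (ψ x)
  map_smul' f φ := ContMDiffSection.ext fun x => map_smul (𝔸.anchor x) (f x) (φ x)

theorem rho_bracket (φ ψ : Sec E B A) :
    𝔸.rho (𝔸.bracket φ ψ) = VecField.bracket (𝔸.rho φ) (𝔸.rho ψ) :=
  ContMDiffSection.ext fun x => 𝔸.anchor_bracket φ ψ x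

/-- The image `L = im ρ ⊂ TM`. -/
def image (x : M) : Submodule ℝ (TangentSpace 𝓘(ℝ, E) x) := LinearMap.range (𝔸.anchor x)

/-- `𝔸` is regular if `im ρ ⊂ TM` is a vector bundle. -/
def IsRegular : Prop := IsSubbundle 𝔸.image

/-- The anchor as a map `Γ(A) → Γ(L)`. -/
def rhoImage (φ : Sec E B A) : distSec 𝔸.image := ⟨𝔸.rho φ, fun x => ⟨φ x, rfl⟩⟩

/-- The sections `Γ(F)` of `F = ker ρ`, as a submodule of `Γ(A)`; the embedding
`t : Γ(F) → Γ(A)` is the coercion. -/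
def kerSec : Submodule (SmoothFun E M) (Sec E B A) := LinearMap.ker 𝔸.rho

theorem bracket_mem_kerSec (φ : Sec E B A) (v : 𝔸.kerSec) : 𝔸.bracket φ v ∈ 𝔸.kerSec := by
  have hv : 𝔸.rho v = 0 := v.2
  have h : VecField.bracket (𝔸.rho φ) (0 : VecField E M) = 0 := by
    simpa using VecField.bracket_smul_right 0 (𝔸.rho φ) (0 : VecField E M)
  change 𝔸.rho _ = 0
  rw [rho_bracket, hv, h]

/-- The `A`-connection `∇_φ v = [φ, v]` on `F`. -/
def conn (φ : Sec E B A) (v : 𝔸.kerSec) : 𝔸.kerSec :=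
  ⟨𝔸.bracket φ v, 𝔸.bracket_mem_kerSec φ v⟩

/-- The Jacobiator `J(φ,ψ,χ) = [φ,[ψ,χ]] + [ψ,[χ,φ]] + [χ,[φ,ψ]]`, with values in `F`. -/
def jacobiator (φ ψ χ : Sec E B A) : 𝔸.kerSec :=
  ⟨𝔸.bracket φ (𝔸.bracket ψ χ) + 𝔸.bracket ψ (𝔸.bracket χ φ) + 𝔸.bracket χ (𝔸.bracket φ ψ), by
    change 𝔸.rho _ = 0
    simp only [map_add, rho_bracket]
    exact VecField.bracket_jacobi _ _ _⟩

/-- The extension of `∇` to `Γ(S^q F*)`: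
`(∇_φ β)(v₁,…,v_q) = ρ(φ)[β(v₁,…,v_q)] - ∑ₖ β(v₁,…,∇_φ vₖ,…,v_q)`. -/
def symConn (q : ℕ) (φ : Sec E B A) :
    ((Fin q → 𝔸.kerSec) → SmoothFun E M) →ₗ[ℝ] ((Fin q → 𝔸.kerSec) → SmoothFun E M) where
  toFun β v := VecField.lieD (𝔸.rho φ) (β v) -
    ∑ k : Fin q, β (Function.update v k (𝔸.conn φ (v k)))
  map_add' β γ := by
    ext1 v
    simp only [Pi.add_apply, map_add, Finset.sum_add_distrib]
    abel
  map_smul' c β := by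
    ext1 v
    simp only [Pi.smul_apply, map_smul, RingHom.id_apply, smul_sub, Finset.smul_sum]

/-- Maps on `Γ(A)ᵖ × Γ(F)^q` with values in `C^∞(M)`. -/
abbrev MixedMap (p q : ℕ) : Type _ :=
  (Fin p → Sec E B A) → (Fin q → 𝔸.kerSec) → SmoothFun E M

/-- `Γ(⋀ᵖ A* ⊗ S^q F*)`: the `C^∞(M)`-multilinear maps on `Γ(A)ᵖ × Γ(F)^q` which are alternating
in the first `p` and symmetric in the last `q` arguments. A product `β₁⋯β_q` of sections of `F*`
corresponds to `(v₁,…,v_q) ↦ ∑_σ ∏ᵢ βᵢ(v_{σ(i)})`. -/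
def mixedForms (p q : ℕ) : Submodule ℝ (𝔸.MixedMap p q) where
  carrier := {ξ |
    (∀ v, ∃ a : (Sec E B A) [⋀^Fin p]→ₗ[SmoothFun E M] SmoothFun E M, ⇑a = fun ψ => ξ ψ v) ∧
    ∀ ψ, ∃ b : MultilinearMap (SmoothFun E M) (fun _ : Fin q => 𝔸.kerSec) (SmoothFun E M),
      ⇑b = ξ ψ ∧ ∀ (σ : Equiv.Perm (Fin q)) (v : Fin q → 𝔸.kerSec), b (v ∘ σ) = b v}
  add_mem' := by
    rintro ξ η ⟨h1, h2⟩ ⟨k1, k2⟩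
    refine ⟨fun v => ?_, fun ψ => ?_⟩
    · obtain ⟨a, ha⟩ := h1 v
      obtain ⟨b, hb⟩ := k1 v
      exact ⟨a + b, by funext ψ; simpa using congrArg₂ (· + ·) (congrFun ha ψ) (congrFun hb ψ)⟩
    · obtain ⟨a, ha, ha'⟩ := h2 ψ
      obtain ⟨b, hb, hb'⟩ := k2 ψ
      refine ⟨a + b, by funext v; simp [ha, hb], fun σ v => ?_⟩
      simp only [MultilinearMap.add_apply, ha', hb']
  zero_mem' := ⟨fun _ => ⟨0, rfl⟩, fun _ => ⟨0, rfl, fun _ _ => rfl⟩⟩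
  smul_mem' := by
    rintro c ξ ⟨h1, h2⟩
    refine ⟨fun v => ?_, fun ψ => ?_⟩
    · obtain ⟨a, ha⟩ := h1 v
      refine ⟨algebraMap ℝ (SmoothFun E M) c • a, funext fun ψ => ?_⟩
      have := congrFun ha ψ
      rw [AlternatingMap.smul_apply, this, Pi.smul_apply, Pi.smul_apply, Algebra.smul_def c,
        smul_eq_mul]
    · obtain ⟨a, ha, ha'⟩ := h2 ψ
      refine ⟨algebraMap ℝ (SmoothFun E M) c • a, funext fun v => ?_, fun σ v => ?_⟩
      · rw [MultilinearMap.smul_apply, ha, Pi.smul_apply, Pi.smul_apply, Algebra.smul_def c,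
          smul_eq_mul]
      · rw [MultilinearMap.smul_apply, MultilinearMap.smul_apply, ha']

/-- The exterior covariant derivative
`D : Γ(⋀ᵖ A* ⊗ S^q F*) → Γ(⋀ᵖ⁺¹ A* ⊗ S^q F*)`. -/
def covD (p q : ℕ) : 𝔸.MixedMap p q →ₗ[ℝ] 𝔸.MixedMap (p + 1) q :=
  koszul (𝔸.symConn q) (fun φ ψ => 𝔸.bracket φ ψ) p

/-- `δ̂ : Γ(⋀ᵖ⁺¹ A* ⊗ S^q F*) → Γ(⋀ᵖ A* ⊗ S^{q+1} F*)`, the odd derivation with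
`δ̂ α = t* α` for `α ∈ Γ(A*)` which vanishes on functions and on `Γ(F*)`. -/
def deltaHat (p q : ℕ) : 𝔸.MixedMap (p + 1) q →ₗ[ℝ] 𝔸.MixedMap p (q + 1) where
  toFun ξ ψ v := ∑ j : Fin (q + 1), ξ (Fin.cons (v j : Sec E B A) ψ) (j.removeNth v)
  map_add' ξ η := by
    ext1 ψ; ext1 v
    simp only [Pi.add_apply, Finset.sum_add_distrib]
  map_smul' c ξ := by
    ext1 ψ; ext1 v
    simp only [Pi.smul_apply, RingHom.id_apply, Finset.smul_sum]

/-- `Ĵ : Γ(⋀ᵖ A* ⊗ S^{q+1} F*) → Γ(⋀ᵖ⁺³ A* ⊗ S^q F*)`, the odd derivation with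
`Ĵ β = ⟨β, J⟩` for `β ∈ Γ(F*)` which vanishes on functions and on `Γ(A*)`. The three positions
inserted into `J` are `i < j + 1 < k + 2` with `i ≤ j ≤ k`; the sign is that of the permutation
moving them to the front. -/
def jHat (p q : ℕ) : 𝔸.MixedMap p (q + 1) →ₗ[ℝ] 𝔸.MixedMap (p + 3) q where
  toFun ξ ψ v :=
    ∑ i : Fin (p + 1), ∑ j : Fin (p + 1), ∑ k : Fin (p + 1), if i ≤ j ∧ j ≤ k then
      (-1 : ℝ) ^ ((i : ℕ) + (j : ℕ) + (k : ℕ)) •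
        ξ (i.removeNth (j.succ.removeNth (k.succ.succ.removeNth ψ)))
          (Fin.cons (𝔸.jacobiator (ψ i.castSucc.castSucc) (ψ j.succ.castSucc) (ψ k.succ.succ)) v)
    else 0
  map_add' ξ η := by
    ext1 ψ; ext1 v
    simp only [Pi.add_apply, smul_add, ite_add_zero, Finset.sum_add_distrib]
  map_smul' c ξ := by
    ext1 ψ; ext1 v
    simp only [Pi.smul_apply, RingHom.id_apply, Finset.smul_sum, smul_ite, smul_zero, smul_comm c]

/-- Families of maps on `Γ(A)ᵖ × Γ(F)^q` for all `p`, `q`. -/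
abbrev Total : Type _ := ∀ p q : ℕ, 𝔸.MixedMap p q

/-- The cochains `Cⁿ = ⨁_{p+2q=n} Γ(⋀ᵖ A* ⊗ S^q F*)`. -/
def cochains (n : ℕ) : Submodule ℝ 𝔸.Total where
  carrier := {ξ | ∀ p q, ξ p q ∈ 𝔸.mixedForms p q ∧ (p + 2 * q ≠ n → ξ p q = 0)}
  add_mem' := fun h k p q => ⟨add_mem (h p q).1 (k p q).1, fun hn => by
    rw [Pi.add_apply, Pi.add_apply, (h p q).2 hn, (k p q).2 hn, add_zero]⟩
  zero_mem' := fun _ _ => ⟨zero_mem _, fun _ => rfl⟩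
  smul_mem' := fun c _ h p q => ⟨Submodule.smul_mem _ c (h p q).1, fun hn => by
    rw [Pi.smul_apply, Pi.smul_apply, (h p q).2 hn, smul_zero]⟩

/-- The `D`-part of the differential. -/
def totalCovD : 𝔸.Total →ₗ[ℝ] 𝔸.Total where
  toFun ξ
    | 0, _ => 0
    | p + 1, q => 𝔸.covD p q (ξ p q)
  map_add' ξ η := by
    funext p q
    cases p with
    | zero => simp
    | succ p => exact map_add (𝔸.covD p q) _ _
  map_smul' c ξ := by
    funext p q
    cases p with
    | zero => simp
    | succ p => exact map_smul (𝔸.covD p q) _ _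

/-- The `δ̂`-part of the differential. -/
def totalDeltaHat : 𝔸.Total →ₗ[ℝ] 𝔸.Total where
  toFun ξ
    | _, 0 => 0
    | p, q + 1 => 𝔸.deltaHat p q (ξ (p + 1) q)
  map_add' ξ η := by
    funext p q
    cases q with
    | zero => simp
    | succ q => exact map_add (𝔸.deltaHat p q) _ _
  map_smul' c ξ := by
    funext p q
    cases q with
    | zero => simp
    | succ q => exact map_smul (𝔸.deltaHat p q) _ _

/-- The `Ĵ`-part of the differential. -/
def totalJHat : 𝔸.Total →ₗ[ℝ] 𝔸.Total where
  toFun ξ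
    | p + 3, q => 𝔸.jHat p q (ξ p (q + 1))
    | _, _ => 0
  map_add' ξ η := by
    funext p q
    match p with
    | 0 | 1 | 2 => simp
    | p + 3 => exact map_add (𝔸.jHat p q) _ _
  map_smul' c ξ := by
    funext p q
    match p with
    | 0 | 1 | 2 => simp
    | p + 3 => exact map_smul (𝔸.jHat p q) _ _

/-- The differential `d = D + Ĵ + δ̂`. -/
def d : 𝔸.Total →ₗ[ℝ] 𝔸.Total := 𝔸.totalCovD + 𝔸.totalJHat + 𝔸.totalDeltaHat

/-- The cocycles in `Cⁿ`. -/
def cocycles (n : ℕ) : Submodule ℝ 𝔸.Total := 𝔸.cochains n ⊓ LinearMap.ker 𝔸.d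

/-- The coboundaries in `Cⁿ`. -/
def coboundaries : ℕ → Submodule ℝ 𝔸.Total
  | 0 => ⊥
  | n + 1 => (𝔸.cochains n).map 𝔸.d

/-- The cohomology `Hⁿ(A, d)`. -/
abbrev Cohomology (n : ℕ) : Type _ :=
  𝔸.cocycles n ⧸ (𝔸.coboundaries n).submoduleOf (𝔸.cocycles n)

/-- A map on `Γ(A)ⁿ` placed in the component `p = n`, `q = 0`. -/
def ofForm (n : ℕ) (α : (Fin n → Sec E B A) → SmoothFun E M) : 𝔸.Total :=
  fun p q ψ _ => if h : p = n ∧ q = 0 then α (fun i => ψ (Fin.cast h.1.symm i)) else 0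

/-- The pullback `ρ* α ∈ Γ(⋀ⁿ A*) ⊂ Cⁿ` of a leafwise form `α ∈ Γ(⋀ⁿ L*)`. -/
def pullback (n : ℕ) (α : (Fin n → distSec 𝔸.image) → SmoothFun E M) : 𝔸.Total :=
  𝔸.ofForm n fun ψ => α fun i => 𝔸.rhoImage (ψ i)

/-- The tangent bundle with the identity as anchor and the commutator bracket. -/
def tangent (E : Type*) [NormedAddCommGroup E] [NormedSpace ℝ E] [FiniteDimensional ℝ E]
    (M : Type*) [TopologicalSpace M] [ChartedSpace E M] [IsManifold 𝓘(ℝ, E) ∞ M] :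
    AlmostLieAlgebroid E E (fun x : M => TangentSpace 𝓘(ℝ, E) x) where
  anchor _ := LinearMap.id
  contMDiff_anchor := contMDiff_id
  bracket := LinearMap.mk₂ ℝ VecField.bracket VecField.bracket_add_left
    VecField.bracket_smul_left VecField.bracket_add_right VecField.bracket_smul_right
  skew := VecField.bracket_swap
  leibniz φ f ψ x := congrArg (fun s => s x) (VecField.bracket_fun_smul_right φ f ψ)
  anchor_bracket _ _ _ := rfl

end AlmostLieAlgebroid

end

noncomputable section

/-! The cohomology is computed by the Koszul operator `δ̂`, which turns an argument in `Γ(A)` into a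
symmetric argument in `Γ(F)`. A smooth splitting of `ρ` over `L` gives a projection `pr : Γ(A) →
Γ(F)`. Let `h` be the insertion of `pr`. Then `N = δ̂h + hδ̂` (`numOp`) counts the arguments lying
in `F`: in bidegree `(p, q)` its possible eigenvalues are `q + k` with `0 ≤ k ≤ p`. They are nonzero
for `q > 0`, so `δ̂` is exact there (`exists_mDel_eq`). Removing the component of highest `q` again
and again (`exists_sub_dif_apply_eq_zero`) shows that a cochain `ξ` with `dξ` concentrated in `q =
0` is itself concentrated in `q = 0` modulo a coboundary. What remains is killed by `δ̂`, so it
depends only on the anchors of its arguments and is a pullback from `L` (`exists_eq_pull`). The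
pullback of cochains is injective and intertwines the differentials (`dif_pull`), which gives both
injectivity and surjectivity in cohomology.

For `d² = 0` a Cartan calculus avoids products and generators. An operator on mixed forms that
commutes or anticommutes with all contractions and produces nothing in bidegree `(0, 0)` is zero
(`eq_zero_of_contr`). Commutators of contractions with `D`, `δ̂`, `Ĵ` are Lie derivatives,
insertions of 1- and 2-forms, and contractions. Every identity is therefore reduced, one contraction
at a time, to an identity for the bracket. `D² = -(Ĵδ̂ + δ̂Ĵ)` comes down to the definition of the
Jacobiator (`mLie_mLie`), and `DĴ + ĴD = 0` to its Bianchi identity (`bianchi`). That the operators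
preserve alternation, symmetry and `C^∞`-multilinearity is likewise checked on contractions: mixed
forms are the largest space stable under them with the expected linearity
(`IsContrStable.le_mixed`).

All of this is algebra over the ring `C^∞(M)`. Geometry enters twice: vector fields act on functions
compatibly with commutators (`VecField.lieD_bracket`), and a regular anchor splits smoothly
(`exists_splitting`), locally because its rank is locally constant and globally by a partition of
unity. The splitting also lifts sections of `L` to `A`, so involutivity follows from `ρ[φ,ψ] =
[ρφ,ρψ]`. -/

/-- An almost Lie–Rinehart algebra over a commutative real algebra `R`: an `R`-module `𝒜` with a
skew bracket and an action on `R` by derivations, together with a submodule `ker` which acts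
trivially, is stable under the bracket and contains the values of the Jacobiator. -/
structure AlmostLieRinehart (R 𝒜 : Type*) [CommRing R] [Algebra ℝ R] [AddCommGroup 𝒜]
    [Module R 𝒜] where
  /-- the action on scalars -/
  act : 𝒜 → R →ₗ[ℝ] R
  /-- the bracket -/
  br : 𝒜 → 𝒜 → 𝒜
  /-- the kernel of the anchor -/
  ker : Submodule R 𝒜
  act_add : ∀ φ ψ f, act (φ + ψ) f = act φ f + act ψ f
  act_smul : ∀ (f : R) φ g, act (f • φ) g = f * act φ g
  act_mul : ∀ φ f g, act φ (f * g) = act φ f * g + f * act φ g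
  act_br : ∀ φ ψ f, act (br φ ψ) f = act φ (act ψ f) - act ψ (act φ f)
  br_add : ∀ φ ψ χ, br φ (ψ + χ) = br φ ψ + br φ χ
  br_swap : ∀ φ ψ, br φ ψ = -br ψ φ
  br_smul : ∀ φ (f : R) ψ, br φ (f • ψ) = act φ f • ψ + f • br φ ψ
  act_ker : ∀ v ∈ ker, ∀ f, act v f = 0
  br_mem_ker : ∀ φ, ∀ v ∈ ker, br φ v ∈ ker
  jac_mem_ker : ∀ φ ψ χ, br φ (br ψ χ) + br ψ (br χ φ) + br χ (br φ ψ) ∈ ker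

/-! ### The connection on the kernel and the Jacobiator -/

namespace AlmostLieRinehart

variable {R 𝒜 : Type*} [CommRing R] [Algebra ℝ R] [AddCommGroup 𝒜] [Module R 𝒜]
  (𝔩 : AlmostLieRinehart R 𝒜)

theorem br_add_left (φ ψ χ : 𝒜) : 𝔩.br (φ + ψ) χ = 𝔩.br φ χ + 𝔩.br ψ χ := by
  rw [𝔩.br_swap, 𝔩.br_add, neg_add, ← 𝔩.br_swap, ← 𝔩.br_swap]

theorem br_smul_left (f : R) (φ ψ : 𝒜) :
    𝔩.br (f • φ) ψ = f • 𝔩.br φ ψ - 𝔩.act ψ f • φ := by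
  rw [𝔩.br_swap, 𝔩.br_smul, 𝔩.br_swap ψ φ, smul_neg]; abel

theorem br_neg (φ ψ : 𝒜) : 𝔩.br φ (-ψ) = -𝔩.br φ ψ := by
  have h0 : 𝔩.br φ 0 = 0 := by simpa using 𝔩.br_add φ 0 0
  rw [eq_neg_iff_add_eq_zero, ← 𝔩.br_add, neg_add_cancel, h0]

/-- Skew-symmetry only gives `2[φ,φ] = 0`; the factor is removed because `R` is a real algebra and
contains `1/2`. -/
theorem br_self (φ : 𝒜) : 𝔩.br φ φ = 0 := by
  have h := 𝔩.br_swap φ φ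
  have h2 : (2 : R) • 𝔩.br φ φ = 0 := by
    rw [two_smul]; exact eq_neg_iff_add_eq_zero.1 h
  have h3 : (algebraMap ℝ R (1 / 2)) * 2 = 1 := by
    rw [← map_ofNat (algebraMap ℝ R) 2, ← map_mul]; norm_num
  rw [← one_smul R (𝔩.br φ φ), ← h3, mul_smul, h2, smul_zero]

theorem br_sub (φ ψ χ : 𝒜) : 𝔩.br φ (ψ - χ) = 𝔩.br φ ψ - 𝔩.br φ χ := by
  rw [sub_eq_add_neg, 𝔩.br_add, 𝔩.br_neg, sub_eq_add_neg]

/-- The connection `∇_φ v = [φ, v]` on `ker`. -/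
def conn (φ : 𝒜) (v : 𝔩.ker) : 𝔩.ker := ⟨𝔩.br φ v, 𝔩.br_mem_ker φ v v.2⟩

@[simp] theorem coe_conn (φ : 𝒜) (v : 𝔩.ker) : (𝔩.conn φ v : 𝒜) = 𝔩.br φ v := rfl

theorem conn_add (φ : 𝒜) (v w : 𝔩.ker) : 𝔩.conn φ (v + w) = 𝔩.conn φ v + 𝔩.conn φ w :=
  Subtype.ext (𝔩.br_add φ v w)

theorem conn_smul (φ : 𝒜) (f : R) (v : 𝔩.ker) :
    𝔩.conn φ (f • v) = 𝔩.act φ f • v + f • 𝔩.conn φ v :=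
  Subtype.ext (𝔩.br_smul φ f v)

/-- The derivative term of the Leibniz rule is `v` acting on `f`, which is zero. This makes `φ ↦ ∇_φ
v` a 1-form that can be inserted. -/
theorem conn_smul_left (f : R) (φ : 𝒜) (v : 𝔩.ker) : 𝔩.conn (f • φ) v = f • 𝔩.conn φ v :=
  Subtype.ext (by simp [𝔩.br_smul_left, 𝔩.act_ker v v.2])

/-- `φ ↦ ∇_φ v` as a linear map. -/
def connL (v : 𝔩.ker) : 𝒜 →ₗ[R] 𝔩.ker where
  toFun φ := 𝔩.conn φ v
  map_add' φ ψ := Subtype.ext (𝔩.br_add_left φ ψ v)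
  map_smul' f φ := 𝔩.conn_smul_left f φ v

/-- The Jacobiator as a function. -/
def jacFun (φ ψ χ : 𝒜) : 𝔩.ker :=
  ⟨𝔩.br φ (𝔩.br ψ χ) + 𝔩.br ψ (𝔩.br χ φ) + 𝔩.br χ (𝔩.br φ ψ), 𝔩.jac_mem_ker φ ψ χ⟩

/-- Cyclic symmetry reduces linearity in each slot to linearity in the last one. -/
theorem jacFun_rotate (φ ψ χ : 𝒜) : 𝔩.jacFun φ ψ χ = 𝔩.jacFun ψ χ φ :=
  Subtype.ext (by simp only [jacFun]; abel)

theorem jacFun_self (φ χ : 𝒜) : 𝔩.jacFun φ φ χ = 0 := by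
  refine Subtype.ext ?_
  simp only [jacFun, br_self, ZeroMemClass.coe_zero]
  rw [𝔩.br_swap χ φ, br_neg, ← 𝔩.br_self 0]
  have h0 : 𝔩.br χ 0 = 0 := by simpa using 𝔩.br_add χ 0 0
  simp [h0, br_self]

theorem jacFun_add (φ ψ χ χ' : 𝒜) :
    𝔩.jacFun φ ψ (χ + χ') = 𝔩.jacFun φ ψ χ + 𝔩.jacFun φ ψ χ' := by
  refine Subtype.ext ?_
  simp only [jacFun, br_add, br_add_left, Submodule.coe_add]
  abel

/-- Second derivatives of `f` cancel because the action respects brackets (`act_br`); the first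
derivatives cancel in pairs, partly by skew-symmetry. -/
theorem jacFun_smul (φ ψ : 𝒜) (f : R) (χ : 𝒜) :
    𝔩.jacFun φ ψ (f • χ) = f • 𝔩.jacFun φ ψ χ := by
  refine Subtype.ext ?_
  simp only [jacFun, 𝔩.br_smul, 𝔩.br_smul_left, 𝔩.br_add, Submodule.coe_smul, smul_add,
    𝔩.act_br, sub_smul, 𝔩.br_sub]
  rw [𝔩.br_swap φ χ, smul_neg]
  abel

/-- The Jacobiator as a trilinear map. -/
def jac : 𝒜 →ₗ[R] 𝒜 →ₗ[R] 𝒜 →ₗ[R] 𝔩.ker where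
  toFun φ :=
    { toFun := fun ψ =>
        { toFun := fun χ => 𝔩.jacFun φ ψ χ
          map_add' := 𝔩.jacFun_add φ ψ
          map_smul' := 𝔩.jacFun_smul φ ψ }
      map_add' := fun ψ ψ' => by
        ext1 χ
        simp only [LinearMap.coe_mk, AddHom.coe_mk, LinearMap.add_apply]
        simp only [← 𝔩.jacFun_rotate χ φ, jacFun_add]
      map_smul' := fun f ψ => by
        ext1 χ
        simp only [LinearMap.coe_mk, AddHom.coe_mk, LinearMap.smul_apply, RingHom.id_apply]
        simp only [← 𝔩.jacFun_rotate χ φ, jacFun_smul] }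
  map_add' φ φ' := by
    ext1 ψ; ext1 χ
    simp only [LinearMap.coe_mk, AddHom.coe_mk, LinearMap.add_apply]
    simp only [𝔩.jacFun_rotate _ ψ χ, jacFun_add]
  map_smul' f φ := by
    ext1 ψ; ext1 χ
    simp only [LinearMap.coe_mk, AddHom.coe_mk, LinearMap.smul_apply, RingHom.id_apply]
    simp only [𝔩.jacFun_rotate _ ψ χ, jacFun_smul]

theorem coe_jac (φ ψ χ : 𝒜) : (𝔩.jac φ ψ χ : 𝒜) =
    𝔩.br φ (𝔩.br ψ χ) + 𝔩.br ψ (𝔩.br χ φ) + 𝔩.br χ (𝔩.br φ ψ) := rfl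

theorem jac_rotate (φ ψ χ : 𝒜) : 𝔩.jac φ ψ χ = 𝔩.jac ψ χ φ := 𝔩.jacFun_rotate φ ψ χ

@[simp] theorem jac_self (φ χ : 𝒜) : 𝔩.jac φ φ χ = 0 := 𝔩.jacFun_self φ χ

@[simp] theorem jac_self_right (φ χ : 𝒜) : 𝔩.jac χ φ φ = 0 := by rw [jac_rotate, jac_self]

/-- Commuting the connection past itself yields the Jacobiator. -/
theorem conn_conn (φ ψ : 𝒜) (v : 𝔩.ker) :
    𝔩.conn φ (𝔩.conn ψ v) - 𝔩.conn (𝔩.br φ ψ) v - 𝔩.conn ψ (𝔩.conn φ v) = -𝔩.jac φ v ψ := by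
  refine Subtype.ext ?_
  simp only [Submodule.coe_sub, Submodule.coe_neg, coe_conn, coe_jac]
  rw [𝔩.br_swap v ψ, 𝔩.br_swap ψ φ, 𝔩.br_neg, 𝔩.br_neg, 𝔩.br_swap (𝔩.br φ ψ)]
  abel

/-- The Bianchi identity for the Jacobiator. -/
theorem bianchi (φ ψ χ η : 𝒜) :
    (𝔩.conn φ (𝔩.jac ψ χ η) - 𝔩.jac ψ χ (𝔩.br φ η) - 𝔩.jac ψ (𝔩.br φ χ) η)
      - (𝔩.conn ψ (𝔩.jac φ χ η) - 𝔩.jac φ χ (𝔩.br ψ η) - 𝔩.jac φ (𝔩.br ψ χ) η)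
      - 𝔩.jac (𝔩.br φ ψ) χ η
      + (𝔩.conn χ (𝔩.jac φ ψ η) - 𝔩.jac φ ψ (𝔩.br χ η)) - 𝔩.conn η (𝔩.jac φ ψ χ) = 0 := by
  refine Subtype.ext ?_
  simp only [Submodule.coe_sub, Submodule.coe_add, coe_conn, coe_jac, 𝔩.br_add,
    ZeroMemClass.coe_zero]
  -- Skew-symmetry brings all iterated brackets to a common order. The cancellation is then formal
  -- and holds for any biadditive skew bracket.
  simp only [𝔩.br_swap χ φ, 𝔩.br_swap η φ, 𝔩.br_swap η ψ, 𝔩.br_neg, 𝔩.br_swap (𝔩.br _ _) φ,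
      𝔩.br_swap (𝔩.br _ _) ψ, 𝔩.br_swap (𝔩.br _ _) χ,
    𝔩.br_swap (𝔩.br _ _) η]
  rw [𝔩.br_swap (𝔩.br ψ χ) (𝔩.br φ η), 𝔩.br_swap (𝔩.br ψ η) (𝔩.br φ χ),
    𝔩.br_swap (𝔩.br χ η) (𝔩.br φ ψ)]
  abel

/-! ### Families of maps and the operators on them -/

/-- Families of maps on `𝒜ᵖ × kerᵠ` for all `p`, `q`. -/
abbrev Tot : Type _ := ∀ p q : ℕ, (Fin p → 𝒜) → (Fin q → 𝔩.ker) → R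

/-- Contraction with an element of `𝒜`. -/
def contr (φ : 𝒜) : 𝔩.Tot →ₗ[ℝ] 𝔩.Tot where
  toFun ξ p q ψ v := ξ (p + 1) q (Fin.cons φ ψ) v
  map_add' _ _ := rfl
  map_smul' _ _ := rfl

/-- Contraction with an element of `ker`. -/
def contrKer (v : 𝔩.ker) : 𝔩.Tot →ₗ[ℝ] 𝔩.Tot where
  toFun ξ p q ψ w := ξ p (q + 1) ψ (Fin.cons v w)
  map_add' _ _ := rfl
  map_smul' _ _ := rfl

/-- Multiplication by a scalar. -/
def mulR (f : R) : 𝔩.Tot →ₗ[ℝ] 𝔩.Tot where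
  toFun ξ p q ψ v := f * ξ p q ψ v
  map_add' ξ η := by funext p q ψ v; simp [mul_add]
  map_smul' c ξ := by funext p q ψ v; simp

/-- The connection on maps of `q` arguments in `ker`. -/
def symConn (q : ℕ) (φ : 𝒜) : ((Fin q → 𝔩.ker) → R) →ₗ[ℝ] ((Fin q → 𝔩.ker) → R) where
  toFun β v := 𝔩.act φ (β v) - ∑ k : Fin q, β (Function.update v k (𝔩.conn φ (v k)))
  map_add' β γ := by
    ext1 v
    simp only [Pi.add_apply, map_add, Finset.sum_add_distrib]
    abel
  map_smul' c β := by
    ext1 v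
    simp only [Pi.smul_apply, map_smul, RingHom.id_apply, smul_sub, Finset.smul_sum]

/-- The Lie derivative along an element of `𝒜`. -/
def lie (φ : 𝒜) : 𝔩.Tot →ₗ[ℝ] 𝔩.Tot where
  toFun ξ p q ψ v := 𝔩.symConn q φ (ξ p q ψ) v -
    ∑ i : Fin p, ξ p q (Function.update ψ i (𝔩.br φ (ψ i))) v
  map_add' ξ η := by
    funext p q ψ v
    simp only [Pi.add_apply, map_add, Finset.sum_add_distrib]
    abel
  map_smul' c ξ := by
    funext p q ψ v
    simp only [Pi.smul_apply, map_smul, RingHom.id_apply, smul_sub, Finset.smul_sum]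

/-- The exterior covariant derivative. -/
def cov : 𝔩.Tot →ₗ[ℝ] 𝔩.Tot where
  toFun ξ
    | 0, _ => 0
    | p + 1, q => koszul (𝔩.symConn q) 𝔩.br p (ξ p q)
  map_add' ξ η := by
    funext p q
    cases p with
    | zero => simp
    | succ p => exact map_add (koszul (𝔩.symConn q) 𝔩.br p) _ _
  map_smul' c ξ := by
    funext p q
    cases p with
    | zero => simp
    | succ p => exact map_smul (koszul (𝔩.symConn q) 𝔩.br p) _ _

/-- The Koszul operator restricting an argument in `𝒜` to `ker`. -/
def del : 𝔩.Tot →ₗ[ℝ] 𝔩.Tot where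
  toFun ξ
    | _, 0 => 0
    | p, q + 1 => fun ψ v =>
      ∑ j : Fin (q + 1), ξ (p + 1) q (Fin.cons (v j : 𝒜) ψ) (j.removeNth v)
  map_add' ξ η := by
    funext p q
    cases q with
    | zero => simp
    | succ q => funext ψ v; simp [Finset.sum_add_distrib]
  map_smul' c ξ := by
    funext p q
    cases q with
    | zero => simp
    | succ q => funext ψ v; simp [Finset.smul_sum]

/-- Insertion of a `ker`-valued 1-form. -/
def ins1 (θ : 𝒜 → 𝔩.ker) : 𝔩.Tot →ₗ[ℝ] 𝔩.Tot where
  toFun ξ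
    | 0, _ => 0
    | p + 1, q => fun ψ v => ∑ i : Fin (p + 1),
        (-1 : ℝ) ^ (i : ℕ) • ξ p (q + 1) (i.removeNth ψ) (Fin.cons (θ (ψ i)) v)
  map_add' ξ η := by
    funext p q
    cases p with
    | zero => simp
    | succ p => funext ψ v; simp [Finset.sum_add_distrib]
  map_smul' c ξ := by
    funext p q
    cases p with
    | zero => simp
    | succ p => funext ψ v; simp [Finset.smul_sum, smul_comm c]

/-- Insertion of a `ker`-valued 2-form. -/
def ins2 (θ : 𝒜 → 𝒜 → 𝔩.ker) : 𝔩.Tot →ₗ[ℝ] 𝔩.Tot where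
  toFun ξ
    | p + 2, q => fun ψ v => ∑ i : Fin (p + 1), ∑ j : Fin (p + 1), if i ≤ j then
        (-1 : ℝ) ^ ((i : ℕ) + (j : ℕ)) • ξ p (q + 1) (i.removeNth (j.succ.removeNth ψ))
          (Fin.cons (θ (ψ i.castSucc) (ψ j.succ)) v) else 0
    | _, _ => 0
  map_add' ξ η := by
    funext p q
    match p with
    | 0 | 1 => simp
    | p + 2 => funext ψ v; simp [Finset.sum_add_distrib, ite_add_zero]
  map_smul' c ξ := by
    funext p q
    match p with
    | 0 | 1 => simp
    | p + 2 => funext ψ v; simp [Finset.smul_sum, smul_ite, smul_comm c]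

/-- Insertion of a `ker`-valued 3-form. -/
def ins3 (θ : 𝒜 → 𝒜 → 𝒜 → 𝔩.ker) : 𝔩.Tot →ₗ[ℝ] 𝔩.Tot where
  toFun ξ
    | p + 3, q => fun ψ v =>
      ∑ i : Fin (p + 1), ∑ j : Fin (p + 1), ∑ k : Fin (p + 1), if i ≤ j ∧ j ≤ k then
        (-1 : ℝ) ^ ((i : ℕ) + (j : ℕ) + (k : ℕ)) •
          ξ p (q + 1) (i.removeNth (j.succ.removeNth (k.succ.succ.removeNth ψ)))
            (Fin.cons (θ (ψ i.castSucc.castSucc) (ψ j.succ.castSucc) (ψ k.succ.succ)) v)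
      else 0
    | _, _ => 0
  map_add' ξ η := by
    funext p q
    match p with
    | 0 | 1 | 2 => simp
    | p + 3 => funext ψ v; simp [Finset.sum_add_distrib, ite_add_zero]
  map_smul' c ξ := by
    funext p q
    match p with
    | 0 | 1 | 2 => simp
    | p + 3 => funext ψ v; simp [Finset.smul_sum, smul_ite, smul_comm c]

/-! ### Commutation of the operators with contractions -/

variable {𝔩}

theorem contr_apply (φ : 𝒜) (ξ : 𝔩.Tot) (p q : ℕ) (ψ : Fin p → 𝒜) (v) :
    𝔩.contr φ ξ p q ψ v = ξ (p + 1) q (Fin.cons φ ψ : Fin (p + 1) → 𝒜) v := rfl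

theorem contrKer_apply (w : 𝔩.ker) (ξ : 𝔩.Tot) (p q : ℕ) (ψ) (v : Fin q → 𝔩.ker) :
    𝔩.contrKer w ξ p q ψ v = ξ p (q + 1) ψ (Fin.cons w v : Fin (q + 1) → 𝔩.ker) := rfl

theorem contr_contrKer (φ : 𝒜) (v : 𝔩.ker) (ξ : 𝔩.Tot) :
    𝔩.contr φ (𝔩.contrKer v ξ) = 𝔩.contrKer v (𝔩.contr φ ξ) := rfl

theorem removeNth_succ_cons {α : Type*} {n : ℕ} (i : Fin (n + 1)) (a : α) (ψ : Fin (n + 1) → α) :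
    (i.succ.removeNth (Fin.cons a ψ : Fin (n + 2) → α) : Fin (n + 1) → α) =
      Fin.cons a (i.removeNth ψ) := by
  funext j
  cases j using Fin.cases <;> simp [Fin.removeNth]

theorem removeNth_zero_cons {α : Type*} {n : ℕ} (a : α) (ψ : Fin n → α) :
    ((0 : Fin (n + 1)).removeNth (Fin.cons a ψ : Fin (n + 1) → α) : Fin n → α) = ψ := by
  simp [Fin.tail_cons]

theorem update_succ_cons {α : Type*} {n : ℕ} (i : Fin n) (a b : α) (ψ : Fin n → α) :
    Function.update (Fin.cons a ψ : Fin (n + 1) → α) i.succ b =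
      Fin.cons a (Function.update ψ i b) := 
  (Fin.cons_update (α := fun _ => α) a ψ i b).symm

theorem update_zero_cons {α : Type*} {n : ℕ} (a b : α) (ψ : Fin n → α) :
    Function.update (Fin.cons a ψ : Fin (n + 1) → α) 0 b = Fin.cons b ψ :=
  Fin.update_cons_zero (α := fun _ => α) a ψ b

/-- The summand `i = 0` feeds `φ` to `θ`; in the others `φ` stays in front and the position in the
sign rises by one. For 2- and 3-forms the same split turns `θ` into `θ φ`, and the remaining sign is
`(-1)` to the degree of `θ`. -/
theorem contr_ins1 (θ : 𝒜 → 𝔩.ker) (φ : 𝒜) (ξ : 𝔩.Tot) :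
    𝔩.contr φ (𝔩.ins1 θ ξ) = 𝔩.contrKer (θ φ) ξ - 𝔩.ins1 θ (𝔩.contr φ ξ) := by
  funext p q ψ v
  cases p with
  | zero =>
    simp [contr, contrKer, ins1]
  | succ p =>
    simp only [contr, contrKer, ins1, LinearMap.coe_mk, AddHom.coe_mk, Pi.sub_apply]
    rw [Fin.sum_univ_succ]
    simp only [Fin.cons_zero, Fin.cons_succ, removeNth_succ_cons, removeNth_zero_cons,
      Fin.val_zero, pow_zero, one_smul, Fin.val_succ, pow_succ, mul_neg, mul_one, neg_smul,
      Finset.sum_neg_distrib, sub_eq_add_neg]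

theorem contr_ins2 (θ : 𝒜 → 𝒜 → 𝔩.ker) (φ : 𝒜) (ξ : 𝔩.Tot) :
    𝔩.contr φ (𝔩.ins2 θ ξ) = 𝔩.ins1 (θ φ) ξ + 𝔩.ins2 θ (𝔩.contr φ ξ) := by
  funext p q ψ v
  match p with
  | 0 => simp [contr, ins1, ins2]
  | 1 =>
    simp [contr, ins1, ins2]
    rfl
  | p + 2 =>
    simp only [contr, ins1, ins2, LinearMap.coe_mk, AddHom.coe_mk, Pi.add_apply]
    rw [Fin.sum_univ_succ]
    congr 1
    · refine Finset.sum_congr rfl fun j _ => ?_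
      simp [removeNth_succ_cons]
    · refine Finset.sum_congr rfl fun i _ => ?_
      rw [Fin.sum_univ_succ]
      simp only [← Fin.succ_castSucc, Fin.cons_succ, removeNth_succ_cons, Fin.succ_le_succ_iff,
        Fin.val_succ]
      rw [if_neg (by simp), zero_add]
      refine Finset.sum_congr rfl fun j _ => ?_
      congr 2
      ring

theorem contr_ins3 (θ : 𝒜 → 𝒜 → 𝒜 → 𝔩.ker) (φ : 𝒜) (ξ : 𝔩.Tot) :
    𝔩.contr φ (𝔩.ins3 θ ξ) = 𝔩.ins2 (θ φ) ξ - 𝔩.ins3 θ (𝔩.contr φ ξ) := by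
  funext p q ψ v
  match p with
  | 0 => simp [contr, ins2, ins3]
  | 1 => simp [contr, ins2, ins3]
  | 2 =>
    simp [contr, ins2, ins3]
    rfl
  | p + 3 =>
    have hz : ∀ {n : ℕ} (i : Fin (n + 1)), ¬ i.succ ≤ 0 := fun i => by simp
    simp only [contr, ins2, ins3, LinearMap.coe_mk, AddHom.coe_mk, Pi.sub_apply]
    rw [Fin.sum_univ_succ, sub_eq_add_neg]
    congr 1
    · refine Finset.sum_congr rfl fun j _ => Finset.sum_congr rfl fun k _ => ?_
      simp [removeNth_succ_cons]
    · rw [← Finset.sum_neg_distrib]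
      refine Finset.sum_congr rfl fun i _ => ?_
      rw [Fin.sum_univ_succ, ← Finset.sum_neg_distrib]
      simp only [← Fin.succ_castSucc, Fin.cons_succ, removeNth_succ_cons, Fin.succ_le_succ_iff,
        Fin.val_succ]
      rw [Finset.sum_eq_zero fun k _ => if_neg fun h => hz i h.1, zero_add]
      refine Finset.sum_congr rfl fun j _ => ?_
      rw [Fin.sum_univ_succ, if_neg fun h => hz j h.2, zero_add, ← Finset.sum_neg_distrib]
      refine Finset.sum_congr rfl fun k _ => ?_
      simp only [Fin.succ_le_succ_iff, Fin.val_succ]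
      split_ifs
      · rw [← neg_smul]
        congr 1
        ring
      · simp

theorem contr_lie (φ χ : 𝒜) (ξ : 𝔩.Tot) :
    𝔩.contr χ (𝔩.lie φ ξ) = 𝔩.lie φ (𝔩.contr χ ξ) - 𝔩.contr (𝔩.br φ χ) ξ := by
  funext p q ψ v
  simp only [contr, lie, LinearMap.coe_mk, AddHom.coe_mk, Pi.sub_apply]
  rw [Fin.sum_univ_succ]
  simp only [Fin.cons_zero, Fin.cons_succ, update_succ_cons, update_zero_cons]
  abel

theorem contrKer_lie (φ : 𝒜) (w : 𝔩.ker) (ξ : 𝔩.Tot) :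
    𝔩.contrKer w (𝔩.lie φ ξ) = 𝔩.lie φ (𝔩.contrKer w ξ) - 𝔩.contrKer (𝔩.conn φ w) ξ := by
  funext p q ψ v
  simp only [contrKer, lie, symConn, LinearMap.coe_mk, AddHom.coe_mk, Pi.sub_apply]
  rw [Fin.sum_univ_succ]
  simp only [Fin.cons_zero, Fin.cons_succ, update_succ_cons, update_zero_cons]
  abel

theorem contrKer_del (w : 𝔩.ker) (ξ : 𝔩.Tot) :
    𝔩.contrKer w (𝔩.del ξ) = 𝔩.del (𝔩.contrKer w ξ) + 𝔩.contr w ξ := by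
  funext p q ψ v
  cases q with
  | zero =>
    simp [contr, contrKer, del]
  | succ q =>
    simp only [contr, contrKer, del, LinearMap.coe_mk, AddHom.coe_mk, Pi.add_apply]
    rw [Fin.sum_univ_succ]
    simp only [Fin.cons_zero, Fin.cons_succ, removeNth_succ_cons, removeNth_zero_cons]
    abel

/-- The only term sensitive to `w` is the part of the connection that differentiates the slot of
`w`. Summed with signs, these terms are the insertion of the 1-form `ψ ↦ ∇_ψ w`. -/
theorem contrKer_cov (w : 𝔩.ker) (ξ : 𝔩.Tot) :
    𝔩.contrKer w (𝔩.cov ξ) = 𝔩.cov (𝔩.contrKer w ξ) - 𝔩.ins1 (𝔩.connL w) ξ := by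
  have key : ∀ q φ (β : (Fin (q + 1) → 𝔩.ker) → R) (v : Fin q → 𝔩.ker),
      𝔩.symConn (q + 1) φ β (Fin.cons w v) =
        𝔩.symConn q φ (fun v' => β (Fin.cons w v')) v - β (Fin.cons (𝔩.connL w φ) v) := by
    intro q φ β v
    simp only [symConn, LinearMap.coe_mk, AddHom.coe_mk]
    rw [Fin.sum_univ_succ]
    simp only [Fin.cons_zero, Fin.cons_succ, update_succ_cons, update_zero_cons, connL,
      LinearMap.coe_mk, AddHom.coe_mk]
    abel
  funext p q ψ v
  match p with
  | 0 => simp [contrKer, cov, ins1]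
  | 1 =>
    simp only [contrKer, cov, ins1, koszul, LinearMap.coe_mk, AddHom.coe_mk, Pi.sub_apply,
      Finset.sum_apply, Pi.smul_apply, key, smul_sub, Finset.sum_sub_distrib]
  | p + 2 =>
    simp only [contrKer, cov, ins1, koszul, LinearMap.coe_mk, AddHom.coe_mk, Pi.sub_apply,
      Finset.sum_apply, Pi.smul_apply, Pi.add_apply, key, smul_sub, Finset.sum_sub_distrib,
      ite_apply, Pi.zero_apply]
    abel

end AlmostLieRinehart
end

noncomputable section
namespace AlmostLieRinehart

variable {R 𝒜 : Type*} [CommRing R] [Algebra ℝ R] [AddCommGroup 𝒜] [Module R 𝒜]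
  {𝔩 : AlmostLieRinehart R 𝒜}

/-! ### Alternating and symmetric multilinear families -/

variable (𝔩) in
/-- The families of maps which are alternating `R`-multilinear in the arguments from `𝒜` and
symmetric `R`-multilinear in the arguments from `ker`. -/
def mixed : Submodule ℝ 𝔩.Tot where
  carrier := {ξ | ∀ p q,
    (∀ v, ∃ a : 𝒜 [⋀^Fin p]→ₗ[R] R, ⇑a = fun ψ => ξ p q ψ v) ∧
    ∀ ψ, ∃ b : MultilinearMap R (fun _ : Fin q => 𝔩.ker) R,
      ⇑b = ξ p q ψ ∧ ∀ (σ : Equiv.Perm (Fin q)) (v : Fin q → 𝔩.ker), b (v ∘ σ) = b v}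
  add_mem' := by
    intro ξ η h k p q
    refine ⟨fun v => ?_, fun ψ => ?_⟩
    · obtain ⟨a, ha⟩ := (h p q).1 v
      obtain ⟨b, hb⟩ := (k p q).1 v
      exact ⟨a + b, by funext ψ; simpa using congrArg₂ (· + ·) (congrFun ha ψ) (congrFun hb ψ)⟩
    · obtain ⟨a, ha, ha'⟩ := (h p q).2 ψ
      obtain ⟨b, hb, hb'⟩ := (k p q).2 ψ
      refine ⟨a + b, by funext v; simp [ha, hb], fun σ v => ?_⟩
      simp only [MultilinearMap.add_apply, ha', hb']
  zero_mem' := fun _ _ => ⟨fun _ => ⟨0, rfl⟩, fun _ => ⟨0, rfl, fun _ _ => rfl⟩⟩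
  smul_mem' := by
    intro c ξ h p q
    refine ⟨fun v => ?_, fun ψ => ?_⟩
    · obtain ⟨a, ha⟩ := (h p q).1 v
      refine ⟨algebraMap ℝ R c • a, funext fun ψ => ?_⟩
      rw [AlternatingMap.smul_apply, ha, smul_eq_mul, ← Algebra.smul_def c]
      rfl
    · obtain ⟨a, ha, ha'⟩ := (h p q).2 ψ
      refine ⟨algebraMap ℝ R c • a, funext fun v => ?_, fun σ v => ?_⟩
      · rw [MultilinearMap.smul_apply, ha, smul_eq_mul, ← Algebra.smul_def c]
        rfl
      · rw [MultilinearMap.smul_apply, MultilinearMap.smul_apply, ha']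

theorem mulR_apply (f : R) (ξ : 𝔩.Tot) (p q : ℕ) (ψ v) :
    𝔩.mulR f ξ p q ψ v = f * ξ p q ψ v := rfl

/-- The properties of contractions which characterize `mixed` as the largest submodule
satisfying them. -/
structure IsContrStable (S : Submodule ℝ 𝔩.Tot) : Prop where
  contr_mem : ∀ ξ ∈ S, ∀ φ, 𝔩.contr φ ξ ∈ S
  contrKer_mem : ∀ ξ ∈ S, ∀ v, 𝔩.contrKer v ξ ∈ S
  contr_add : ∀ ξ ∈ S, ∀ φ ψ, 𝔩.contr (φ + ψ) ξ = 𝔩.contr φ ξ + 𝔩.contr ψ ξ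
  contr_smul : ∀ ξ ∈ S, ∀ (f : R) φ, 𝔩.contr (f • φ) ξ = 𝔩.mulR f (𝔩.contr φ ξ)
  contr_self : ∀ ξ ∈ S, ∀ φ, 𝔩.contr φ (𝔩.contr φ ξ) = 0
  contrKer_add : ∀ ξ ∈ S, ∀ v w, 𝔩.contrKer (v + w) ξ = 𝔩.contrKer v ξ + 𝔩.contrKer w ξ
  contrKer_smul : ∀ ξ ∈ S, ∀ (f : R) v, 𝔩.contrKer (f • v) ξ = 𝔩.mulR f (𝔩.contrKer v ξ)
  contrKer_comm : ∀ ξ ∈ S, ∀ v w,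
    𝔩.contrKer v (𝔩.contrKer w ξ) = 𝔩.contrKer w (𝔩.contrKer v ξ)

theorem isContrStable_mixed : IsContrStable (mixed 𝔩) where
  contr_mem := by
    intro ξ h φ p q
    refine ⟨fun v => ?_, fun ψ => (h (p + 1) q).2 (Fin.cons φ ψ : Fin (p + 1) → 𝒜)⟩
    obtain ⟨a, ha⟩ := (h (p + 1) q).1 v
    exact ⟨a.curryLeft φ, funext fun ψ => congrFun ha (Fin.cons φ ψ : Fin (p + 1) → 𝒜)⟩
  contrKer_mem := by
    intro ξ h w p q
    refine ⟨fun v => (h p (q + 1)).1 (Fin.cons w v : Fin (q + 1) → 𝔩.ker), fun ψ => ?_⟩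
    obtain ⟨b, hb, hb'⟩ := (h p (q + 1)).2 ψ
    refine ⟨b.curryLeft w, funext fun v => congrFun hb (Fin.cons w v : Fin (q + 1) → 𝔩.ker),
      fun σ v => ?_⟩
    -- This permutation extends `σ` to the longer list by fixing the new slot `0`.
    have := hb' (Equiv.Perm.decomposeFin.symm (0, σ)) (Fin.cons w v)
    rw [MultilinearMap.curryLeft_apply, MultilinearMap.curryLeft_apply, ← this]
    congr 1
    funext i
    cases i using Fin.cases <;> simp
  contr_add := by
    intro ξ h φ ψ
    funext p q χ v
    obtain ⟨a, ha⟩ := (h (p + 1) q).1 v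
    have e : ∀ x, ξ (p + 1) q x v = a x := fun x => (congrFun ha x).symm
    simp only [Pi.add_apply, contr_apply, e]
    exact a.map_vecCons_add χ φ ψ
  contr_smul := by
    intro ξ h f φ
    funext p q χ v
    obtain ⟨a, ha⟩ := (h (p + 1) q).1 v
    have e : ∀ x, ξ (p + 1) q x v = a x := fun x => (congrFun ha x).symm
    simp only [mulR_apply, contr_apply, e]
    exact a.map_vecCons_smul χ f φ
  contr_self := by
    intro ξ h φ
    funext p q χ v
    obtain ⟨a, ha⟩ := (h (p + 2) q).1 v
    have e : ∀ x, ξ (p + 2) q x v = a x := fun x => (congrFun ha x).symm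
    simp only [contr_apply, e]
    exact a.map_eq_zero_of_eq _ (by simp) Fin.zero_ne_one
  contrKer_add := by
    intro ξ h v w
    funext p q ψ u
    obtain ⟨b, hb, -⟩ := (h p (q + 1)).2 ψ
    simp only [Pi.add_apply, contrKer_apply, ← hb]
    exact b.cons_add u v w
  contrKer_smul := by
    intro ξ h f v
    funext p q ψ u
    obtain ⟨b, hb, -⟩ := (h p (q + 1)).2 ψ
    simp only [mulR_apply, contrKer_apply, ← hb]
    exact b.cons_smul u f v
  contrKer_comm := by
    intro ξ h v w
    funext p q ψ u
    obtain ⟨b, hb, hb'⟩ := (h p (q + 2)).2 ψ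
    simp only [contrKer_apply, ← hb]
    rw [← hb' (Equiv.swap 0 1)]
    congr 1
    funext i
    refine Fin.cases ?_ (fun i => Fin.cases ?_ (fun i => ?_) i) i
    · simp
    · simp
    · rw [Function.comp_apply, Equiv.swap_apply_of_ne_of_ne (by simp)
        (by simp [Fin.ext_iff])]
      simp

namespace IsContrStable

variable {S : Submodule ℝ 𝔩.Tot} (hS : IsContrStable S)
include hS

theorem contr_anticomm {ξ : 𝔩.Tot} (h : ξ ∈ S) (φ ψ : 𝒜) :
    𝔩.contr φ (𝔩.contr ψ ξ) = -𝔩.contr ψ (𝔩.contr φ ξ) := by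
  have h1 := hS.contr_self ξ h (φ + ψ)
  rw [hS.contr_add ξ h, map_add, hS.contr_add _ (hS.contr_mem ξ h φ),
    hS.contr_add _ (hS.contr_mem ξ h ψ), hS.contr_self ξ h, hS.contr_self ξ h, zero_add,
    add_zero] at h1
  rw [eq_neg_iff_add_eq_zero, add_comm]
  exact h1

/-- Contraction lowers `p` and stays inside `S`, so induction over all members of `S` at once gives
an alternating map for each first argument. It depends linearly on that argument and can be
uncurried. -/
theorem exists_alternating (p : ℕ) : ∀ (q : ℕ), ∀ ξ ∈ S, ∀ v,
    ∃ a : 𝒜 [⋀^Fin p]→ₗ[R] R, ⇑a = fun ψ => ξ p q ψ v := by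
  induction p with
  | zero =>
    intro q ξ _ v
    refine ⟨AlternatingMap.constOfIsEmpty R 𝒜 (Fin 0) (ξ 0 q Fin.elim0 v), funext fun ψ => ?_⟩
    rw [AlternatingMap.constOfIsEmpty_apply, Subsingleton.elim ψ Fin.elim0]
    rfl
  | succ p ih =>
    intro q ξ h v
    choose a ha using fun φ => ih q (𝔩.contr φ ξ) (hS.contr_mem ξ h φ) v
    have e : ∀ φ ψ, ξ (p + 1) q (Fin.cons φ ψ) v = a φ ψ := fun φ ψ => (congrFun (ha φ) ψ).symm
    have eadd : ∀ φ φ' ψ, a (φ + φ') ψ = a φ ψ + a φ' ψ := fun φ φ' ψ => by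
      simp only [← e]
      exact congrFun (congrFun (congrFun (congrFun (hS.contr_add ξ h φ φ') p) q) ψ) v
    have esmul : ∀ (f : R) φ ψ, a (f • φ) ψ = f * a φ ψ := fun f φ ψ => by
      simp only [← e]
      exact congrFun (congrFun (congrFun (congrFun (hS.contr_smul ξ h f φ) p) q) ψ) v
    let A : 𝒜 →ₗ[R] 𝒜 [⋀^Fin p]→ₗ[R] R :=
      { toFun := a
        map_add' := fun φ φ' => AlternatingMap.ext (eadd φ φ')
        map_smul' := fun f φ => AlternatingMap.ext (esmul f φ) }
    let m : MultilinearMap R (fun _ : Fin (p + 1) => 𝒜) R :=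
      LinearMap.uncurryLeft (AlternatingMap.toMultilinearMapLM (S := R) ∘ₗ A)
    have hm : ∀ ψ, m ψ = ξ (p + 1) q ψ v := fun ψ => by
      conv_rhs => rw [← Fin.cons_self_tail ψ, e]
      rfl
    -- Only a repetition involving the first argument is new. A transposition of the tail moves the
    -- equal argument next to it, at most changing the sign, and the double contraction vanishes.
    have m0 : ∀ (ψ : Fin (p + 1) → 𝒜) (j : Fin p), ψ 0 = ψ j.succ → m ψ = 0 := by
      intro ψ j hj
      obtain ⟨p, rfl⟩ : ∃ p', p = p' + 1 := ⟨p - 1, by have := j.2; omega⟩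
      have h1 : m ψ = a (ψ 0) (Fin.tail ψ) := by
        rw [hm, ← e, Fin.cons_self_tail]
      have h2 : a (ψ 0) (Fin.tail ψ ∘ Equiv.swap 0 j) = 0 := by
        rw [← e, ← Fin.cons_self_tail (Fin.tail ψ ∘ Equiv.swap 0 j)]
        have : (Fin.tail ψ ∘ Equiv.swap 0 j) 0 = ψ 0 := by simp [Fin.tail, hj]
        rw [this]
        exact congrFun (congrFun (congrFun (congrFun (hS.contr_self ξ h (ψ 0)) p) q) _) v
      rw [h1]
      by_cases h0 : (0 : Fin (p + 1)) = j
      · rw [← h0, Equiv.swap_self] at h2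
        exact h2
      · rw [AlternatingMap.map_swap _ _ h0, neg_eq_zero] at h2
        exact h2
    refine ⟨{ m with map_eq_zero_of_eq' := ?_ }, funext hm⟩
    intro ψ i j hij hne
    change m ψ = 0
    induction i using Fin.cases with
    | zero =>
      induction j using Fin.cases with
      | zero => exact absurd rfl hne
      | succ j => exact m0 ψ j hij
    | succ i =>
      induction j using Fin.cases with
      | zero => exact m0 ψ i hij.symm
      | succ j =>
        rw [hm, ← Fin.cons_self_tail ψ, e]
        exact (a (ψ 0)).map_eq_zero_of_eq _ hij (fun h => hne (by rw [h]))

theorem exists_symmetric (q : ℕ) : ∀ (p : ℕ), ∀ ξ ∈ S, ∀ ψ,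
    ∃ b : MultilinearMap R (fun _ : Fin q => 𝔩.ker) R,
      ⇑b = ξ p q ψ ∧ ∀ (σ : Equiv.Perm (Fin q)) (v : Fin q → 𝔩.ker), b (v ∘ σ) = b v := by
  induction q with
  | zero =>
    intro p ξ _ ψ
    refine ⟨MultilinearMap.constOfIsEmpty R _ (ξ p 0 ψ Fin.elim0), funext fun v => ?_,
      fun σ v => congrArg _ (Subsingleton.elim _ _)⟩
    rw [MultilinearMap.constOfIsEmpty_apply, Subsingleton.elim v Fin.elim0]
    rfl
  | succ q ih =>
    intro p ξ h ψ
    choose b hb hb' using fun w => ih p (𝔩.contrKer w ξ) (hS.contrKer_mem ξ h w) ψ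
    have e : ∀ w v, ξ p (q + 1) ψ (Fin.cons w v) = b w v := fun w v => (congrFun (hb w) v).symm
    have eadd : ∀ φ φ' ψ, b (φ + φ') ψ = b φ ψ + b φ' ψ := fun φ φ' v => by
      simp only [← e]
      exact congrFun (congrFun (congrFun (congrFun (hS.contrKer_add ξ h φ φ') p) q) ψ) v
    have esmul : ∀ (f : R) φ ψ, b (f • φ) ψ = f * b φ ψ := fun f φ v => by
      simp only [← e]
      exact congrFun (congrFun (congrFun (congrFun (hS.contrKer_smul ξ h f φ) p) q) ψ) v
    let A : 𝔩.ker →ₗ[R] MultilinearMap R (fun _ : Fin q => 𝔩.ker) R :=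
      { toFun := b
        map_add' := fun φ φ' => MultilinearMap.ext (eadd φ φ')
        map_smul' := fun f φ => MultilinearMap.ext (esmul f φ) }
    let m : MultilinearMap R (fun _ : Fin (q + 1) => 𝔩.ker) R := LinearMap.uncurryLeft A
    have hm : ∀ v, m v = ξ p (q + 1) ψ v := fun v => by
      conv_rhs => rw [← Fin.cons_self_tail v, e]
      rfl
    refine ⟨m, funext hm, fun σ => ?_⟩
    cases q with
    | zero => 
      exact fun v => congrArg m (funext fun i => congrArg v (Subsingleton.elim (α := Fin 1) _ _))
    | succ q =>
      -- Adjacent transpositions suffice: the one of the first two slots is `contrKer_comm`, and the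
      -- others fix slot `0` and come from the induction hypothesis.
      have hσ : σ ∈ Submonoid.closure
          (Set.range fun i : Fin (q + 1) => Equiv.swap i.castSucc i.succ) := by
        rw [Equiv.Perm.mclosure_swap_castSucc_succ]; trivial
      induction hσ using Submonoid.closure_induction with
      | one => exact fun _ => rfl
      | mul σ τ _ _ hσ hτ =>
        intro v
        rw [Equiv.Perm.coe_mul, ← Function.comp_assoc, hτ, hσ]
      | mem σ hσ =>
        obtain ⟨i, rfl⟩ := hσ
        intro v
        rw [hm, hm]
        induction i using Fin.cases with
        | zero =>
          have h1 := congrFun (congrFun (congrFun (congrFun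
            (hS.contrKer_comm ξ h (v 0) (v 1)) p) q) ψ) (Fin.tail (Fin.tail v))
          simp only [contrKer_apply] at h1
          convert! h1 using 2
          · funext j
            refine Fin.cases ?_ (fun j => Fin.cases ?_ (fun j => ?_) j) j
            · simp
            · simp
            · rw [Function.comp_apply, Equiv.swap_apply_of_ne_of_ne (by simp)
                (by simp [Fin.ext_iff])]
              simp [Fin.tail]
          · funext j
            refine Fin.cases ?_ (fun j => Fin.cases ?_ (fun j => ?_) j) j <;> simp [Fin.tail]
        | succ i =>
          have h1 := hb' (v 0) (Equiv.swap i.castSucc i.succ) (Fin.tail v)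
          rw [← e, ← e, Fin.cons_self_tail] at h1
          rw [← h1]
          congr 1
          funext j
          refine Fin.cases ?_ (fun j => ?_) j
          · rw [Function.comp_apply, Equiv.swap_apply_of_ne_of_ne]
            · simp
            · simp [Fin.ext_iff]
            · simp [Fin.ext_iff]
          · simp only [Fin.cons_succ, Function.comp_apply, Fin.tail]
            rw [← Fin.succ_castSucc, (Fin.succ_injective _).swap_apply]

/-- Coinduction principle for `mixed`. -/
theorem le_mixed : S ≤ mixed 𝔩 := fun ξ h p q =>
  ⟨hS.exists_alternating p q ξ h, hS.exists_symmetric q p ξ h⟩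

end IsContrStable

/-- A criterion for an operator to preserve `mixed`. -/
theorem map_mem_mixed (T : 𝔩.Tot →ₗ[ℝ] 𝔩.Tot)
    (h1 : ∀ ξ ∈ mixed 𝔩, ∀ φ, ∃ η ∈ mixed 𝔩, 𝔩.contr φ (T ξ) - T η ∈ mixed 𝔩)
    (h2 : ∀ ξ ∈ mixed 𝔩, ∀ v, ∃ η ∈ mixed 𝔩, 𝔩.contrKer v (T ξ) - T η ∈ mixed 𝔩)
    (h3 : ∀ ξ ∈ mixed 𝔩, ∀ φ ψ, 𝔩.contr (φ + ψ) (T ξ) = 𝔩.contr φ (T ξ) + 𝔩.contr ψ (T ξ))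
    (h4 : ∀ ξ ∈ mixed 𝔩, ∀ (f : R) φ, 𝔩.contr (f • φ) (T ξ) = 𝔩.mulR f (𝔩.contr φ (T ξ)))
    (h5 : ∀ ξ ∈ mixed 𝔩, ∀ φ, 𝔩.contr φ (𝔩.contr φ (T ξ)) = 0)
    (h6 : ∀ ξ ∈ mixed 𝔩, ∀ v w,
      𝔩.contrKer (v + w) (T ξ) = 𝔩.contrKer v (T ξ) + 𝔩.contrKer w (T ξ))
    (h7 : ∀ ξ ∈ mixed 𝔩, ∀ (f : R) v,
      𝔩.contrKer (f • v) (T ξ) = 𝔩.mulR f (𝔩.contrKer v (T ξ)))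
    (h8 : ∀ ξ ∈ mixed 𝔩, ∀ v w,
      𝔩.contrKer v (𝔩.contrKer w (T ξ)) = 𝔩.contrKer w (𝔩.contrKer v (T ξ)))
    {ξ : 𝔩.Tot} (hξ : ξ ∈ mixed 𝔩) : T ξ ∈ mixed 𝔩 := by
  have hm := isContrStable_mixed (𝔩 := 𝔩)
  have aux : ∀ x ∈ mixed 𝔩 ⊔ (mixed 𝔩).map T, ∃ ζ ∈ mixed 𝔩, ∃ η ∈ mixed 𝔩, x = ζ + T η := by
    intro x hx
    obtain ⟨ζ, hζ, _, ⟨η, hη, rfl⟩, rfl⟩ := Submodule.mem_sup.1 hx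
    exact ⟨ζ, hζ, η, hη, rfl⟩
  have mem : ∀ x, (∃ η ∈ mixed 𝔩, x - T η ∈ mixed 𝔩) → x ∈ mixed 𝔩 ⊔ (mixed 𝔩).map T := by
    rintro x ⟨η, hη, hx⟩
    rw [← sub_add_cancel x (T η)]
    exact add_mem (Submodule.mem_sup_left hx)
      (Submodule.mem_sup_right (Submodule.mem_map_of_mem hη))
  -- The image of `T` alone need not be stable under contractions, but its sum with `mixed 𝔩` is, by
  -- `h1` and `h2`.
  refine IsContrStable.le_mixed (S := mixed 𝔩 ⊔ (mixed 𝔩).map T)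
    ⟨fun x hx φ => ?_, fun x hx v => ?_, fun x hx φ ψ => ?_, fun x hx f φ => ?_,
      fun x hx φ => ?_, fun x hx v w => ?_, fun x hx f v => ?_, fun x hx v w => ?_⟩
    (Submodule.mem_sup_right (Submodule.mem_map_of_mem hξ)) <;>
  obtain ⟨ζ, hζ, η, hη, rfl⟩ := aux x hx
  · rw [map_add]
    exact add_mem (Submodule.mem_sup_left (hm.contr_mem ζ hζ φ)) (mem _ (h1 η hη φ))
  · rw [map_add]
    exact add_mem (Submodule.mem_sup_left (hm.contrKer_mem ζ hζ v)) (mem _ (h2 η hη v))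
  · simp only [map_add, hm.contr_add ζ hζ, h3 η hη]; abel
  · simp only [map_add, hm.contr_smul ζ hζ, h4 η hη]
  · simp only [map_add, hm.contr_self ζ hζ, h5 η hη, add_zero]
  · simp only [map_add, hm.contrKer_add ζ hζ, h6 η hη]; abel
  · simp only [map_add, hm.contrKer_smul ζ hζ, h7 η hη]
  · simp only [map_add, hm.contrKer_comm ζ hζ v w, h8 η hη v w]

/-! ### Contractions of the operators on mixed families -/

theorem contr_mulR (φ : 𝒜) (f : R) (ξ : 𝔩.Tot) :
    𝔩.contr φ (𝔩.mulR f ξ) = 𝔩.mulR f (𝔩.contr φ ξ) := rfl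

theorem contrKer_mulR (v : 𝔩.ker) (f : R) (ξ : 𝔩.Tot) :
    𝔩.contrKer v (𝔩.mulR f ξ) = 𝔩.mulR f (𝔩.contrKer v ξ) := rfl

theorem mulR_mulR (f g : R) (ξ : 𝔩.Tot) : 𝔩.mulR f (𝔩.mulR g ξ) = 𝔩.mulR g (𝔩.mulR f ξ) := by
  funext p q ψ v
  simp only [mulR_apply]
  ring

theorem mulR_mem {ξ : 𝔩.Tot} (hξ : ξ ∈ mixed 𝔩) (f : R) : 𝔩.mulR f ξ ∈ mixed 𝔩 := by
  have hm := isContrStable_mixed (𝔩 := 𝔩)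
  refine map_mem_mixed (𝔩.mulR f) (fun ξ h φ => ⟨_, hm.contr_mem ξ h φ, ?_⟩)
    (fun ξ h v => ⟨_, hm.contrKer_mem ξ h v, ?_⟩) (fun ξ h φ ψ => ?_) (fun ξ h g φ => ?_)
    (fun ξ h φ => ?_) (fun ξ h v w => ?_) (fun ξ h g v => ?_) (fun ξ h v w => ?_) hξ
  · rw [contr_mulR, sub_self]; exact zero_mem _
  · rw [contrKer_mulR, sub_self]; exact zero_mem _
  · simp only [contr_mulR, hm.contr_add ξ h, map_add]
  · simp only [contr_mulR, hm.contr_smul ξ h, mulR_mulR]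
  · simp only [contr_mulR, hm.contr_self ξ h, map_zero]
  · simp only [contrKer_mulR, hm.contrKer_add ξ h, map_add]
  · simp only [contrKer_mulR, hm.contrKer_smul ξ h, mulR_mulR]
  · simp only [contrKer_mulR, hm.contrKer_comm ξ h v w]

theorem mixed_cons_swap {ξ : 𝔩.Tot} (hξ : ξ ∈ mixed 𝔩) (p q : ℕ) (φ ψ : 𝒜) (χ : Fin p → 𝒜) (v) :
    ξ (p + 2) q (Fin.cons φ (Fin.cons ψ χ : Fin (p + 1) → 𝒜) : Fin (p + 2) → 𝒜) v =
      -ξ (p + 2) q (Fin.cons ψ (Fin.cons φ χ : Fin (p + 1) → 𝒜) : Fin (p + 2) → 𝒜) v :=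
  congrFun (congrFun (congrFun (congrFun
    (isContrStable_mixed.contr_anticomm hξ ψ φ) p) q) χ) v

theorem mixed_cons_swap_ker {ξ : 𝔩.Tot} (hξ : ξ ∈ mixed 𝔩) (p q : ℕ) (v w : 𝔩.ker) (χ)
    (u : Fin q → 𝔩.ker) :
    ξ p (q + 2) χ (Fin.cons v (Fin.cons w u : Fin (q + 1) → 𝔩.ker) : Fin (q + 2) → 𝔩.ker) =
      ξ p (q + 2) χ (Fin.cons w (Fin.cons v u : Fin (q + 1) → 𝔩.ker) : Fin (q + 2) → 𝔩.ker) :=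
  congrFun (congrFun (congrFun (congrFun
    (isContrStable_mixed.contrKer_comm ξ hξ w v) p) q) χ) u

/-- Moving the `j`-th argument to the front is a cycle of sign `(-1)^j`. -/
theorem mixed_cons_removeNth {ξ : 𝔩.Tot} (hξ : ξ ∈ mixed 𝔩) (p q : ℕ) (j : Fin (p + 1)) (x : 𝒜)
    (ψ : Fin (p + 1) → 𝒜) (v) :
    ξ (p + 1) q (Function.update ψ j x) v =
      (-1 : ℝ) ^ (j : ℕ) • ξ (p + 1) q (Fin.cons x (j.removeNth ψ)) v := by
  obtain ⟨a, ha⟩ := (hξ (p + 1) q).1 v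
  have e : ∀ x, ξ (p + 1) q x v = a x := fun x => (congrFun ha x).symm
  rw [e, e, ← Fin.insertNth_removeNth, AlternatingMap.map_insertNth]
  obtain h | h := Nat.even_or_odd (j : ℕ) <;> simp only [h.neg_one_pow] <;> simp <;> rfl

theorem contrKer_ins1 (θ : 𝒜 → 𝔩.ker) (w : 𝔩.ker) {ξ : 𝔩.Tot} (hξ : ξ ∈ mixed 𝔩) :
    𝔩.contrKer w (𝔩.ins1 θ ξ) = 𝔩.ins1 θ (𝔩.contrKer w ξ) := by
  funext p q ψ v
  cases p with
  | zero => rfl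
  | succ p =>
    simp only [contrKer, ins1, LinearMap.coe_mk, AddHom.coe_mk, mixed_cons_swap_ker hξ _ _ w]

theorem contrKer_ins2 (θ : 𝒜 → 𝒜 → 𝔩.ker) (w : 𝔩.ker) {ξ : 𝔩.Tot} (hξ : ξ ∈ mixed 𝔩) :
    𝔩.contrKer w (𝔩.ins2 θ ξ) = 𝔩.ins2 θ (𝔩.contrKer w ξ) := by
  funext p q ψ v
  match p with
  | 0 | 1 => rfl
  | p + 2 =>
    simp only [contrKer, ins2, LinearMap.coe_mk, AddHom.coe_mk, mixed_cons_swap_ker hξ _ _ w]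

theorem contrKer_ins3 (θ : 𝒜 → 𝒜 → 𝒜 → 𝔩.ker) (w : 𝔩.ker) {ξ : 𝔩.Tot} (hξ : ξ ∈ mixed 𝔩) :
    𝔩.contrKer w (𝔩.ins3 θ ξ) = 𝔩.ins3 θ (𝔩.contrKer w ξ) := by
  funext p q ψ v
  match p with
  | 0 | 1 | 2 => rfl
  | p + 3 =>
    simp only [contrKer, ins3, LinearMap.coe_mk, AddHom.coe_mk, mixed_cons_swap_ker hξ _ _ w]

theorem contr_del (φ : 𝒜) {ξ : 𝔩.Tot} (hξ : ξ ∈ mixed 𝔩) :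
    𝔩.contr φ (𝔩.del ξ) = -𝔩.del (𝔩.contr φ ξ) := by
  funext p q ψ v
  match q with
  | 0 => simp [contr, del]
  | q + 1 =>
    simp only [contr, del, LinearMap.coe_mk, AddHom.coe_mk, mixed_cons_swap hξ _ _ _ φ,
      Pi.neg_apply, Finset.sum_neg_distrib]

/-- Cartan's formula. The terms with `i = 0` in both sums form the Lie derivative, once alternation
has put `[φ, ψⱼ]` back into slot `j`. In the other terms `φ` is a spectator and the sign flips. -/
theorem contr_cov (φ : 𝒜) {ξ : 𝔩.Tot} (hξ : ξ ∈ mixed 𝔩) :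
    𝔩.contr φ (𝔩.cov ξ) = 𝔩.lie φ ξ - 𝔩.cov (𝔩.contr φ ξ) := by
  funext p q ψ v
  have hs : ∀ (p : ℕ) (c : 𝒜) (χ : Fin p → 𝒜) (s : ℕ),
      (-1 : ℝ) ^ (s + 1) • 𝔩.symConn q c (ξ (p + 1) q (Fin.cons φ χ)) v =
        -((-1 : ℝ) ^ s • 𝔩.symConn q c (𝔩.contr φ ξ p q χ) v) := by
    intro p c χ s
    rw [pow_succ, mul_neg_one, neg_smul]
    rfl
  have hu : ∀ (p : ℕ) (ψ : Fin (p + 1) → 𝒜) (j : Fin (p + 1)) (x : 𝒜),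
      (-1 : ℝ) ^ ((j : ℕ) + 1) • ξ (p + 1) q (Fin.cons x (j.removeNth ψ)) v =
        -ξ (p + 1) q (Function.update ψ j x) v := by
    intro p ψ j x
    rw [mixed_cons_removeNth hξ, pow_succ, mul_neg_one, neg_smul]
  have h1 : ∀ (p : ℕ) (ψ : Fin (p + 1) → 𝒜),
      ∑ i : Fin (p + 2), (-1 : ℝ) ^ (i : ℕ) •
          𝔩.symConn q ((Fin.cons φ ψ : Fin (p + 2) → 𝒜) i)
            (ξ (p + 1) q (i.removeNth (Fin.cons φ ψ : Fin (p + 2) → 𝒜))) v =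
        𝔩.symConn q φ (ξ (p + 1) q ψ) v - ∑ i : Fin (p + 1), (-1 : ℝ) ^ (i : ℕ) •
          𝔩.symConn q (ψ i) (𝔩.contr φ ξ p q (i.removeNth ψ)) v := by
    intro p ψ
    rw [Fin.sum_univ_succ, sub_eq_add_neg, ← Finset.sum_neg_distrib]
    simp only [Fin.cons_zero, removeNth_zero_cons, Fin.cons_succ, removeNth_succ_cons,
      Fin.val_succ, hs, Fin.val_zero, pow_zero, one_smul]
  match p with
  | 0 =>
    simp [contr, cov, lie, koszul]
  | 1 =>
    have h2 : ∑ i : Fin (0 + 1), ∑ j : Fin (0 + 1), (if i ≤ j then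
          (-1 : ℝ) ^ ((i.castSucc : ℕ) + (j.succ : ℕ)) •
            ξ (0 + 1) q (Fin.cons (𝔩.br ((Fin.cons φ ψ : Fin (0 + 2) → 𝒜) i.castSucc)
              ((Fin.cons φ ψ : Fin (0 + 2) → 𝒜) j.succ)) (i.removeNth
                (j.succ.removeNth (Fin.cons φ ψ : Fin (0 + 2) → 𝒜)))) v else 0) =
        -∑ j : Fin (0 + 1), ξ (0 + 1) q (Function.update ψ j (𝔩.br φ (ψ j))) v := by
      rw [Fin.sum_univ_succ, ← Finset.sum_neg_distrib]
      simp only [Finset.univ_eq_empty (α := Fin 0), Finset.sum_empty, add_zero]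
      refine Finset.sum_congr rfl fun j _ => ?_
      rw [if_pos (Fin.zero_le j), ← hu]
      simp [removeNth_succ_cons]
    simp only [contr_apply, cov, lie, koszul, LinearMap.coe_mk, AddHom.coe_mk, Pi.sub_apply,
      Pi.add_apply, Finset.sum_apply, Pi.smul_apply, ite_apply, Pi.zero_apply, h1, h2]
    abel
  | p + 2 =>
    have h2 : ∑ i : Fin (p + 2), ∑ j : Fin (p + 2), (if i ≤ j then
          (-1 : ℝ) ^ ((i.castSucc : ℕ) + (j.succ : ℕ)) •
            ξ (p + 2) q (Fin.cons (𝔩.br ((Fin.cons φ ψ : Fin (p + 3) → 𝒜) i.castSucc)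
              ((Fin.cons φ ψ : Fin (p + 3) → 𝒜) j.succ)) (i.removeNth
                (j.succ.removeNth (Fin.cons φ ψ : Fin (p + 3) → 𝒜)))) v else 0) =
        -(∑ j : Fin (p + 2), ξ (p + 2) q (Function.update ψ j (𝔩.br φ (ψ j))) v) -
          ∑ i : Fin (p + 1), ∑ j : Fin (p + 1), (if i ≤ j then
            (-1 : ℝ) ^ ((i.castSucc : ℕ) + (j.succ : ℕ)) •
              𝔩.contr φ ξ (p + 1) q (Fin.cons (𝔩.br (ψ i.castSucc) (ψ j.succ)) (i.removeNth
                (j.succ.removeNth ψ))) v else 0) := by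
      rw [Fin.sum_univ_succ, sub_eq_add_neg]
      congr 1
      · rw [← Finset.sum_neg_distrib]
        refine Finset.sum_congr rfl fun j _ => ?_
        rw [if_pos (Fin.zero_le j), ← hu]
        simp [removeNth_succ_cons]
      · rw [← Finset.sum_neg_distrib]
        refine Finset.sum_congr rfl fun i _ => ?_
        rw [Fin.sum_univ_succ, if_neg (by simp), zero_add, ← Finset.sum_neg_distrib]
        refine Finset.sum_congr rfl fun j _ => ?_
        simp only [← Fin.succ_castSucc, Fin.cons_succ, removeNth_succ_cons,
          Fin.succ_le_succ_iff, Fin.val_succ]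
        split_ifs
        · rw [mixed_cons_swap hξ, contr_apply, smul_neg]
          congr 2
          ring
        · simp
    simp only [cov, contr_apply, lie, koszul, LinearMap.coe_mk, AddHom.coe_mk, Pi.sub_apply,
      Pi.add_apply, Finset.sum_apply, Pi.smul_apply, ite_apply, Pi.zero_apply, h1, h2]
    abel

/-! ### Linearity over the scalars -/

theorem ins1_mulR (θ : 𝒜 → 𝔩.ker) (f : R) (ξ : 𝔩.Tot) :
    𝔩.ins1 θ (𝔩.mulR f ξ) = 𝔩.mulR f (𝔩.ins1 θ ξ) := by
  funext p q ψ v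
  match p with
  | 0 => simp [ins1, mulR]
  | p + 1 => simp [ins1, mulR, Finset.mul_sum]

theorem ins2_mulR (θ : 𝒜 → 𝒜 → 𝔩.ker) (f : R) (ξ : 𝔩.Tot) :
    𝔩.ins2 θ (𝔩.mulR f ξ) = 𝔩.mulR f (𝔩.ins2 θ ξ) := by
  funext p q ψ v
  match p with
  | 0 | 1 => simp [ins2, mulR]
  | p + 2 => simp [ins2, mulR, Finset.mul_sum]

theorem ins3_mulR (θ : 𝒜 → 𝒜 → 𝒜 → 𝔩.ker) (f : R) (ξ : 𝔩.Tot) :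
    𝔩.ins3 θ (𝔩.mulR f ξ) = 𝔩.mulR f (𝔩.ins3 θ ξ) := by
  funext p q ψ v
  match p with
  | 0 | 1 | 2 => simp [ins3, mulR]
  | p + 3 => simp [ins3, mulR, Finset.mul_sum]

theorem del_mulR (f : R) (ξ : 𝔩.Tot) : 𝔩.del (𝔩.mulR f ξ) = 𝔩.mulR f (𝔩.del ξ) := by
  funext p q ψ v
  match q with
  | 0 => simp [del, mulR]
  | q + 1 => simp [del, mulR, Finset.mul_sum]

theorem lie_mulR (φ : 𝒜) (f : R) (ξ : 𝔩.Tot) :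
    𝔩.lie φ (𝔩.mulR f ξ) = 𝔩.mulR (𝔩.act φ f) ξ + 𝔩.mulR f (𝔩.lie φ ξ) := by
  funext p q ψ v
  simp only [lie, symConn, mulR, LinearMap.coe_mk, AddHom.coe_mk, Pi.add_apply, 𝔩.act_mul,
    ← Finset.mul_sum]
  ring

/-! ### The operators preserve mixed families -/

theorem contr_mem {ξ : 𝔩.Tot} (hξ : ξ ∈ mixed 𝔩) (φ : 𝒜) : 𝔩.contr φ ξ ∈ mixed 𝔩 :=
  isContrStable_mixed.contr_mem ξ hξ φ

theorem contrKer_mem {ξ : 𝔩.Tot} (hξ : ξ ∈ mixed 𝔩) (v : 𝔩.ker) : 𝔩.contrKer v ξ ∈ mixed 𝔩 :=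
  isContrStable_mixed.contrKer_mem ξ hξ v

theorem contr_add {ξ : 𝔩.Tot} (hξ : ξ ∈ mixed 𝔩) (φ ψ : 𝒜) :
    𝔩.contr (φ + ψ) ξ = 𝔩.contr φ ξ + 𝔩.contr ψ ξ :=
  isContrStable_mixed.contr_add ξ hξ φ ψ

theorem contr_smul {ξ : 𝔩.Tot} (hξ : ξ ∈ mixed 𝔩) (f : R) (φ : 𝒜) :
    𝔩.contr (f • φ) ξ = 𝔩.mulR f (𝔩.contr φ ξ) :=
  isContrStable_mixed.contr_smul ξ hξ f φ

theorem contr_self {ξ : 𝔩.Tot} (hξ : ξ ∈ mixed 𝔩) (φ : 𝒜) : 𝔩.contr φ (𝔩.contr φ ξ) = 0 :=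
  isContrStable_mixed.contr_self ξ hξ φ

theorem contrKer_add {ξ : 𝔩.Tot} (hξ : ξ ∈ mixed 𝔩) (v w : 𝔩.ker) :
    𝔩.contrKer (v + w) ξ = 𝔩.contrKer v ξ + 𝔩.contrKer w ξ :=
  isContrStable_mixed.contrKer_add ξ hξ v w

theorem contrKer_smul {ξ : 𝔩.Tot} (hξ : ξ ∈ mixed 𝔩) (f : R) (v : 𝔩.ker) :
    𝔩.contrKer (f • v) ξ = 𝔩.mulR f (𝔩.contrKer v ξ) :=
  isContrStable_mixed.contrKer_smul ξ hξ f v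

theorem contrKer_comm {ξ : 𝔩.Tot} (hξ : ξ ∈ mixed 𝔩) (v w : 𝔩.ker) :
    𝔩.contrKer v (𝔩.contrKer w ξ) = 𝔩.contrKer w (𝔩.contrKer v ξ) :=
  isContrStable_mixed.contrKer_comm ξ hξ v w

theorem contr_anticomm {ξ : 𝔩.Tot} (hξ : ξ ∈ mixed 𝔩) (φ ψ : 𝒜) :
    𝔩.contr φ (𝔩.contr ψ ξ) = -𝔩.contr ψ (𝔩.contr φ ξ) :=
  isContrStable_mixed.contr_anticomm hξ φ ψ

theorem mulR_zero (ξ : 𝔩.Tot) : 𝔩.mulR 0 ξ = 0 := by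
  funext p q ψ v
  simp [mulR_apply]

theorem contr_zero {ξ : 𝔩.Tot} (hξ : ξ ∈ mixed 𝔩) : 𝔩.contr 0 ξ = 0 := by
  rw [← zero_smul R (0 : 𝒜), contr_smul hξ, mulR_zero]

theorem contrKer_zero {ξ : 𝔩.Tot} (hξ : ξ ∈ mixed 𝔩) : 𝔩.contrKer 0 ξ = 0 := by
  rw [← zero_smul R (0 : 𝔩.ker), contrKer_smul hξ, mulR_zero]

theorem contr_sub {ξ : 𝔩.Tot} (hξ : ξ ∈ mixed 𝔩) (φ ψ : 𝒜) :
    𝔩.contr (φ - ψ) ξ = 𝔩.contr φ ξ - 𝔩.contr ψ ξ := by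
  rw [eq_sub_iff_add_eq, ← contr_add hξ, sub_add_cancel]

theorem contr_neg {ξ : 𝔩.Tot} (hξ : ξ ∈ mixed 𝔩) (φ : 𝒜) :
    𝔩.contr (-φ) ξ = -𝔩.contr φ ξ := by
  rw [← zero_sub, contr_sub hξ, contr_zero hξ, zero_sub]

theorem contrKer_sub {ξ : 𝔩.Tot} (hξ : ξ ∈ mixed 𝔩) (v w : 𝔩.ker) :
    𝔩.contrKer (v - w) ξ = 𝔩.contrKer v ξ - 𝔩.contrKer w ξ := by
  rw [eq_sub_iff_add_eq, ← contrKer_add hξ, sub_add_cancel]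

theorem contrKer_neg {ξ : 𝔩.Tot} (hξ : ξ ∈ mixed 𝔩) (v : 𝔩.ker) :
    𝔩.contrKer (-v) ξ = -𝔩.contrKer v ξ := by
  rw [← zero_sub, contrKer_sub hξ, contrKer_zero hξ, zero_sub]

/-- An operator on mixed families which commutes or anticommutes with all contractions vanishes
if its values have no component of bidegree `(0, 0)`. -/
theorem eq_zero_of_contr (T : 𝔩.Tot → 𝔩.Tot)
    (h1 : ∀ ξ ∈ mixed 𝔩, ∀ φ,
      𝔩.contr φ (T ξ) = T (𝔩.contr φ ξ) ∨ 𝔩.contr φ (T ξ) = -T (𝔩.contr φ ξ))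
    (h2 : ∀ ξ ∈ mixed 𝔩, ∀ v, 𝔩.contrKer v (T ξ) = T (𝔩.contrKer v ξ))
    (h0 : ∀ ξ ∈ mixed 𝔩, T ξ 0 0 = 0) {ξ : 𝔩.Tot} (hξ : ξ ∈ mixed 𝔩) : T ξ = 0 := by
  funext p
  induction p generalizing ξ with
  | zero =>
    funext q
    induction q generalizing ξ with
    | zero => exact h0 ξ hξ
    | succ q ih =>
      funext ψ v
      rw [← Fin.cons_self_tail v]
      change 𝔩.contrKer (v 0) (T ξ) 0 q ψ (Fin.tail v) = 0
      rw [h2 ξ hξ, ih (contrKer_mem hξ _)]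
      rfl
  | succ p ih =>
    funext q ψ v
    rw [← Fin.cons_self_tail ψ]
    change 𝔩.contr (ψ 0) (T ξ) p q (Fin.tail ψ) v = 0
    obtain h | h := h1 ξ hξ (ψ 0) <;> rw [h]
    · rw [ih (contr_mem hξ _)]; rfl
    · rw [Pi.neg_apply, ih (contr_mem hξ _)]; exact neg_zero

theorem ins1_mem (θ : 𝒜 →ₗ[R] 𝔩.ker) {ξ : 𝔩.Tot} (hξ : ξ ∈ mixed 𝔩) :
    𝔩.ins1 θ ξ ∈ mixed 𝔩 := by
  refine map_mem_mixed (𝔩.ins1 θ) (fun ξ h φ => ⟨_, neg_mem (contr_mem h φ), ?_⟩)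
    (fun ξ h v => ⟨_, contrKer_mem h v, ?_⟩) (fun ξ h φ ψ => ?_) (fun ξ h g φ => ?_)
    (fun ξ h φ => ?_) (fun ξ h v w => ?_) (fun ξ h g v => ?_) (fun ξ h v w => ?_) hξ
  · rw [contr_ins1, map_neg, sub_neg_eq_add, sub_add_cancel]; exact contrKer_mem h _
  · rw [contrKer_ins1 _ _ h, sub_self]; exact zero_mem _
  · simp only [contr_ins1, map_add, contr_add h, contrKer_add h]; abel
  · simp only [contr_ins1, map_smul, contr_smul h, contrKer_smul h, ins1_mulR, map_sub]
  · simp only [contr_ins1, map_sub, contr_contrKer, contr_self h, map_zero]; abel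
  · simp only [contrKer_ins1 _ _ h, contrKer_add h, map_add]
  · simp only [contrKer_ins1 _ _ h, contrKer_smul h, ins1_mulR]
  · simp only [contrKer_ins1 _ _ h, contrKer_ins1 _ _ (contrKer_mem h _), contrKer_comm h v w]

theorem ins2_mem (θ : 𝒜 →ₗ[R] 𝒜 →ₗ[R] 𝔩.ker) (hθ : ∀ φ, θ φ φ = 0) {ξ : 𝔩.Tot}
    (hξ : ξ ∈ mixed 𝔩) : 𝔩.ins2 (fun φ ψ => θ φ ψ) ξ ∈ mixed 𝔩 := by
  -- Contracting `ins2` with `φ` produces the insertion of `θ φ`, so the linearity of this insertion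
  -- in `θ φ` has to be known first. It is tested on contractions.
  have hadd : ∀ ξ ∈ mixed 𝔩, ∀ φ ψ,
      𝔩.ins1 (θ (φ + ψ)) ξ = 𝔩.ins1 (θ φ) ξ + 𝔩.ins1 (θ ψ) ξ := by
    intro ξ h φ ψ
    rw [← sub_eq_zero]
    refine eq_zero_of_contr
      (fun ξ => 𝔩.ins1 (θ (φ + ψ)) ξ - (𝔩.ins1 (θ φ) ξ + 𝔩.ins1 (θ ψ) ξ))
      (fun ξ h χ => .inr ?_) (fun ξ h v => ?_) (fun ξ h => ?_) h
    · simp only [map_sub, map_add, contr_ins1, LinearMap.add_apply, contrKer_add h]; abel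
    · simp only [map_sub, map_add, contrKer_ins1 _ _ h]
    · simp [ins1]
  have hsmul : ∀ ξ ∈ mixed 𝔩, ∀ (f : R) φ,
      𝔩.ins1 (θ (f • φ)) ξ = 𝔩.mulR f (𝔩.ins1 (θ φ) ξ) := by
    intro ξ h f φ
    rw [← sub_eq_zero]
    refine eq_zero_of_contr
      (fun ξ => 𝔩.ins1 (θ (f • φ)) ξ - 𝔩.mulR f (𝔩.ins1 (θ φ) ξ))
      (fun ξ h χ => .inr ?_) (fun ξ h v => ?_) (fun ξ h => ?_) h
    · simp only [map_sub, map_smul, contr_mulR, contr_ins1, LinearMap.smul_apply,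
        contrKer_smul h]; abel
    · simp only [map_sub, contrKer_mulR, contrKer_ins1 _ _ h]
    · ext; simp [ins1, mulR]
  refine map_mem_mixed (𝔩.ins2 fun φ ψ => θ φ ψ) (fun ξ h φ => ⟨_, contr_mem h φ, ?_⟩)
    (fun ξ h v => ⟨_, contrKer_mem h v, ?_⟩) (fun ξ h φ ψ => ?_) (fun ξ h g φ => ?_)
    (fun ξ h φ => ?_) (fun ξ h v w => ?_) (fun ξ h g v => ?_) (fun ξ h v w => ?_) hξ
  · rw [contr_ins2, add_sub_cancel_right]; exact ins1_mem _ h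
  · rw [contrKer_ins2 _ _ h, sub_self]; exact zero_mem _
  · simp only [contr_ins2, map_add _ (_ : 𝔩.Tot), contr_add h, hadd ξ h]; abel
  · simp only [contr_ins2, contr_smul h, hsmul ξ h, ins2_mulR, map_add]
  · simp only [contr_ins2, contr_ins1, map_add, contr_self h, map_zero, hθ, contrKer_zero h]
    abel
  · simp only [contrKer_ins2 _ _ h, contrKer_add h, map_add]
  · simp only [contrKer_ins2 _ _ h, contrKer_smul h, ins2_mulR]
  · simp only [contrKer_ins2 _ _ h, contrKer_ins2 _ _ (contrKer_mem h _), contrKer_comm h v w]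

theorem ins2_jac_mem (φ : 𝒜) {ξ : 𝔩.Tot} (hξ : ξ ∈ mixed 𝔩) :
    𝔩.ins2 (fun ψ χ => 𝔩.jac φ ψ χ) ξ ∈ mixed 𝔩 :=
  ins2_mem (𝔩.jac φ) (fun ψ => 𝔩.jac_self_right ψ φ) hξ

theorem ins3_jac_mem {ξ : 𝔩.Tot} (hξ : ξ ∈ mixed 𝔩) :
    𝔩.ins3 (fun φ ψ χ => 𝔩.jac φ ψ χ) ξ ∈ mixed 𝔩 := by
  have hadd1 : ∀ ξ ∈ mixed 𝔩, ∀ φ ψ χ,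
      𝔩.ins1 (𝔩.jac (φ + ψ) χ) ξ = 𝔩.ins1 (𝔩.jac φ χ) ξ + 𝔩.ins1 (𝔩.jac ψ χ) ξ := by
    intro ξ h φ ψ χ
    rw [← sub_eq_zero]
    refine eq_zero_of_contr
      (fun ξ => 𝔩.ins1 (𝔩.jac (φ + ψ) χ) ξ - (𝔩.ins1 (𝔩.jac φ χ) ξ + 𝔩.ins1 (𝔩.jac ψ χ) ξ))
      (fun ξ h χ => .inr ?_) (fun ξ h v => ?_) (fun ξ h => ?_) h
    · simp only [map_sub, map_add, contr_ins1, LinearMap.add_apply, contrKer_add h]; abel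
    · simp only [map_sub, map_add, contrKer_ins1 _ _ h]
    · simp [ins1]
  have hsmul1 : ∀ ξ ∈ mixed 𝔩, ∀ (f : R) φ χ,
      𝔩.ins1 (𝔩.jac (f • φ) χ) ξ = 𝔩.mulR f (𝔩.ins1 (𝔩.jac φ χ) ξ) := by
    intro ξ h f φ χ
    rw [← sub_eq_zero]
    refine eq_zero_of_contr
      (fun ξ => 𝔩.ins1 (𝔩.jac (f • φ) χ) ξ - 𝔩.mulR f (𝔩.ins1 (𝔩.jac φ χ) ξ))
      (fun ξ h χ => .inr ?_) (fun ξ h v => ?_) (fun ξ h => ?_) h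
    · simp only [map_sub, map_smul, contr_mulR, contr_ins1, LinearMap.smul_apply,
        contrKer_smul h]; abel
    · simp only [map_sub, contrKer_mulR, contrKer_ins1 _ _ h]
    · ext; simp [ins1, mulR]
  have hadd : ∀ ξ ∈ mixed 𝔩, ∀ φ ψ,
      𝔩.ins2 (fun x y => 𝔩.jac (φ + ψ) x y) ξ =
        𝔩.ins2 (fun x y => 𝔩.jac φ x y) ξ + 𝔩.ins2 (fun x y => 𝔩.jac ψ x y) ξ := by
    intro ξ h φ ψ
    rw [← sub_eq_zero]
    refine eq_zero_of_contr
      (fun ξ => 𝔩.ins2 (fun x y => 𝔩.jac (φ + ψ) x y) ξ -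
        (𝔩.ins2 (fun x y => 𝔩.jac φ x y) ξ + 𝔩.ins2 (fun x y => 𝔩.jac ψ x y) ξ))
      (fun ξ h χ => .inl ?_) (fun ξ h v => ?_) (fun ξ h => ?_) h
    · simp only [map_sub _ (_ : 𝔩.Tot), map_add _ (_ : 𝔩.Tot), contr_ins2, hadd1 ξ h]; abel
    · simp only [map_sub, map_add _ (_ : 𝔩.Tot), contrKer_ins2 _ _ h]
    · simp [ins2]
  have hsmul : ∀ ξ ∈ mixed 𝔩, ∀ (f : R) φ,
      𝔩.ins2 (fun x y => 𝔩.jac (f • φ) x y) ξ =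
        𝔩.mulR f (𝔩.ins2 (fun x y => 𝔩.jac φ x y) ξ) := by
    intro ξ h f φ
    rw [← sub_eq_zero]
    refine eq_zero_of_contr
      (fun ξ => 𝔩.ins2 (fun x y => 𝔩.jac (f • φ) x y) ξ -
        𝔩.mulR f (𝔩.ins2 (fun x y => 𝔩.jac φ x y) ξ))
      (fun ξ h χ => .inl ?_) (fun ξ h v => ?_) (fun ξ h => ?_) h
    · simp only [map_sub _ (_ : 𝔩.Tot), map_add _ (_ : 𝔩.Tot), contr_ins2, contr_mulR,
        hsmul1 ξ h]; abel
    · simp only [map_sub _ (_ : 𝔩.Tot), contrKer_mulR, contrKer_ins2 _ _ h]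
    · ext; simp [ins2, mulR]
  refine map_mem_mixed (𝔩.ins3 fun φ ψ χ => 𝔩.jac φ ψ χ)
    (fun ξ h φ => ⟨_, neg_mem (contr_mem h φ), ?_⟩)
    (fun ξ h v => ⟨_, contrKer_mem h v, ?_⟩) (fun ξ h φ ψ => ?_) (fun ξ h g φ => ?_)
    (fun ξ h φ => ?_) (fun ξ h v w => ?_) (fun ξ h g v => ?_) (fun ξ h v w => ?_) hξ
  · rw [contr_ins3, map_neg, sub_neg_eq_add, sub_add_cancel]; exact ins2_jac_mem φ h
  · rw [contrKer_ins3 _ _ h, sub_self]; exact zero_mem _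
  · simp only [contr_ins3, contr_add h, hadd ξ h, map_add _ (_ : 𝔩.Tot)]; abel
  · simp only [contr_ins3, contr_smul h, hsmul ξ h, ins3_mulR, map_sub _ (_ : 𝔩.Tot)]
  -- Contracting twice with `φ` leaves exactly this insertion.
  · have h0 : 𝔩.ins1 (𝔩.jac φ φ) ξ = 0 := by
      refine eq_zero_of_contr (fun ξ => 𝔩.ins1 (𝔩.jac φ φ) ξ)
        (fun ξ h χ => .inr ?_) (fun ξ h v => ?_) (fun ξ h => ?_) h
      · simp only [contr_ins1, jac_self, contrKer_zero h, zero_sub]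
      · simp only [contrKer_ins1 _ _ h]
      · simp [ins1]
    simp only [contr_ins3, contr_ins2, map_sub _ (_ : 𝔩.Tot), contr_self h,
      map_zero (𝔩.ins3 _), h0]
    abel
  · simp only [contrKer_ins3 _ _ h, contrKer_add h, map_add _ (_ : 𝔩.Tot)]
  · simp only [contrKer_ins3 _ _ h, contrKer_smul h, ins3_mulR]
  · simp only [contrKer_ins3 _ _ h, contrKer_ins3 _ _ (contrKer_mem h _), contrKer_comm h v w]

theorem lie_mem (φ : 𝒜) {ξ : 𝔩.Tot} (hξ : ξ ∈ mixed 𝔩) : 𝔩.lie φ ξ ∈ mixed 𝔩 := by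
  refine map_mem_mixed (𝔩.lie φ) (fun ξ h χ => ⟨_, contr_mem h χ, ?_⟩)
    (fun ξ h v => ⟨_, contrKer_mem h v, ?_⟩) (fun ξ h ψ χ => ?_) (fun ξ h g ψ => ?_)
    (fun ξ h ψ => ?_) (fun ξ h v w => ?_) (fun ξ h g v => ?_) (fun ξ h v w => ?_) hξ
  · rw [contr_lie, sub_sub_cancel_left]; exact neg_mem (contr_mem h _)
  · rw [contrKer_lie, sub_sub_cancel_left]; exact neg_mem (contrKer_mem h _)
  · simp only [contr_lie, contr_add h, 𝔩.br_add, map_add]; abel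
  · simp only [contr_lie, contr_add h, contr_smul h, 𝔩.br_smul, lie_mulR, map_sub]; abel
  · simp only [contr_lie, map_sub, contr_self h, map_zero]
    rw [contr_anticomm h]
    abel
  · simp only [contrKer_lie, contrKer_add h, 𝔩.conn_add, map_add]; abel
  · simp only [contrKer_lie, contrKer_add h, contrKer_smul h, 𝔩.conn_smul, lie_mulR, map_sub]
    abel
  · simp only [contrKer_lie, map_sub, contrKer_comm h v w, contrKer_comm h v (𝔩.conn φ w),
      contrKer_comm h w (𝔩.conn φ v)]
    abel

theorem del_mem {ξ : 𝔩.Tot} (hξ : ξ ∈ mixed 𝔩) : 𝔩.del ξ ∈ mixed 𝔩 := by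
  refine map_mem_mixed 𝔩.del (fun ξ h χ => ⟨_, neg_mem (contr_mem h χ), ?_⟩)
    (fun ξ h v => ⟨_, contrKer_mem h v, ?_⟩) (fun ξ h ψ χ => ?_) (fun ξ h g ψ => ?_)
    (fun ξ h ψ => ?_) (fun ξ h v w => ?_) (fun ξ h g v => ?_) (fun ξ h v w => ?_) hξ
  · rw [contr_del _ h, map_neg, sub_self]; exact zero_mem _
  · rw [contrKer_del, add_sub_cancel_left]; exact contr_mem h _
  · simp only [contr_del _ h, contr_add h, map_add, neg_add]
  · simp only [contr_del _ h, contr_smul h, del_mulR, map_neg]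
  · simp only [contr_del _ h, contr_del _ (contr_mem h ψ), map_neg, contr_self h, map_zero,
      neg_zero]
  · simp only [contrKer_del, contrKer_add h, Submodule.coe_add, contr_add h, map_add]; abel
  · simp only [contrKer_del, contrKer_smul h, Submodule.coe_smul, contr_smul h, del_mulR, map_add]
  · simp only [contrKer_del, map_add, contrKer_comm h v w, contr_contrKer]; abel

theorem lie_add (φ ψ : 𝒜) {ξ : 𝔩.Tot} (hξ : ξ ∈ mixed 𝔩) :
    𝔩.lie (φ + ψ) ξ = 𝔩.lie φ ξ + 𝔩.lie ψ ξ := by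
  rw [← sub_eq_zero]
  refine eq_zero_of_contr (fun ξ => 𝔩.lie (φ + ψ) ξ - (𝔩.lie φ ξ + 𝔩.lie ψ ξ))
    (fun ξ h χ => .inl ?_) (fun ξ h v => ?_) (fun ξ h => ?_) hξ
  · simp only [map_sub, map_add, contr_lie, 𝔩.br_add_left, contr_add h]; abel
  · have : 𝔩.conn (φ + ψ) v = 𝔩.conn φ v + 𝔩.conn ψ v := (𝔩.connL v).map_add φ ψ
    simp only [map_sub, map_add, contrKer_lie, this, contrKer_add h]; abel
  · ext
    simp [lie, symConn, 𝔩.act_add]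

/-- This is the rule `L_{fφ} = f L_φ + df ∧ i_φ`. The last term is written `D(f i_φ) - f D i_φ`, so
no wedge product is required. -/
theorem lie_smul (f : R) (φ : 𝒜) {ξ : 𝔩.Tot} (hξ : ξ ∈ mixed 𝔩) :
    𝔩.lie (f • φ) ξ = 𝔩.mulR f (𝔩.lie φ ξ) + 𝔩.cov (𝔩.mulR f (𝔩.contr φ ξ)) -
      𝔩.mulR f (𝔩.cov (𝔩.contr φ ξ)) := by
  rw [← sub_eq_zero]
  refine eq_zero_of_contr (fun ξ => 𝔩.lie (f • φ) ξ - (𝔩.mulR f (𝔩.lie φ ξ) +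
    𝔩.cov (𝔩.mulR f (𝔩.contr φ ξ)) - 𝔩.mulR f (𝔩.cov (𝔩.contr φ ξ))))
    (fun ξ h χ => .inl ?_) (fun ξ h v => ?_) (fun ξ h => ?_) hξ
  · simp only [map_sub, map_add, contr_lie, 𝔩.br_smul_left, contr_sub h, contr_smul h,
      contr_mulR, contr_cov _ (contr_mem h φ), contr_cov _ (mulR_mem (contr_mem h φ) f),
      lie_mulR, contr_anticomm h χ φ, map_neg]
    abel
  · simp only [map_sub, map_add, contrKer_lie, 𝔩.conn_smul_left, contrKer_smul h,
      contrKer_mulR, contrKer_cov, ← contr_contrKer, ins1_mulR]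
    abel
  · ext
    simp [lie, symConn, 𝔩.act_smul, cov, mulR]

/-- The term `df ∧ i_v` arising from `D(f i_v)` cancels the one from `∇(fv) = df ⊗ v + f ∇v`; this
is what makes `cov` preserve linearity in the arguments from `ker`. -/
theorem cov_mulR_contrKer (f : R) (v : 𝔩.ker) {ξ : 𝔩.Tot} (hξ : ξ ∈ mixed 𝔩) :
    𝔩.cov (𝔩.mulR f (𝔩.contrKer v ξ)) - 𝔩.ins1 (𝔩.connL (f • v)) ξ =
      𝔩.mulR f (𝔩.cov (𝔩.contrKer v ξ)) - 𝔩.mulR f (𝔩.ins1 (𝔩.connL v) ξ) := by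
  rw [← sub_eq_zero]
  refine eq_zero_of_contr (fun ξ => 𝔩.cov (𝔩.mulR f (𝔩.contrKer v ξ)) -
    𝔩.ins1 (𝔩.connL (f • v)) ξ -
      (𝔩.mulR f (𝔩.cov (𝔩.contrKer v ξ)) - 𝔩.mulR f (𝔩.ins1 (𝔩.connL v) ξ)))
    (fun ξ h χ => .inr ?_) (fun ξ h w => ?_) (fun ξ h => ?_) hξ
  · have : 𝔩.connL (f • v) χ = 𝔩.act χ f • v + f • 𝔩.connL v χ := 𝔩.conn_smul χ f v
    simp only [map_sub, contr_mulR, contr_cov _ (contrKer_mem h v), contr_ins1, this,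
      contrKer_add h, contrKer_smul h, contr_cov _ (mulR_mem (contrKer_mem h v) f),
      lie_mulR, contr_contrKer]
    abel
  · simp only [map_sub, contrKer_mulR, contrKer_cov, contrKer_ins1 _ _ h, ins1_mulR,
      contrKer_comm h w v]
    abel
  · ext
    simp [ins1, cov, mulR]

theorem ins1_connL_add (v w : 𝔩.ker) {ξ : 𝔩.Tot} (hξ : ξ ∈ mixed 𝔩) :
    𝔩.ins1 (𝔩.connL (v + w)) ξ = 𝔩.ins1 (𝔩.connL v) ξ + 𝔩.ins1 (𝔩.connL w) ξ := by
  rw [← sub_eq_zero]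
  refine eq_zero_of_contr
    (fun ξ => 𝔩.ins1 (𝔩.connL (v + w)) ξ - (𝔩.ins1 (𝔩.connL v) ξ + 𝔩.ins1 (𝔩.connL w) ξ))
    (fun ξ h χ => .inr ?_) (fun ξ h u => ?_) (fun ξ h => ?_) hξ
  · have : 𝔩.connL (v + w) χ = 𝔩.connL v χ + 𝔩.connL w χ := 𝔩.conn_add χ v w
    simp only [map_sub, map_add, contr_ins1, this, contrKer_add h]; abel
  · simp only [map_sub, map_add, contrKer_ins1 _ _ h]
  · simp [ins1]

/-- Contractions of `cov` give Lie derivatives and insertions of `∇v`, both already known to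
preserve mixed families. Linearity over `R` is `lie_smul` and `cov_mulR_contrKer`; alternation
follows from `[φ,φ] = 0`. -/
theorem cov_mem {ξ : 𝔩.Tot} (hξ : ξ ∈ mixed 𝔩) : 𝔩.cov ξ ∈ mixed 𝔩 := by
  refine map_mem_mixed 𝔩.cov (fun ξ h χ => ⟨_, neg_mem (contr_mem h χ), ?_⟩)
    (fun ξ h v => ⟨_, contrKer_mem h v, ?_⟩) (fun ξ h ψ χ => ?_) (fun ξ h g ψ => ?_)
    (fun ξ h ψ => ?_) (fun ξ h v w => ?_) (fun ξ h g v => ?_) (fun ξ h v w => ?_) hξ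
  · rw [contr_cov _ h, map_neg, sub_neg_eq_add, sub_add_cancel]; exact lie_mem _ h
  · rw [contrKer_cov, sub_sub_cancel_left]; exact neg_mem (ins1_mem _ h)
  · simp only [contr_cov _ h, contr_add h, lie_add _ _ h, map_add]; abel
  · simp only [contr_cov _ h, contr_smul h, lie_smul _ _ h, map_sub]; abel
  · simp only [contr_cov _ h, contr_cov _ (contr_mem h ψ), map_sub, contr_lie, contr_self h,
      map_zero, 𝔩.br_self, contr_zero h]
    abel
  · simp only [contrKer_cov, contrKer_add h, map_add, ins1_connL_add _ _ h]; abel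
  · simp only [contrKer_cov, contrKer_smul h, map_sub, cov_mulR_contrKer _ _ h]
  · simp only [contrKer_cov, map_sub, contrKer_comm h v w, contrKer_ins1 _ _ h]; abel

set_option linter.unusedSimpArgs false

/-! ### Operator identities on mixed families -/

/-- `contr` on mixed families. -/
def mContr (φ : 𝒜) : mixed 𝔩 →ₗ[ℝ] mixed 𝔩 := (𝔩.contr φ).restrict fun _ h => contr_mem h φ

/-- `contrKer` on mixed families. -/
def mContrKer (v : 𝔩.ker) : mixed 𝔩 →ₗ[ℝ] mixed 𝔩 :=
  (𝔩.contrKer v).restrict fun _ h => contrKer_mem h v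

/-- `lie` on mixed families. -/
def mLie (φ : 𝒜) : mixed 𝔩 →ₗ[ℝ] mixed 𝔩 := (𝔩.lie φ).restrict fun _ h => lie_mem φ h

variable (𝔩) in
/-- `cov` on mixed families. -/
def mCov : mixed 𝔩 →ₗ[ℝ] mixed 𝔩 := 𝔩.cov.restrict fun _ h => cov_mem h

variable (𝔩) in
/-- `del` on mixed families. -/
def mDel : mixed 𝔩 →ₗ[ℝ] mixed 𝔩 := 𝔩.del.restrict fun _ h => del_mem h

/-- `ins1` on mixed families. -/
def mIns1 (θ : 𝒜 →ₗ[R] 𝔩.ker) : mixed 𝔩 →ₗ[ℝ] mixed 𝔩 :=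
  (𝔩.ins1 θ).restrict fun _ h => ins1_mem θ h

/-- Insertion of the 2-form `J(φ, ·, ·)` into mixed families. -/
def mIns2 (φ : 𝒜) : mixed 𝔩 →ₗ[ℝ] mixed 𝔩 :=
  (𝔩.ins2 fun ψ χ => 𝔩.jac φ ψ χ).restrict fun _ h => ins2_jac_mem φ h

variable (𝔩) in
/-- Insertion of the Jacobiator into mixed families. -/
def mIns3 : mixed 𝔩 →ₗ[ℝ] mixed 𝔩 :=
  (𝔩.ins3 fun φ ψ χ => 𝔩.jac φ ψ χ).restrict fun _ h => ins3_jac_mem h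

theorem mContr_mContrKer (φ : 𝒜) (v : 𝔩.ker) (ξ : mixed 𝔩) :
    mContr φ (mContrKer v ξ) = mContrKer v (mContr φ ξ) := rfl

theorem mContr_add (φ ψ : 𝒜) (ξ : mixed 𝔩) :
    mContr (φ + ψ) ξ = mContr φ ξ + mContr ψ ξ := Subtype.ext (contr_add ξ.2 φ ψ)

theorem mContr_neg (φ : 𝒜) (ξ : mixed 𝔩) : mContr (-φ) ξ = -mContr φ ξ :=
  Subtype.ext (contr_neg ξ.2 φ)

theorem mContrKer_add (v w : 𝔩.ker) (ξ : mixed 𝔩) :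
    mContrKer (v + w) ξ = mContrKer v ξ + mContrKer w ξ := Subtype.ext (contrKer_add ξ.2 v w)

theorem mContrKer_sub (v w : 𝔩.ker) (ξ : mixed 𝔩) :
    mContrKer (v - w) ξ = mContrKer v ξ - mContrKer w ξ := Subtype.ext (contrKer_sub ξ.2 v w)

theorem mContrKer_neg (v : 𝔩.ker) (ξ : mixed 𝔩) : mContrKer (-v) ξ = -mContrKer v ξ :=
  Subtype.ext (contrKer_neg ξ.2 v)

theorem mContr_mCov (φ : 𝒜) (ξ : mixed 𝔩) :
    mContr φ (mCov 𝔩 ξ) = mLie φ ξ - mCov 𝔩 (mContr φ ξ) := Subtype.ext (contr_cov φ ξ.2)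

theorem mContr_mDel (φ : 𝒜) (ξ : mixed 𝔩) :
    mContr φ (mDel 𝔩 ξ) = -mDel 𝔩 (mContr φ ξ) := Subtype.ext (contr_del φ ξ.2)

theorem mContr_mLie (φ ψ : 𝒜) (ξ : mixed 𝔩) :
    mContr φ (mLie ψ ξ) = mLie ψ (mContr φ ξ) - mContr (𝔩.br ψ φ) ξ :=
  Subtype.ext (contr_lie ψ φ ξ.1)

theorem mContr_mIns1 (φ : 𝒜) (θ : 𝒜 →ₗ[R] 𝔩.ker) (ξ : mixed 𝔩) :
    mContr φ (mIns1 θ ξ) = mContrKer (θ φ) ξ - mIns1 θ (mContr φ ξ) :=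
  Subtype.ext (contr_ins1 θ φ ξ.1)

theorem mContr_mIns2 (φ ψ : 𝒜) (ξ : mixed 𝔩) :
    mContr φ (mIns2 ψ ξ) = mIns1 (𝔩.jac ψ φ) ξ + mIns2 ψ (mContr φ ξ) := by
  refine Subtype.ext ?_
  exact contr_ins2 (fun χ η => 𝔩.jac ψ χ η) φ ξ.1

theorem mContr_mIns3 (φ : 𝒜) (ξ : mixed 𝔩) :
    mContr φ (mIns3 𝔩 ξ) = mIns2 φ ξ - mIns3 𝔩 (mContr φ ξ) := by
  refine Subtype.ext ?_
  exact contr_ins3 (fun ψ χ η => 𝔩.jac ψ χ η) φ ξ.1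

theorem mContrKer_mCov (v : 𝔩.ker) (ξ : mixed 𝔩) :
    mContrKer v (mCov 𝔩 ξ) = mCov 𝔩 (mContrKer v ξ) - mIns1 (𝔩.connL v) ξ :=
  Subtype.ext (contrKer_cov v ξ.1)

theorem mContrKer_mDel (v : 𝔩.ker) (ξ : mixed 𝔩) :
    mContrKer v (mDel 𝔩 ξ) = mDel 𝔩 (mContrKer v ξ) + mContr (v : 𝒜) ξ :=
  Subtype.ext (contrKer_del v ξ.1)

theorem mContrKer_mLie (v : 𝔩.ker) (ψ : 𝒜) (ξ : mixed 𝔩) :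
    mContrKer v (mLie ψ ξ) = mLie ψ (mContrKer v ξ) - mContrKer (𝔩.conn ψ v) ξ :=
  Subtype.ext (contrKer_lie ψ v ξ.1)

theorem mContrKer_mIns1 (v : 𝔩.ker) (θ : 𝒜 →ₗ[R] 𝔩.ker) (ξ : mixed 𝔩) :
    mContrKer v (mIns1 θ ξ) = mIns1 θ (mContrKer v ξ) := Subtype.ext (contrKer_ins1 θ v ξ.2)

theorem mContrKer_mIns2 (v : 𝔩.ker) (ψ : 𝒜) (ξ : mixed 𝔩) :
    mContrKer v (mIns2 ψ ξ) = mIns2 ψ (mContrKer v ξ) := by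
  refine Subtype.ext ?_
  exact contrKer_ins2 (fun χ η => 𝔩.jac ψ χ η) v ξ.2

theorem mContrKer_mIns3 (v : 𝔩.ker) (ξ : mixed 𝔩) :
    mContrKer v (mIns3 𝔩 ξ) = mIns3 𝔩 (mContrKer v ξ) := by
  refine Subtype.ext ?_
  exact contrKer_ins3 (fun ψ χ η => 𝔩.jac ψ χ η) v ξ.2

/-- The component of bidegree `(0, 0)`. -/
def bot : mixed 𝔩 →ₗ[ℝ] ((Fin 0 → 𝒜) → (Fin 0 → 𝔩.ker) → R) where
  toFun ξ := ξ.1 0 0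
  map_add' _ _ := rfl
  map_smul' _ _ := rfl

theorem bot_mCov (ξ : mixed 𝔩) : bot (mCov 𝔩 ξ) = 0 := rfl

theorem bot_mDel (ξ : mixed 𝔩) : bot (mDel 𝔩 ξ) = 0 := rfl

theorem bot_mIns1 (θ : 𝒜 →ₗ[R] 𝔩.ker) (ξ : mixed 𝔩) : bot (mIns1 θ ξ) = 0 := rfl

theorem bot_mIns2 (φ : 𝒜) (ξ : mixed 𝔩) : bot (mIns2 φ ξ) = 0 := rfl

theorem bot_mIns3 (ξ : mixed 𝔩) : bot (mIns3 𝔩 ξ) = 0 := rfl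

/-- The action of `𝒜` on components of bidegree `(0, 0)`. -/
def botAct (φ : 𝒜) : ((Fin 0 → 𝒜) → (Fin 0 → 𝔩.ker) → R) →ₗ[ℝ]
    ((Fin 0 → 𝒜) → (Fin 0 → 𝔩.ker) → R) where
  toFun g ψ v := 𝔩.act φ (g ψ v)
  map_add' _ _ := by ext; simp
  map_smul' _ _ := by ext; simp

theorem bot_mLie (φ : 𝒜) (ξ : mixed 𝔩) : bot (mLie φ ξ) = botAct φ (bot ξ) := by
  funext ψ v
  change 𝔩.lie φ ξ.1 0 0 ψ v = 𝔩.act φ (ξ.1 0 0 ψ v)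
  simp [lie, symConn]

theorem botAct_ker (v : 𝔩.ker) (g) : botAct (𝔩 := 𝔩) (v : 𝒜) g = 0 := by
  funext ψ w
  exact 𝔩.act_ker v v.2 _

theorem botAct_br (φ ψ : 𝒜) (g) : botAct (𝔩 := 𝔩) (𝔩.br φ ψ) g =
    botAct φ (botAct ψ g) - botAct ψ (botAct φ g) := by
  funext χ w
  exact 𝔩.act_br _ _ _

theorem jac_swap (φ ψ χ : 𝒜) : 𝔩.jac φ ψ χ = -𝔩.jac ψ φ χ := by
  have := 𝔩.jac_self (φ + ψ) χ
  simp only [map_add, LinearMap.add_apply, jac_self, zero_add, add_zero] at this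
  exact eq_neg_of_add_eq_zero_right this

theorem jac_swap_right (φ ψ χ : 𝒜) : 𝔩.jac φ ψ χ = -𝔩.jac φ χ ψ := by
  rw [𝔩.jac_rotate φ ψ χ, jac_swap, 𝔩.jac_rotate φ χ ψ]

theorem conn_jac_eq (φ ψ χ η : 𝒜) : 𝔩.conn φ (𝔩.jac ψ χ η) =
    𝔩.jac ψ χ (𝔩.br φ η) + 𝔩.jac ψ (𝔩.br φ χ) η
      + (𝔩.conn ψ (𝔩.jac φ χ η) - 𝔩.jac φ χ (𝔩.br ψ η) - 𝔩.jac φ (𝔩.br ψ χ) η)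
      + 𝔩.jac (𝔩.br φ ψ) χ η
      - (𝔩.conn χ (𝔩.jac φ ψ η) - 𝔩.jac φ ψ (𝔩.br χ η)) + 𝔩.conn η (𝔩.jac φ ψ χ) := by
  rw [← sub_eq_zero, ← 𝔩.bianchi φ ψ χ η]
  abel

theorem conn_conn_eq (φ ψ : 𝒜) (v : 𝔩.ker) : 𝔩.conn φ (𝔩.conn ψ v) =
    𝔩.conn (𝔩.br φ ψ) v + 𝔩.conn ψ (𝔩.conn φ v) - 𝔩.jac φ v ψ := by
  rw [eq_sub_iff_add_eq, ← sub_eq_iff_eq_add', ← neg_neg (𝔩.jac φ v ψ), ← 𝔩.conn_conn]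
  abel

theorem connL_apply (v : 𝔩.ker) (φ : 𝒜) : 𝔩.connL v φ = 𝔩.conn φ v := rfl

/-- Two operators on mixed families with the same anticommutators with `mContr`, the same
commutators with `mContrKer` and the same component of bidegree `(0, 0)` agree. -/
theorem eq_of_anticomm (X Y : mixed 𝔩 → mixed 𝔩)
    (h1 : ∀ ξ φ, mContr φ (X ξ) - (mContr φ (Y ξ)) = Y (mContr φ ξ) - X (mContr φ ξ))
    (h2 : ∀ ξ v, mContrKer v (X ξ) - mContrKer v (Y ξ) = X (mContrKer v ξ) - Y (mContrKer v ξ))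
    (h0 : ∀ ξ, bot (X ξ) = bot (Y ξ)) (ξ : mixed 𝔩) : X ξ = Y ξ := by
  classical
  -- The criterion concerns operators on all families, so `X - Y` is extended by zero outside `mixed
  -- 𝔩`.
  have h := eq_zero_of_contr
    (fun η => if h : η ∈ mixed 𝔩 then (X ⟨η, h⟩ - Y ⟨η, h⟩ : mixed 𝔩).1 else 0)
    (fun η h φ => .inr ?_) (fun η h v => ?_) (fun η h => ?_) ξ.2
  · rw [dif_pos ξ.2] at h
    exact sub_eq_zero.1 (Subtype.ext h)
  · simp only [dif_pos h, dif_pos (contr_mem h φ)]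
    have := congrArg Subtype.val (h1 ⟨η, h⟩ φ)
    rw [← map_sub, ← neg_sub (X _)] at this
    exact this
  · simp only [dif_pos h, dif_pos (contrKer_mem h v)]
    have := congrArg Subtype.val (h2 ⟨η, h⟩ v)
    rw [← map_sub] at this
    exact this
  · simp only [dif_pos h]
    exact sub_eq_zero.2 (h0 ⟨η, h⟩)

/-- Two operators on mixed families with the same commutators with `mContr` and `mContrKer`, and
the same component of bidegree `(0, 0)` agree. -/
theorem eq_of_comm (X Y : mixed 𝔩 → mixed 𝔩)
    (h1 : ∀ ξ φ, mContr φ (X ξ) - mContr φ (Y ξ) = X (mContr φ ξ) - Y (mContr φ ξ))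
    (h2 : ∀ ξ v, mContrKer v (X ξ) - mContrKer v (Y ξ) = X (mContrKer v ξ) - Y (mContrKer v ξ))
    (h0 : ∀ ξ, bot (X ξ) = bot (Y ξ)) (ξ : mixed 𝔩) : X ξ = Y ξ := by
  classical
  have h := eq_zero_of_contr
    (fun η => if h : η ∈ mixed 𝔩 then (X ⟨η, h⟩ - Y ⟨η, h⟩ : mixed 𝔩).1 else 0)
    (fun η h φ => .inl ?_) (fun η h v => ?_) (fun η h => ?_) ξ.2
  · rw [dif_pos ξ.2] at h
    exact sub_eq_zero.1 (Subtype.ext h)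
  · simp only [dif_pos h, dif_pos (contr_mem h φ)]
    have := congrArg Subtype.val (h1 ⟨η, h⟩ φ)
    rw [← map_sub] at this
    exact this
  · simp only [dif_pos h, dif_pos (contrKer_mem h v)]
    have := congrArg Subtype.val (h2 ⟨η, h⟩ v)
    rw [← map_sub] at this
    exact this
  · simp only [dif_pos h]
    exact sub_eq_zero.2 (h0 ⟨η, h⟩)

theorem mDel_mDel (ξ : mixed 𝔩) :
    mDel 𝔩 (mDel 𝔩 ξ) =
      0 := by
  refine eq_of_comm (fun ξ => mDel 𝔩 (mDel 𝔩 ξ))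
    (fun ξ => 0) (fun ξ χ => ?_) (fun ξ w => ?_) (fun ξ => ?_) ξ
  · simp only [map_zero, map_add, map_sub, map_neg, mContr_mDel, mContrKer_mDel, mContr_mContrKer,
      coe_conn, connL_apply]
    abel
  · simp only [map_zero, map_add, map_sub, map_neg, mContrKer_mDel, mContr_mDel, mContr_mContrKer,
      coe_conn, connL_apply]
    abel
  · simp only [map_zero, map_add, map_sub, map_neg, bot_mDel, add_zero, zero_add, sub_zero,
      neg_zero, sub_self]

theorem mLie_mDel (φ : 𝒜) (ξ : mixed 𝔩) :
    mLie φ (mDel 𝔩 ξ) =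
      mDel 𝔩 (mLie φ ξ) := by
  refine eq_of_anticomm (fun ξ => mLie φ (mDel 𝔩 ξ))
    (fun ξ => mDel 𝔩 (mLie φ ξ)) (fun ξ χ => ?_) (fun ξ w => ?_) (fun ξ => ?_) ξ
  · simp only [map_zero, map_add, map_sub, map_neg, mContr_mLie, mContr_mDel, mContrKer_mLie,
      mContrKer_mDel, mContr_mContrKer, coe_conn, connL_apply]
    abel
  · simp only [map_zero, map_add, map_sub, map_neg, mContrKer_mLie, mContrKer_mDel, mContr_mLie,
      mContr_mDel, mContr_mContrKer, coe_conn, connL_apply]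
    abel
  · simp only [map_zero, map_add, map_sub, map_neg, bot_mLie, bot_mDel, add_zero, zero_add,
      sub_zero, neg_zero, sub_self]

/-- Both the anticommutator and the Lie derivative bracket the arguments with `v`, by skew-symmetry.
They agree on functions because `v` acts trivially there. -/
theorem mDel_mIns1_connL (v : 𝔩.ker) (ξ : mixed 𝔩) :
    mDel 𝔩 (mIns1 (𝔩.connL v) ξ) =
      mLie (v : 𝒜) ξ - mIns1 (𝔩.connL v) (mDel 𝔩 ξ) := by
  refine eq_of_comm (fun ξ => mDel 𝔩 (mIns1 (𝔩.connL v) ξ))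
    (fun ξ => mLie (v : 𝒜) ξ - mIns1 (𝔩.connL v) (mDel 𝔩 ξ)) (fun ξ χ => ?_) (fun ξ w => ?_)
        (fun ξ => ?_) ξ
  · simp only [map_zero, map_add, map_sub, map_neg, mContr_mDel, mContr_mIns1, mContr_mLie,
      mContrKer_mDel, mContrKer_mIns1, mContrKer_mLie, mContr_mContrKer, coe_conn, connL_apply,
      𝔩.br_swap (v : 𝒜), mContr_neg]
    abel
  · simp only [map_zero, map_add, map_sub, map_neg, mContrKer_mDel, mContrKer_mIns1, mContrKer_mLie,
      mContr_mDel, mContr_mIns1, mContr_mLie, mContr_mContrKer, coe_conn, connL_apply,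
      show 𝔩.conn (v : 𝒜) w = -𝔩.conn (w : 𝒜) v from Subtype.ext (𝔩.br_swap _ _), mContrKer_neg]
    abel
  · simp only [map_zero, map_add, map_sub, map_neg, bot_mDel, bot_mIns1, bot_mLie, botAct_ker,
      add_zero, zero_add, sub_zero, neg_zero, sub_self]

/-- Contraction with `𝒜` reduces this to `mLie_mDel`, contraction with `ker` to `mDel_mIns1_connL`.
-/
theorem mDel_mCov (ξ : mixed 𝔩) :
    mDel 𝔩 (mCov 𝔩 ξ) =
      -mCov 𝔩 (mDel 𝔩 ξ) := by
  refine eq_of_comm (fun ξ => mDel 𝔩 (mCov 𝔩 ξ))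
    (fun ξ => -mCov 𝔩 (mDel 𝔩 ξ)) (fun ξ χ => ?_) (fun ξ w => ?_) (fun ξ => ?_) ξ
  · simp only [map_zero, map_add, map_sub, map_neg, mContr_mDel, mContr_mCov, mContr_mLie,
      mContr_mIns1,
      mContrKer_mDel, mContrKer_mCov, mContrKer_mLie, mContrKer_mIns1, mContr_mContrKer,
      coe_conn, connL_apply, mLie_mDel]
    abel
  · simp only [map_zero, map_add, map_sub, map_neg, mContrKer_mDel, mContrKer_mCov, mContrKer_mLie,
      mContrKer_mIns1, mContr_mDel, mContr_mCov, mContr_mLie, mContr_mIns1, mContr_mContrKer,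
      coe_conn, connL_apply, mDel_mIns1_connL]
    abel
  · simp only [map_zero, map_add, map_sub, map_neg, bot_mDel, bot_mCov, bot_mLie, bot_mIns1,
      add_zero, zero_add, sub_zero, neg_zero, sub_self]

/-- Contracting with `χ` leaves the commutator of `∇_φ` and `∇_χ` on `v`; the Jacobiator term is the
curvature of the connection. -/
theorem mLie_mIns1_connL (φ : 𝒜) (v : 𝔩.ker) (ξ : mixed 𝔩) :
    mLie φ (mIns1 (𝔩.connL v) ξ) =
      mIns1 (𝔩.connL v) (mLie φ ξ) + mIns1 (𝔩.connL (𝔩.conn φ v)) ξ - mIns1 (𝔩.jac φ v) ξ := by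
  refine eq_of_anticomm (fun ξ => mLie φ (mIns1 (𝔩.connL v) ξ))
    (fun ξ => mIns1 (𝔩.connL v) (mLie φ ξ) + mIns1 (𝔩.connL (𝔩.conn φ v)) ξ - mIns1 (𝔩.jac φ v) ξ)
    (fun ξ χ => ?_) (fun ξ w => ?_) (fun ξ => ?_) ξ
  · simp only [map_zero, map_add, map_sub, map_neg, mContr_mLie, mContr_mIns1, mContrKer_mLie,
      mContrKer_mIns1, mContr_mContrKer, coe_conn, connL_apply, conn_conn_eq φ χ, mContrKer_add,
      mContrKer_sub]
    abel
  · simp only [map_zero, map_add, map_sub, map_neg, mContrKer_mLie, mContrKer_mIns1, mContr_mLie,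
      mContr_mIns1, mContr_mContrKer, coe_conn, connL_apply]
    abel
  · simp only [map_zero, map_add, map_sub, map_neg, bot_mLie, bot_mIns1, add_zero, zero_add,
      sub_zero, neg_zero, sub_self]

/-- Insertions supercommute according to form degree. Contraction lowers the degree of a form, so
the statements up to `mIns3_mIns3`, which is `Ĵ² = 0`, rest on one another starting here. -/
theorem mIns1_mIns1 (θ η : 𝒜 →ₗ[R] 𝔩.ker) (ξ : mixed 𝔩) :
    mIns1 θ (mIns1 η ξ) =
      -mIns1 η (mIns1 θ ξ) := by
  refine eq_of_comm (fun ξ => mIns1 θ (mIns1 η ξ))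
    (fun ξ => -mIns1 η (mIns1 θ ξ)) (fun ξ χ => ?_) (fun ξ w => ?_) (fun ξ => ?_) ξ
  · simp only [map_zero, map_add, map_sub, map_neg, mContr_mIns1, mContrKer_mIns1, mContr_mContrKer,
      coe_conn, connL_apply]
    abel
  · simp only [map_zero, map_add, map_sub, map_neg, mContrKer_mIns1, mContr_mIns1, mContr_mContrKer,
      coe_conn, connL_apply]
  · simp only [map_zero, map_add, map_sub, map_neg, bot_mIns1, add_zero, zero_add, sub_zero,
      neg_zero, sub_self]

theorem mIns1_mIns2 (θ : 𝒜 →ₗ[R] 𝔩.ker) (φ : 𝒜) (ξ : mixed 𝔩) :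
    mIns1 θ (mIns2 φ ξ) =
      mIns2 φ (mIns1 θ ξ) := by
  refine eq_of_anticomm (fun ξ => mIns1 θ (mIns2 φ ξ))
    (fun ξ => mIns2 φ (mIns1 θ ξ)) (fun ξ χ => ?_) (fun ξ w => ?_) (fun ξ => ?_) ξ
  · simp only [map_zero, map_add, map_sub, map_neg, mContr_mIns1, mContr_mIns2, mContrKer_mIns1,
      mContrKer_mIns2, mContr_mContrKer, coe_conn, connL_apply, mIns1_mIns1 θ]
    abel
  · simp only [map_zero, map_add, map_sub, map_neg, mContrKer_mIns1, mContrKer_mIns2, mContr_mIns1,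
      mContr_mIns2, mContr_mContrKer, coe_conn, connL_apply]
  · simp only [map_zero, map_add, map_sub, map_neg, bot_mIns1, bot_mIns2, add_zero, zero_add,
      sub_zero, neg_zero, sub_self]

theorem mIns1_mIns3 (θ : 𝒜 →ₗ[R] 𝔩.ker) (ξ : mixed 𝔩) :
    mIns1 θ (mIns3 𝔩 ξ) =
      -mIns3 𝔩 (mIns1 θ ξ) := by
  refine eq_of_comm (fun ξ => mIns1 θ (mIns3 𝔩 ξ))
    (fun ξ => -mIns3 𝔩 (mIns1 θ ξ)) (fun ξ χ => ?_) (fun ξ w => ?_) (fun ξ => ?_) ξ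
  · simp only [map_zero, map_add, map_sub, map_neg, mContr_mIns1, mContr_mIns3, mContrKer_mIns1,
      mContrKer_mIns3, mContr_mContrKer, coe_conn, connL_apply, mIns1_mIns2]
    abel
  · simp only [map_zero, map_add, map_sub, map_neg, mContrKer_mIns1, mContrKer_mIns3, mContr_mIns1,
      mContr_mIns3, mContr_mContrKer, coe_conn, connL_apply]
  · simp only [map_zero, map_add, map_sub, map_neg, bot_mIns1, bot_mIns3, add_zero, zero_add,
      sub_zero, neg_zero, sub_self]

theorem mIns2_mIns2 (φ ψ : 𝒜) (ξ : mixed 𝔩) :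
    mIns2 φ (mIns2 ψ ξ) =
      mIns2 ψ (mIns2 φ ξ) := by
  refine eq_of_comm (fun ξ => mIns2 φ (mIns2 ψ ξ))
    (fun ξ => mIns2 ψ (mIns2 φ ξ)) (fun ξ χ => ?_) (fun ξ w => ?_) (fun ξ => ?_) ξ
  · simp only [map_zero, map_add, map_sub, map_neg, mContr_mIns2, mContrKer_mIns2, mContr_mContrKer,
      coe_conn, connL_apply, mIns1_mIns2]
    abel
  · simp only [map_zero, map_add, map_sub, map_neg, mContrKer_mIns2, mContr_mIns2, mContr_mContrKer,
      coe_conn, connL_apply]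
  · simp only [map_zero, map_add, map_sub, map_neg, bot_mIns2, add_zero, zero_add, sub_zero,
      neg_zero, sub_self]

theorem mIns2_mIns3 (φ : 𝒜) (ξ : mixed 𝔩) :
    mIns2 φ (mIns3 𝔩 ξ) =
      mIns3 𝔩 (mIns2 φ ξ) := by
  refine eq_of_anticomm (fun ξ => mIns2 φ (mIns3 𝔩 ξ))
    (fun ξ => mIns3 𝔩 (mIns2 φ ξ)) (fun ξ χ => ?_) (fun ξ w => ?_) (fun ξ => ?_) ξ
  · simp only [map_zero, map_add, map_sub, map_neg, mContr_mIns2, mContr_mIns3, mContrKer_mIns2,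
      mContrKer_mIns3, mContr_mContrKer, coe_conn, connL_apply, mIns1_mIns3, mIns2_mIns2 φ χ]
    abel
  · simp only [map_zero, map_add, map_sub, map_neg, mContrKer_mIns2, mContrKer_mIns3, mContr_mIns2,
      mContr_mIns3, mContr_mContrKer, coe_conn, connL_apply]
  · simp only [map_zero, map_add, map_sub, map_neg, bot_mIns2, bot_mIns3, add_zero, zero_add,
      sub_zero, neg_zero, sub_self]

theorem mIns3_mIns3 (ξ : mixed 𝔩) :
    mIns3 𝔩 (mIns3 𝔩 ξ) =
      0 := by
  refine eq_of_comm (fun ξ => mIns3 𝔩 (mIns3 𝔩 ξ))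
    (fun ξ => 0) (fun ξ χ => ?_) (fun ξ w => ?_) (fun ξ => ?_) ξ
  · simp only [map_zero, map_add, map_sub, map_neg, mContr_mIns3, mContrKer_mIns3, mContr_mContrKer,
      coe_conn, connL_apply, mIns2_mIns3]
    abel
  · simp only [map_zero, map_add, map_sub, map_neg, mContrKer_mIns3, mContr_mIns3, mContr_mContrKer,
      coe_conn, connL_apply]
  · simp only [map_zero, map_add, map_sub, map_neg, bot_mIns3, add_zero, zero_add, sub_zero,
      neg_zero, sub_self]

/-- The defect comes from the Jacobi identity. The anticommutator of `δ̂` with an inserted 1-form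
`θ`, commuted with contraction by `χ`, gives contraction by `θ χ`. For `θ = J(φ,ψ,·)` this is
exactly the discrepancy among the iterated brackets of `φ`, `ψ`, `χ`. -/
theorem mLie_mLie (φ ψ : 𝒜) (ξ : mixed 𝔩) :
    mLie φ (mLie ψ ξ) =
      mLie ψ (mLie φ ξ) + mLie (𝔩.br φ ψ) ξ - mIns1 (𝔩.jac φ ψ) (mDel 𝔩 ξ) -
        mDel 𝔩 (mIns1 (𝔩.jac φ ψ) ξ) := by
  refine eq_of_comm (fun ξ => mLie φ (mLie ψ ξ))
    (fun ξ => mLie ψ (mLie φ ξ) + mLie (𝔩.br φ ψ) ξ - mIns1 (𝔩.jac φ ψ) (mDel 𝔩 ξ) -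
        mDel 𝔩 (mIns1 (𝔩.jac φ ψ) ξ)) (fun ξ χ => ?_) (fun ξ w => ?_) (fun ξ => ?_) ξ
  · simp only [map_zero, map_add, map_sub, map_neg, mContr_mLie, mContr_mIns1, mContr_mDel,
      mContrKer_mLie, mContrKer_mIns1, mContrKer_mDel, mContr_mContrKer, coe_conn, connL_apply,
      coe_jac, mContr_add, 𝔩.br_swap χ, 𝔩.br_neg, mContr_neg]
    abel
  · simp only [map_zero, map_add, map_sub, map_neg, mContrKer_mLie, mContrKer_mIns1, mContrKer_mDel,
      mContr_mLie, mContr_mIns1, mContr_mDel, mContr_mContrKer, coe_conn, connL_apply,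
      conn_conn_eq φ ψ, jac_swap_right φ w ψ, mContrKer_add, mContrKer_sub, mContrKer_neg]
    abel
  · simp only [map_zero, map_add, map_sub, map_neg, bot_mLie, bot_mIns1, bot_mDel, botAct_br,
      add_zero, zero_add, sub_zero, neg_zero, sub_self]
    abel

theorem mIns1_jac_swap (φ ψ : 𝒜) (ξ : mixed 𝔩) :
    mIns1 (𝔩.jac φ ψ) ξ = -mIns1 (𝔩.jac ψ φ) ξ := by
  refine eq_of_anticomm (fun ξ => mIns1 (𝔩.jac φ ψ) ξ) (fun ξ => -mIns1 (𝔩.jac ψ φ) ξ)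
    (fun ξ χ => ?_) (fun ξ w => ?_) (fun ξ => ?_) ξ
  · simp only [map_neg, mContr_mIns1, jac_swap φ ψ χ, mContrKer_neg]
    abel
  · simp only [map_neg, mContrKer_mIns1]
  · simp only [map_neg, bot_mIns1, neg_zero]

theorem mCov_mIns1_connL (v : 𝔩.ker) (ξ : mixed 𝔩) :
    mCov 𝔩 (mIns1 (𝔩.connL v) ξ) =
      mIns2 (v : 𝒜) ξ - mIns1 (𝔩.connL v) (mCov 𝔩 ξ) := by
  refine eq_of_comm (fun ξ => mCov 𝔩 (mIns1 (𝔩.connL v) ξ))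
    (fun ξ => mIns2 (v : 𝒜) ξ - mIns1 (𝔩.connL v) (mCov 𝔩 ξ)) (fun ξ χ => ?_) (fun ξ w => ?_)
        (fun ξ => ?_) ξ
  · simp only [map_zero, map_add, map_sub, map_neg, mContr_mCov, mContr_mIns1, mContr_mIns2,
      mContr_mLie,
      mContrKer_mCov, mContrKer_mIns1, mContrKer_mIns2, mContrKer_mLie, mContr_mContrKer,
      coe_conn, connL_apply, mLie_mIns1_connL, mIns1_jac_swap (v : 𝒜) χ]
    abel
  · simp only [map_zero, map_add, map_sub, map_neg, mContrKer_mCov, mContrKer_mIns1,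
      mContrKer_mIns2,
      mContrKer_mLie, mContr_mCov, mContr_mIns1, mContr_mIns2, mContr_mLie, mContr_mContrKer,
      coe_conn, connL_apply, mIns1_mIns1 (𝔩.connL w)]
    abel
  · simp only [map_zero, map_add, map_sub, map_neg, bot_mCov, bot_mIns1, bot_mIns2, bot_mLie,
      add_zero, zero_add, sub_zero, neg_zero, sub_self]

theorem mLie_mCov (φ : 𝒜) (ξ : mixed 𝔩) :
    mLie φ (mCov 𝔩 ξ) =
      mCov 𝔩 (mLie φ ξ) + mDel 𝔩 (mIns2 φ ξ) - mIns2 φ (mDel 𝔩 ξ) := by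
  refine eq_of_anticomm (fun ξ => mLie φ (mCov 𝔩 ξ))
    (fun ξ => mCov 𝔩 (mLie φ ξ) + mDel 𝔩 (mIns2 φ ξ) - mIns2 φ (mDel 𝔩 ξ)) (fun ξ χ => ?_)
        (fun ξ w => ?_) (fun ξ => ?_) ξ
  · simp only [map_zero, map_add, map_sub, map_neg, mContr_mLie, mContr_mCov, mContr_mIns2,
      mContr_mDel,
      mContr_mIns1, mContrKer_mLie, mContrKer_mCov, mContrKer_mIns2, mContrKer_mDel,
      mContrKer_mIns1, mContr_mContrKer, coe_conn, connL_apply, mLie_mLie φ χ]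
    abel
  · simp only [map_zero, map_add, map_sub, map_neg, mContrKer_mLie, mContrKer_mCov, mContrKer_mIns2,
      mContrKer_mDel, mContrKer_mIns1, mContr_mLie, mContr_mCov, mContr_mIns2, mContr_mDel,
      mContr_mIns1, mContr_mContrKer, coe_conn, connL_apply, mLie_mIns1_connL,
      mIns1_mIns1 (𝔩.connL w)]
    abel
  · simp only [map_zero, map_add, map_sub, map_neg, bot_mLie, bot_mCov, bot_mIns2, bot_mDel,
      bot_mIns1, add_zero, zero_add, sub_zero, neg_zero, sub_self]

/-- The curvature of `D` is homotopic to zero through `Ĵ`. Contraction with `χ` turns `D²` into the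
commutator of `L_χ` and `D` (`mLie_mCov`), and contraction with `ker` reduces to `mCov_mIns1_connL`.
-/
theorem mCov_mCov (ξ : mixed 𝔩) :
    mCov 𝔩 (mCov 𝔩 ξ) =
      -mIns3 𝔩 (mDel 𝔩 ξ) - mDel 𝔩 (mIns3 𝔩 ξ) := by
  refine eq_of_comm (fun ξ => mCov 𝔩 (mCov 𝔩 ξ))
    (fun ξ => -mIns3 𝔩 (mDel 𝔩 ξ) - mDel 𝔩 (mIns3 𝔩 ξ)) (fun ξ χ => ?_) (fun ξ w => ?_)
        (fun ξ => ?_) ξ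
  · simp only [map_zero, map_add, map_sub, map_neg, mContr_mCov, mContr_mIns3, mContr_mDel,
      mContr_mLie,
      mContr_mIns2, mContrKer_mCov, mContrKer_mIns3, mContrKer_mDel, mContrKer_mLie,
      mContrKer_mIns2, mContr_mContrKer, coe_conn, connL_apply, mLie_mCov]
    abel
  · simp only [map_zero, map_add, map_sub, map_neg, mContrKer_mCov, mContrKer_mIns3, mContrKer_mDel,
      mContrKer_mLie, mContrKer_mIns2, mContr_mCov, mContr_mIns3, mContr_mDel, mContr_mLie,
      mContr_mIns2, mContr_mContrKer, coe_conn, connL_apply, mCov_mIns1_connL]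
    abel
  · simp only [map_zero, map_add, map_sub, map_neg, bot_mCov, bot_mIns3, bot_mDel, bot_mLie,
      bot_mIns2, add_zero, zero_add, sub_zero, neg_zero, sub_self]

/-- Bianchi's identity in operator form: a further contraction with `η` turns it into `conn_jac_eq`.
-/
theorem mLie_mIns1_jac (φ ψ χ : 𝒜) (ξ : mixed 𝔩) :
    mLie φ (mIns1 (𝔩.jac ψ χ) ξ) =
      mIns1 (𝔩.jac ψ χ) (mLie φ ξ) + mIns1 (𝔩.jac ψ (𝔩.br φ χ)) ξ +
        (mLie ψ (mIns1 (𝔩.jac φ χ) ξ) - mIns1 (𝔩.jac φ χ) (mLie ψ ξ) -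
          mIns1 (𝔩.jac φ (𝔩.br ψ χ)) ξ) + mIns1 (𝔩.jac (𝔩.br φ ψ) χ) ξ -
        (mLie χ (mIns1 (𝔩.jac φ ψ) ξ) - mIns1 (𝔩.jac φ ψ) (mLie χ ξ)) +
        mIns1 (𝔩.connL (𝔩.jac φ ψ χ)) ξ := by
  refine eq_of_anticomm (fun ξ => mLie φ (mIns1 (𝔩.jac ψ χ) ξ))
    (fun ξ => mIns1 (𝔩.jac ψ χ) (mLie φ ξ) + mIns1 (𝔩.jac ψ (𝔩.br φ χ)) ξ +
        (mLie ψ (mIns1 (𝔩.jac φ χ) ξ) - mIns1 (𝔩.jac φ χ) (mLie ψ ξ) -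
          mIns1 (𝔩.jac φ (𝔩.br ψ χ)) ξ) + mIns1 (𝔩.jac (𝔩.br φ ψ) χ) ξ -
        (mLie χ (mIns1 (𝔩.jac φ ψ) ξ) - mIns1 (𝔩.jac φ ψ) (mLie χ ξ)) +
        mIns1 (𝔩.connL (𝔩.jac φ ψ χ)) ξ) (fun ξ η => ?_) (fun ξ w => ?_) (fun ξ => ?_) ξ
  · simp only [map_zero, map_add, map_sub, map_neg, mContr_mLie, mContr_mIns1, mContrKer_mLie,
      mContrKer_mIns1, mContr_mContrKer, coe_conn, connL_apply, conn_jac_eq φ ψ χ η,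
      mContrKer_add, mContrKer_sub]
    abel
  · simp only [map_zero, map_add, map_sub, map_neg, mContrKer_mLie, mContrKer_mIns1, mContr_mLie,
      mContr_mIns1, mContr_mContrKer, coe_conn, connL_apply]
    abel
  · simp only [map_zero, map_add, map_sub, map_neg, bot_mLie, bot_mIns1, add_zero, zero_add,
      sub_zero, neg_zero, sub_self]

theorem mLie_mIns2 (φ ψ : 𝒜) (ξ : mixed 𝔩) :
    mLie φ (mIns2 ψ ξ) =
      mIns2 ψ (mLie φ ξ) + mLie ψ (mIns2 φ ξ) - mIns2 φ (mLie ψ ξ) + mIns2 (𝔩.br φ ψ) ξ -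
        mCov 𝔩 (mIns1 (𝔩.jac φ ψ) ξ) - mIns1 (𝔩.jac φ ψ) (mCov 𝔩 ξ) := by
  refine eq_of_comm (fun ξ => mLie φ (mIns2 ψ ξ))
    (fun ξ => mIns2 ψ (mLie φ ξ) + mLie ψ (mIns2 φ ξ) - mIns2 φ (mLie ψ ξ) + mIns2 (𝔩.br φ ψ) ξ -
        mCov 𝔩 (mIns1 (𝔩.jac φ ψ) ξ) - mIns1 (𝔩.jac φ ψ) (mCov 𝔩 ξ)) (fun ξ χ => ?_)
        (fun ξ w => ?_) (fun ξ => ?_) ξ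
  · simp only [map_zero, map_add, map_sub, map_neg, mContr_mLie, mContr_mIns2, mContr_mCov,
      mContr_mIns1,
      mContrKer_mLie, mContrKer_mIns2, mContrKer_mCov, mContrKer_mIns1, mContr_mContrKer,
      coe_conn, connL_apply, mLie_mIns1_jac φ ψ χ]
    abel
  · simp only [map_zero, map_add, map_sub, map_neg, mContrKer_mLie, mContrKer_mIns2, mContrKer_mCov,
      mContrKer_mIns1, mContr_mLie, mContr_mIns2, mContr_mCov, mContr_mIns1, mContr_mContrKer,
      coe_conn, connL_apply, mIns1_mIns1 (𝔩.connL w)]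
    abel
  · simp only [map_zero, map_add, map_sub, map_neg, bot_mLie, bot_mIns2, bot_mCov, bot_mIns1,
      add_zero, zero_add, sub_zero, neg_zero, sub_self]

theorem mLie_mIns3 (φ : 𝒜) (ξ : mixed 𝔩) :
    mLie φ (mIns3 𝔩 ξ) =
      mIns3 𝔩 (mLie φ ξ) + mCov 𝔩 (mIns2 φ ξ) - mIns2 φ (mCov 𝔩 ξ) := by
  refine eq_of_anticomm (fun ξ => mLie φ (mIns3 𝔩 ξ))
    (fun ξ => mIns3 𝔩 (mLie φ ξ) + mCov 𝔩 (mIns2 φ ξ) - mIns2 φ (mCov 𝔩 ξ)) (fun ξ χ => ?_)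
        (fun ξ w => ?_) (fun ξ => ?_) ξ
  · simp only [map_zero, map_add, map_sub, map_neg, mContr_mLie, mContr_mIns3, mContr_mCov,
      mContr_mIns2,
      mContr_mIns1, mContrKer_mLie, mContrKer_mIns3, mContrKer_mCov, mContrKer_mIns2,
      mContrKer_mIns1, mContr_mContrKer, coe_conn, connL_apply, mLie_mIns2 φ χ]
    abel
  · simp only [map_zero, map_add, map_sub, map_neg, mContrKer_mLie, mContrKer_mIns3, mContrKer_mCov,
      mContrKer_mIns2, mContrKer_mIns1, mContr_mLie, mContr_mIns3, mContr_mCov, mContr_mIns2,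
      mContr_mIns1, mContr_mContrKer, coe_conn, connL_apply, mIns1_mIns2]
    abel
  · simp only [map_zero, map_add, map_sub, map_neg, bot_mLie, bot_mIns3, bot_mCov, bot_mIns2,
      bot_mIns1, add_zero, zero_add, sub_zero, neg_zero, sub_self]

/-- Successive contractions with elements of `𝒜` lead through `mLie_mIns3` and `mLie_mIns2` to
`mLie_mIns1_jac`, and a fourth one to `bianchi`. -/
theorem mCov_mIns3 (ξ : mixed 𝔩) :
    mCov 𝔩 (mIns3 𝔩 ξ) =
      -mIns3 𝔩 (mCov 𝔩 ξ) := by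
  refine eq_of_comm (fun ξ => mCov 𝔩 (mIns3 𝔩 ξ))
    (fun ξ => -mIns3 𝔩 (mCov 𝔩 ξ)) (fun ξ χ => ?_) (fun ξ w => ?_) (fun ξ => ?_) ξ
  · simp only [map_zero, map_add, map_sub, map_neg, mContr_mCov, mContr_mIns3, mContr_mLie,
      mContr_mIns2,
      mContr_mIns1, mContrKer_mCov, mContrKer_mIns3, mContrKer_mLie, mContrKer_mIns2,
      mContrKer_mIns1, mContr_mContrKer, coe_conn, connL_apply, mLie_mIns3]
    abel
  · simp only [map_zero, map_add, map_sub, map_neg, mContrKer_mCov, mContrKer_mIns3, mContrKer_mLie,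
      mContrKer_mIns2, mContrKer_mIns1, mContr_mCov, mContr_mIns3, mContr_mLie, mContr_mIns2,
      mContr_mIns1, mContr_mContrKer, coe_conn, connL_apply, mIns1_mIns3]
    abel
  · simp only [map_zero, map_add, map_sub, map_neg, bot_mCov, bot_mIns3, bot_mLie, bot_mIns2,
      bot_mIns1, add_zero, zero_add, sub_zero, neg_zero, sub_self]

/-! ### The differential -/

variable (𝔩) in
/-- The differential `d = D + Ĵ + δ̂`. -/
def dif : 𝔩.Tot →ₗ[ℝ] 𝔩.Tot := 𝔩.cov + 𝔩.ins3 (fun φ ψ χ => 𝔩.jac φ ψ χ) + 𝔩.del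

theorem dif_mem {ξ : 𝔩.Tot} (hξ : ξ ∈ mixed 𝔩) : 𝔩.dif ξ ∈ mixed 𝔩 :=
  add_mem (add_mem (cov_mem hξ) (ins3_jac_mem hξ)) (del_mem hξ)

/-- By bidegree this splits into `δ̂² = 0`, `Dδ̂ + δ̂D = 0`, `D² + Ĵδ̂ + δ̂Ĵ = 0`, `DĴ + ĴD = 0` and
`Ĵ² = 0`. -/
theorem dif_dif {ξ : 𝔩.Tot} (hξ : ξ ∈ mixed 𝔩) : 𝔩.dif (𝔩.dif ξ) = 0 := by
  let x : mixed 𝔩 := ⟨ξ, hξ⟩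
  let d : mixed 𝔩 →ₗ[ℝ] mixed 𝔩 := mCov 𝔩 + mIns3 𝔩 + mDel 𝔩
  have hd : d (d x) = 0 := by
    simp only [d, LinearMap.add_apply, map_add, mCov_mCov, mCov_mIns3, mIns3_mIns3, mDel_mCov,
      mDel_mDel]
    abel
  exact congrArg Subtype.val hd

theorem cov_apply_eq_zero {ξ : 𝔩.Tot} {p q : ℕ} (h : ∀ p', p' + 1 = p → ξ p' q = 0) :
    𝔩.cov ξ p q = 0 := by
  cases p with
  | zero => rfl
  | succ p =>
    change koszul (𝔩.symConn q) 𝔩.br p (ξ p q) = 0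
    rw [h p rfl, map_zero]

theorem del_apply_eq_zero {ξ : 𝔩.Tot} {p q : ℕ} (h : ∀ q', q' + 1 = q → ξ (p + 1) q' = 0) :
    𝔩.del ξ p q = 0 := by
  cases q with
  | zero => rfl
  | succ q => funext ψ v; simp [del, h q rfl]

theorem ins3_apply_eq_zero (θ : 𝒜 → 𝒜 → 𝒜 → 𝔩.ker) {ξ : 𝔩.Tot} {p q : ℕ}
    (h : ∀ p', p' + 3 = p → ξ p' (q + 1) = 0) : 𝔩.ins3 θ ξ p q = 0 := by
  match p with
  | 0 | 1 | 2 => rfl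
  | p + 3 => funext ψ v; simp [ins3, h p rfl]

variable (𝔩) in
/-- The cochains of total degree `n`. -/
def cochains (n : ℕ) : Submodule ℝ 𝔩.Tot where
  carrier := {ξ | ξ ∈ mixed 𝔩 ∧ ∀ p q, p + 2 * q ≠ n → ξ p q = 0}
  add_mem' := fun h k => ⟨add_mem h.1 k.1, fun p q hn => by
    rw [Pi.add_apply, Pi.add_apply, h.2 p q hn, k.2 p q hn, add_zero]⟩
  zero_mem' := ⟨zero_mem _, fun _ _ _ => rfl⟩
  smul_mem' := fun c _ h => ⟨Submodule.smul_mem _ c h.1, fun p q hn => by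
    rw [Pi.smul_apply, Pi.smul_apply, h.2 p q hn, smul_zero]⟩

theorem dif_mem_cochains {n : ℕ} {ξ : 𝔩.Tot} (hξ : ξ ∈ 𝔩.cochains n) :
    𝔩.dif ξ ∈ 𝔩.cochains (n + 1) := by
  refine ⟨dif_mem hξ.1, fun p q h => ?_⟩
  change 𝔩.cov ξ p q + 𝔩.ins3 _ ξ p q + 𝔩.del ξ p q = 0
  rw [cov_apply_eq_zero fun p' hp => hξ.2 _ _ (by omega),
    ins3_apply_eq_zero _ fun p' hp => hξ.2 _ _ (by omega),
    del_apply_eq_zero fun q' hq => hξ.2 _ _ (by omega), add_zero, add_zero]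

variable (𝔩) in
/-- The component of bidegree `(p, q)` as a family. -/
def comp (p q : ℕ) : 𝔩.Tot →ₗ[ℝ] 𝔩.Tot where
  toFun ξ p' q' := if p' = p ∧ q' = q then ξ p' q' else 0
  map_add' ξ η := by funext p' q'; simp only [Pi.add_apply]; split_ifs <;> simp
  map_smul' c ξ := by funext p' q'; simp only [Pi.smul_apply]; split_ifs <;> simp

theorem comp_mem (p q : ℕ) {ξ : 𝔩.Tot} (hξ : ξ ∈ mixed 𝔩) : 𝔩.comp p q ξ ∈ mixed 𝔩 := by
  intro p' q'
  by_cases h : p' = p ∧ q' = q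
  · simpa only [comp, LinearMap.coe_mk, AddHom.coe_mk, if_pos h] using hξ p' q'
  · simp only [comp, LinearMap.coe_mk, AddHom.coe_mk, if_neg h]
    exact (zero_mem (mixed 𝔩) : (0 : 𝔩.Tot) ∈ mixed 𝔩) p' q'

theorem comp_self (p q : ℕ) (ξ : 𝔩.Tot) : 𝔩.comp p q ξ p q = ξ p q := by simp [comp]

theorem comp_of_ne {p q p' q' : ℕ} (h : ¬(p' = p ∧ q' = q)) (ξ : 𝔩.Tot) :
    𝔩.comp p q ξ p' q' = 0 := by simp [comp, h]

/-! ### Exactness of the Koszul operator -/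

section Exact

variable (pr : 𝒜 →ₗ[R] 𝔩.ker) (hpr : ∀ v : 𝔩.ker, pr v = v)

/-- The anticommutator of `mDel` with the homotopy defined by a projection onto `ker`. -/
def numOp : Module.End ℝ (mixed 𝔩) := mDel 𝔩 ∘ₗ mIns1 pr + mIns1 pr ∘ₗ mDel 𝔩

theorem numOp_apply (ξ : mixed 𝔩) :
    numOp pr ξ = mDel 𝔩 (mIns1 pr ξ) + mIns1 pr (mDel 𝔩 ξ) := rfl

/-- This is the counting property of `N`: an argument fixed by `pr` is counted once, and one killed
by `pr` is not counted. -/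
theorem mContr_numOp (φ : 𝒜) (ξ : mixed 𝔩) :
    mContr φ (numOp pr ξ) = numOp pr (mContr φ ξ) + mContr (pr φ : 𝒜) ξ := by
  simp only [numOp_apply, map_add, mContr_mDel, mContr_mIns1, map_sub, map_neg, mContrKer_mDel]
  abel

include hpr in
theorem mContrKer_numOp (v : 𝔩.ker) (ξ : mixed 𝔩) :
    mContrKer v (numOp pr ξ) = numOp pr (mContrKer v ξ) + mContrKer v ξ := by
  simp only [numOp_apply, map_add, mContrKer_mDel, mContrKer_mIns1, mContr_mIns1, hpr]
  abel

theorem numOp_mDel (ξ : mixed 𝔩) : numOp pr (mDel 𝔩 ξ) = mDel 𝔩 (numOp pr ξ) := by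
  simp only [numOp_apply, map_add, mDel_mDel, map_zero, add_zero, zero_add]

open Polynomial in
-- If `T` intertwines `N` with `N' + c`, it intertwines `f(N)` with `f(N' + c)`.
theorem aeval_shift {V W : Type*} [AddCommGroup V] [Module ℝ V] [AddCommGroup W] [Module ℝ W]
    (N : Module.End ℝ V) (N' : Module.End ℝ W) (T : V →ₗ[ℝ] W) (c : ℝ)
    (h : ∀ x, T (N x) = N' (T x) + c • T x) (f : ℝ[X]) (x : V) :
    T (aeval N f x) = aeval N' (f.comp (X + C c)) (T x) := by
  induction f using Polynomial.induction_on' generalizing x with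
  | add f g hf hg => simp [hf, hg]
  | monomial n a =>
    simp only [aeval_monomial, monomial_comp, map_mul, map_pow, map_add, aeval_X, aeval_C,
      Module.End.mul_apply, Module.algebraMap_end_apply, map_smul]
    congr 1
    induction n generalizing x with
    | zero => rfl
    | succ n ih =>
      rw [pow_succ, pow_succ, Module.End.mul_apply, Module.End.mul_apply, ih, h]
      rfl

open Polynomial in
include hpr in
-- A polynomial vanishing at all possible eigenvalues `q, …, q + p` of `N` annihilates bidegree `(p,
-- q)`. Working with polynomials replaces an eigenspace decomposition: each contraction removes an
-- argument and translates the polynomial by `1` or `0`.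
theorem aeval_numOp_apply_eq_zero (p : ℕ) : ∀ (q : ℕ) (f : ℝ[X]),
    (∀ k ≤ p, f.eval ((q : ℝ) + k) = 0) → ∀ ξ : mixed 𝔩, (aeval (numOp pr) f ξ).1 p q = 0 := by
  induction p with
  | zero =>
    intro q
    induction q with
    | zero =>
      intro f hf ξ
      have h0 : f.coeff 0 = 0 := by
        rw [coeff_zero_eq_eval_zero]; simpa using hf 0 le_rfl
      -- Since `f(0) = 0`, a factor `N` splits off on the left, and `N` produces nothing in bidegree
      -- `(0, 0)`.
      rw [← divX_mul_X_add f, h0, mul_comm, C_0, add_zero, map_mul, aeval_X, Module.End.mul_apply]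
      change bot (numOp pr _) = 0
      simp only [numOp_apply, map_add, bot_mDel, bot_mIns1, add_zero]
    | succ q ih =>
      intro f hf ξ
      funext ψ v
      rw [← Fin.cons_self_tail v]
      have h := aeval_shift (numOp pr) (numOp pr) (mContrKer (v 0)) 1
        (fun x => by rw [mContrKer_numOp pr hpr, one_smul]) f ξ
      have h2 := ih (f.comp (X + C 1)) (fun k hk => by
        have := hf k hk
        push_cast at this
        rw [eval_comp, eval_add, eval_X, eval_C, ← this]; congr 1; ring) (mContrKer (v 0) ξ)
      rw [← h] at h2
      exact congrFun (congrFun h2 ψ) (Fin.tail v)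
  | succ p ih =>
    intro q f hf ξ
    funext ψ v
    rw [← Fin.cons_self_tail ψ]
    -- The part of `ψ 0` in `ker` shifts the polynomial by `1`, the complementary part by `0`; in
    -- both cases the remaining roots suffice for `p` arguments.
    have hsplit : mContr (ψ 0) (aeval (numOp pr) f ξ) =
        mContr (ψ 0 - pr (ψ 0) : 𝒜) (aeval (numOp pr) f ξ) +
          mContr (pr (ψ 0) : 𝒜) (aeval (numOp pr) f ξ) := by
      rw [← mContr_add, sub_add_cancel]
    have h1 := aeval_shift (numOp pr) (numOp pr) (mContr (pr (ψ 0) : 𝒜)) 1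
      (fun x => by rw [mContr_numOp pr, hpr, one_smul]) f ξ
    have h2 := aeval_shift (numOp pr) (numOp pr) (mContr (ψ 0 - pr (ψ 0) : 𝒜)) 0
      (fun x => by
        rw [mContr_numOp pr, map_sub, hpr, sub_self, ZeroMemClass.coe_zero, zero_smul]
        congr 1
        exact Subtype.ext (contr_zero x.2)) f ξ
    have h3 := ih q (f.comp (X + C 1)) (fun k hk => by
      have := hf (k + 1) (by omega)
      push_cast at this
      rw [eval_comp, eval_add, eval_X, eval_C, ← this]; congr 1; ring)
        (mContr (pr (ψ 0) : 𝒜) ξ)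
    have h4 := ih q (f.comp (X + C 0)) (fun k hk => by
      rw [eval_comp, eval_add, eval_X, eval_C, add_zero]; exact hf k (by omega))
        (mContr (ψ 0 - pr (ψ 0) : 𝒜) ξ)
    rw [← h1] at h3
    rw [← h2] at h4
    have h5 : (mContr (ψ 0) (aeval (numOp pr) f ξ)).1 p q = 0 := by
      rw [hsplit, Submodule.coe_add, Pi.add_apply, Pi.add_apply, h3, h4, add_zero]
    exact congrFun (congrFun h5 (Fin.tail ψ)) v

open Polynomial in
include hpr in
/-- The Koszul operator is exact in bidegrees `(p, q)` with `q ≠ 0`. -/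
theorem exists_mDel_eq (p q : ℕ) (hq : q ≠ 0) (ξ : mixed 𝔩) (hξ : mDel 𝔩 ξ = 0) :
    ∃ η : mixed 𝔩, (mDel 𝔩 η).1 p q = ξ.1 p q := by
  let f : ℝ[X] := ∏ k ∈ Finset.range (p + 1), (X - C ((q : ℝ) + k))
  have hf : ∀ k ≤ p, f.eval ((q : ℝ) + k) = 0 := fun k hk => by
    rw [eval_prod]
    exact Finset.prod_eq_zero (Finset.mem_range.2 (by omega : k < p + 1)) (by simp)
  -- All roots `q + k` are positive because `q ≠ 0`.
  have hf0 : f.coeff 0 ≠ 0 := by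
    rw [coeff_zero_eq_eval_zero, eval_prod]
    refine Finset.prod_ne_zero_iff.2 fun k _ => ?_
    simp only [eval_sub, eval_X, eval_C, zero_sub, ne_eq, neg_eq_zero]
    positivity
  have h := aeval_numOp_apply_eq_zero pr hpr p q f hf ξ
  have hc : ∀ (g : ℝ[X]) (ζ : mixed 𝔩),
      aeval (numOp pr) g (mDel 𝔩 ζ) = mDel 𝔩 (aeval (numOp pr) g ζ) := fun g ζ => by
    have := aeval_shift (numOp pr) (numOp pr) (mDel 𝔩) 0
      (fun x => by rw [numOp_mDel, zero_smul, add_zero]) g ζ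
    rw [this, C_0, add_zero, comp_X]
  have hN : numOp pr ξ = mDel 𝔩 (mIns1 pr ξ) := by
    rw [numOp_apply, hξ, map_zero, add_zero]
  -- Write `f = g·X + f(0)`. On a `δ̂`-closed `ξ`, `f(N)ξ = δ̂(g(N)hξ) + f(0)ξ`, and its component
  -- in bidegree `(p, q)` is zero; solving for `ξ` gives the primitive.
  rw [← divX_mul_X_add f, map_add, map_mul, aeval_X, aeval_C, LinearMap.add_apply,
    Module.End.mul_apply, hN, hc, Module.algebraMap_end_apply, Submodule.coe_add,
    Submodule.coe_smul] at h
  refine ⟨-(f.coeff 0)⁻¹ • aeval (numOp pr) f.divX (mIns1 pr ξ), ?_⟩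
  rw [map_smul, Submodule.coe_smul, Pi.smul_apply, Pi.smul_apply]
  have h' := eq_neg_of_add_eq_zero_left h
  rw [h', smul_neg, neg_smul, neg_neg, Pi.smul_apply, Pi.smul_apply, smul_smul,
    inv_mul_cancel₀ hf0, one_smul]

include hpr in
-- Since `δ̂` has bidegree `(-1, 1)`, the primitive may be truncated to bidegree `(p + 1, q)`
-- without changing its image in `(p, q + 1)`.
theorem exists_del_eq (p q : ℕ) {ξ : 𝔩.Tot} (hξ : ξ ∈ mixed 𝔩)
    (h : ∀ p' q', ¬(p' = p ∧ q' = q + 1) → ξ p' q' = 0) (hd : 𝔩.del ξ = 0) :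
    ∃ η ∈ mixed 𝔩, (∀ p' q', ¬(p' = p + 1 ∧ q' = q) → η p' q' = 0) ∧ 𝔩.del η = ξ := by
  obtain ⟨η, hη⟩ := exists_mDel_eq pr hpr p (q + 1) (Nat.succ_ne_zero q) ⟨ξ, hξ⟩ (Subtype.ext hd)
  refine ⟨𝔩.comp (p + 1) q η.1, comp_mem _ _ η.2, fun p' q' h' => comp_of_ne h' _, ?_⟩
  funext p' q'
  by_cases h' : p' = p ∧ q' = q + 1
  · obtain ⟨rfl, rfl⟩ := h'
    refine Eq.trans ?_ hη
    funext ψ v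
    simp only [del, mDel, LinearMap.coe_restrict_apply, LinearMap.coe_mk, AddHom.coe_mk,
      comp_self]
  · rw [h p' q' h']
    exact del_apply_eq_zero fun k hk => comp_of_ne (by omega) _

include hpr in
/-- Up to a coboundary, a cochain whose differential has only components with `q = 0` has only
components with `q = 0`. -/
theorem exists_sub_dif_apply_eq_zero (m : ℕ) : ∀ (n : ℕ) (ξ : 𝔩.Tot), ξ ∈ 𝔩.cochains n →
    (∀ p q, m < q → ξ p q = 0) → (∀ p q, q ≠ 0 → 𝔩.dif ξ p q = 0) →
    ∃ ζ ∈ mixed 𝔩, (∀ p q, p + 2 * q + 1 ≠ n → ζ p q = 0) ∧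
      ∀ p q, q ≠ 0 → (ξ - 𝔩.dif ζ) p q = 0 := by
  induction m with
  | zero =>
    intro n ξ _ h _
    exact ⟨0, zero_mem _, fun _ _ _ => rfl, fun p q hq => by
      rw [map_zero, sub_zero]; exact h p q (Nat.pos_of_ne_zero hq)⟩
  | succ m ih =>
    intro n ξ hξ h hd
    by_cases hn : n < 2 * (m + 1)
    · refine ih n ξ hξ (fun p q hq => ?_) hd
      exact hξ.2 p q (by omega)
    obtain ⟨p, rfl⟩ : ∃ p, n = p + 2 * (m + 1) := ⟨n - 2 * (m + 1), by omega⟩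
    -- In the row `q = m + 2` of `dξ` only `δ̂` contributes: `D` and `Ĵ` would need components of
    -- `ξ` in rows `m + 2` and `m + 3`, which vanish.
    have hdel : 𝔩.del (𝔩.comp p (m + 1) ξ) = 0 := by
      funext p' q'
      by_cases h' : p' + 1 = p ∧ q' = m + 2
      · obtain ⟨rfl, rfl⟩ := h'
        have h1 := hd p' (m + 2) (by omega)
        change 𝔩.cov ξ p' (m + 2) + 𝔩.ins3 _ ξ p' (m + 2) + 𝔩.del ξ p' (m + 2) = 0 at h1
        rw [cov_apply_eq_zero fun p' hp => h _ _ (by omega),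
          ins3_apply_eq_zero _ fun p' hp => h _ _ (by omega), zero_add, zero_add] at h1
        refine Eq.trans ?_ h1
        funext ψ v
        simp only [del, LinearMap.coe_mk, AddHom.coe_mk, comp_self]
      · exact del_apply_eq_zero fun k hk => comp_of_ne (by omega) _
    obtain ⟨η, hη, hη', hηd⟩ := exists_del_eq pr hpr p m (comp_mem p (m + 1) hξ.1)
      (fun p' q' h' => comp_of_ne h' _) hdel
    have hηc : η ∈ 𝔩.cochains (p + 1 + 2 * m) := ⟨hη, fun p' q' h' => hη' _ _ (by omega)⟩
    have hdη : 𝔩.dif η ∈ 𝔩.cochains (p + 2 * (m + 1)) := by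
      have := dif_mem_cochains hηc
      rwa [show p + 1 + 2 * m + 1 = p + 2 * (m + 1) by ring] at this
    -- As `η` lives in row `m`, its `D`- and `Ĵ`-parts do not reach the rows above `m`. There `dη`
    -- is just `δ̂η`, the top component of `ξ`.
    have hh1 : ∀ p' q', m < q' → (ξ - 𝔩.dif η) p' q' = 0 := by
      intro p' q' hq
      change ξ p' q' - (𝔩.cov η p' q' + 𝔩.ins3 _ η p' q' + 𝔩.del η p' q') = 0
      rw [cov_apply_eq_zero fun p' hp => hη' _ _ (by omega),
          ins3_apply_eq_zero _ fun p' hp => hη' _ _ (by omega), zero_add, zero_add, hηd]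
      by_cases h' : p' = p ∧ q' = m + 1
      · rw [h'.1, h'.2, comp_self, sub_self]
      · rw [comp_of_ne h', sub_zero]
        by_cases h'' : q' = m + 1
        · exact hξ.2 _ _ (by omega)
        · exact h _ _ (by omega)
    have hh2 : ∀ p' q', q' ≠ 0 → 𝔩.dif (ξ - 𝔩.dif η) p' q' = 0 := by
      intro p' q' hq
      rw [map_sub, dif_dif hη, sub_zero]
      exact hd p' q' hq
    obtain ⟨ζ, hζ, hζ', hζd⟩ := ih (p + 2 * (m + 1)) (ξ - 𝔩.dif η) (sub_mem hξ hdη) hh1 hh2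
    refine ⟨η + ζ, add_mem hη hζ, fun p' q' h' => ?_, fun p' q' hq => ?_⟩
    · rw [Pi.add_apply, Pi.add_apply, hη' _ _ (by omega), hζ' _ _ h', add_zero]
    · rw [map_add, ← sub_sub]; exact hζd p' q' hq

end Exact

/-! ### Comparison with the forms on the image of the anchor -/

section Pull

variable {𝓛 : Type*} [AddCommGroup 𝓛] [Module R 𝓛]

variable (𝔩) in
/-- The pullback of maps of `n` arguments along the anchor. -/
def pull (r : 𝒜 →ₗ[R] 𝓛) (n : ℕ) : ((Fin n → 𝓛) → R) →ₗ[ℝ] 𝔩.Tot where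
  toFun α p q ψ _ := if h : p = n ∧ q = 0 then α (fun i => r (ψ (Fin.cast h.1.symm i))) else 0
  map_add' α β := by
    funext p q ψ v
    simp only [Pi.add_apply]
    split_ifs <;> simp
  map_smul' c α := by
    funext p q ψ v
    simp only [Pi.smul_apply]
    split_ifs <;> simp

variable (r : 𝒜 →ₗ[R] 𝓛)

theorem pull_self (n : ℕ) (α : (Fin n → 𝓛) → R) (ψ : Fin n → 𝒜) (v) :
    𝔩.pull r n α n 0 ψ v = α fun i => r (ψ i) := by
  simp [pull]

theorem pull_of_ne {n p q : ℕ} (h : ¬(p = n ∧ q = 0)) (α : (Fin n → 𝓛) → R) :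
    𝔩.pull r n α p q = 0 := by
  funext ψ v
  simp [pull, h]

theorem pull_mem_cochains {n : ℕ} {α : (Fin n → 𝓛) → R} (hα : α ∈ Forms R 𝓛 n) :
    𝔩.pull r n α ∈ 𝔩.cochains n := by
  obtain ⟨a, rfl⟩ := hα
  refine ⟨fun p q => ?_, fun p q h => pull_of_ne r (by omega) _⟩
  by_cases h : p = n ∧ q = 0
  · obtain ⟨rfl, rfl⟩ := h
    refine ⟨fun v => ⟨a.compLinearMap r, ?_⟩, fun ψ =>
      ⟨MultilinearMap.constOfIsEmpty R _ (a fun i => r (ψ i)), ?_, fun _ _ => rfl⟩⟩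
    · funext ψ
      rw [pull_self]
      rfl
    · funext v
      rw [pull_self]
      rfl
  · rw [pull_of_ne r h]
    exact (zero_mem (mixed 𝔩) : (0 : 𝔩.Tot) ∈ mixed 𝔩) p q

theorem pull_injective {σ : 𝓛 → 𝒜} (hσ : ∀ X, r (σ X) = X) (n : ℕ) :
    Function.Injective (𝔩.pull r n) := by
  intro α β h
  funext X
  have := congrFun (congrFun (congrFun (congrFun h n) 0) fun i => σ (X i)) Fin.elim0
  simpa only [pull_self, hσ] using this

variable {act' : 𝓛 → R →ₗ[ℝ] R} {br' : 𝓛 → 𝓛 → 𝓛}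
  (hact : ∀ φ, act' (r φ) = 𝔩.act φ) (hbr : ∀ φ ψ, r (𝔩.br φ ψ) = br' (r φ) (r ψ))

include hact hbr in
theorem koszul_pull (n : ℕ) (α : (Fin n → 𝓛) → R) (ψ : Fin (n + 1) → 𝒜) (v : Fin 0 → 𝔩.ker) :
    koszul (𝔩.symConn 0) 𝔩.br n (fun ψ _ => α fun i => r (ψ i)) ψ v =
      koszul act' br' n α fun i => r (ψ i) := by
  have hs : ∀ (φ : 𝒜) (c : R), 𝔩.symConn 0 φ (fun _ => c) v = act' (r φ) c := by
    intro φ c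
    simp [symConn, hact]
  have hc : ∀ (m : ℕ) (φ : 𝒜) (χ : Fin m → 𝒜),
      (fun i => r ((Fin.cons φ χ : Fin (m + 1) → 𝒜) i)) =
        (Fin.cons (r φ) fun i => r (χ i) : Fin (m + 1) → 𝓛) := by
    intro m φ χ
    funext i
    cases i using Fin.cases <;> simp
  cases n with
  | zero =>
    simp only [koszul, LinearMap.coe_mk, AddHom.coe_mk, Finset.sum_apply, Pi.smul_apply, hs]
    rfl
  | succ n =>
    simp only [koszul, LinearMap.coe_mk, AddHom.coe_mk, Finset.sum_apply, Pi.smul_apply, hs,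
      Pi.add_apply, ite_apply, Pi.zero_apply, hc, hbr]
    rfl

include hact hbr in
theorem cov_pull (n : ℕ) (α : (Fin n → 𝓛) → R) :
    𝔩.cov (𝔩.pull r n α) = 𝔩.pull r (n + 1) (koszul act' br' n α) := by
  funext p q
  by_cases h : p = n + 1 ∧ q = 0
  · obtain ⟨rfl, rfl⟩ := h
    funext ψ v
    rw [pull_self, ← koszul_pull (𝔩 := 𝔩) r hact hbr n α ψ v]
    change koszul (𝔩.symConn 0) 𝔩.br n (𝔩.pull r n α n 0) ψ v = _
    have he : 𝔩.pull r n α n 0 = fun ψ _ => α fun i => r (ψ i) := by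
      funext ψ v
      exact pull_self r n α ψ v
    rw [he]
  · rw [pull_of_ne r h]
    exact cov_apply_eq_zero fun p' hp => pull_of_ne r (by omega) _

variable (hker : ∀ φ, r φ = 0 ↔ φ ∈ 𝔩.ker)

include hker in
theorem del_pull {n : ℕ} {α : (Fin n → 𝓛) → R} (hα : α ∈ Forms R 𝓛 n) :
    𝔩.del (𝔩.pull r n α) = 0 := by
  obtain ⟨a, rfl⟩ := hα
  funext p q
  by_cases h : p + 1 = n ∧ q = 1
  · obtain ⟨rfl, rfl⟩ := h
    funext ψ v
    simp only [del, LinearMap.coe_mk, AddHom.coe_mk, pull_self]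
    refine Finset.sum_eq_zero fun j _ => a.map_coord_zero 0 ?_
    exact (hker _).2 (v j).2
  · exact del_apply_eq_zero fun q' hq => pull_of_ne r (by omega) _

include hact hbr hker in
theorem dif_pull {n : ℕ} {α : (Fin n → 𝓛) → R} (hα : α ∈ Forms R 𝓛 n) :
    𝔩.dif (𝔩.pull r n α) = 𝔩.pull r (n + 1) (koszul act' br' n α) := by
  have h3 : 𝔩.ins3 (fun φ ψ χ => 𝔩.jac φ ψ χ) (𝔩.pull r n α) = 0 := by
    funext p q
    exact ins3_apply_eq_zero _ fun p' hp => pull_of_ne r (by omega) _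
  change 𝔩.cov _ + 𝔩.ins3 _ _ + 𝔩.del _ = _
  rw [h3, del_pull r hker hα, add_zero, add_zero, cov_pull r hact hbr]

variable (σ : 𝓛 →ₗ[R] 𝒜) (hσ : ∀ X, r (σ X) = X)

include hker in
-- In bidegree `(p, 1)`, `δ̂ξ = 0` says that `ξ` vanishes when its first argument is in `ker`.
-- Contractions of `ξ` are `δ̂`-closed again, so the arguments can be exchanged one at a time.
theorem apply_eq_of_del_eq_zero (p : ℕ) : ∀ ξ ∈ mixed 𝔩, 𝔩.del ξ = 0 → ∀ (ψ ψ' : Fin p → 𝒜) v,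
    (∀ i, r (ψ i) = r (ψ' i)) → ξ p 0 ψ v = ξ p 0 ψ' v := by
  induction p with
  | zero => intro ξ _ _ ψ ψ' v _; rw [Subsingleton.elim ψ ψ']
  | succ p ih =>
    intro ξ hξ hd ψ ψ' v h
    have h1 := ih (𝔩.contr (ψ 0) ξ) (contr_mem hξ _)
      (by rw [← neg_eq_zero, ← contr_del _ hξ, hd, map_zero]) (Fin.tail ψ) (Fin.tail ψ') v
      fun i => h i.succ
    rw [contr_apply, contr_apply, Fin.cons_self_tail] at h1
    rw [h1]
    have hk : ψ 0 - ψ' 0 ∈ 𝔩.ker := by rw [← hker, map_sub, h, sub_self]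
    have h2 : 𝔩.contr (ψ 0 - ψ' 0) ξ p 0 (Fin.tail ψ') v = 0 := by
      have e : 𝔩.del ξ p 1 (Fin.tail ψ') (fun _ => ⟨_, hk⟩) = 0 := by rw [hd]; rfl
      change ∑ j : Fin 1, ξ (p + 1) 0 (Fin.cons (ψ 0 - ψ' 0) (Fin.tail ψ')) _ = 0 at e
      rw [Fin.sum_univ_one] at e
      rw [contr_apply, ← e]
      congr 1
      exact Subsingleton.elim _ _
    rw [contr_sub hξ] at h2
    have h3 := sub_eq_zero.1 h2
    rw [contr_apply, contr_apply, Fin.cons_self_tail] at h3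
    exact h3

include hker hσ in
/-- A cochain with only a component with `q = 0`, which vanishes on `ker`, is a pullback. -/
theorem exists_eq_pull {n : ℕ} {ξ : 𝔩.Tot} (hξ : ξ ∈ 𝔩.cochains n)
    (h0 : ∀ p q, q ≠ 0 → ξ p q = 0) (hd : ∀ p q, q ≠ 0 → 𝔩.dif ξ p q = 0) :
    ∃ α ∈ Forms R 𝓛 n, ξ = 𝔩.pull r n α := by
  have hdel : 𝔩.del ξ = 0 := by
    funext p q
    by_cases hq : q = 0
    · subst hq; rfl
    · have h1 := hd p q hq
      change 𝔩.cov ξ p q + 𝔩.ins3 _ ξ p q + 𝔩.del ξ p q = 0 at h1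
      rwa [cov_apply_eq_zero fun p' hp => h0 _ _ hq,
        ins3_apply_eq_zero _ fun p' hp => h0 _ _ (by omega), zero_add, zero_add] at h1
  refine ⟨fun X => ξ n 0 (fun i => σ (X i)) Fin.elim0, ?_, ?_⟩
  · obtain ⟨a, ha⟩ := (hξ.1 n 0).1 Fin.elim0
    exact ⟨a.compLinearMap σ, funext fun X => congrFun ha fun i => σ (X i)⟩
  · funext p q
    by_cases h : p = n ∧ q = 0
    · obtain ⟨rfl, rfl⟩ := h
      funext ψ v
      rw [pull_self, Subsingleton.elim v Fin.elim0]
      exact apply_eq_of_del_eq_zero r hker p ξ hξ.1 hdel _ _ _ fun i => (hσ _).symm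
    · rw [pull_of_ne r h]
      by_cases hq : q = 0
      · exact hξ.2 _ _ (by omega)
      · exact h0 p q hq

variable (𝔩) in
/-- The cocycles of degree `n`. -/
def cocycles (n : ℕ) : Submodule ℝ 𝔩.Tot := 𝔩.cochains n ⊓ LinearMap.ker 𝔩.dif

variable (𝔩) in
/-- The coboundaries of degree `n`. -/
def coboundaries : ℕ → Submodule ℝ 𝔩.Tot
  | 0 => ⊥
  | n + 1 => (𝔩.cochains n).map 𝔩.dif

include hker hσ in
theorem exists_sub_dif_eq_pull {n : ℕ} {ξ : 𝔩.Tot} (hξ : ξ ∈ 𝔩.cochains n)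
    (hd : ∀ p q, q ≠ 0 → 𝔩.dif ξ p q = 0) :
    ∃ ζ ∈ mixed 𝔩, 𝔩.dif ζ ∈ 𝔩.coboundaries n ∧ ∃ α ∈ Forms R 𝓛 n,
      ξ - 𝔩.dif ζ = 𝔩.pull r n α := by
  -- The splitting of `r` yields the projection onto `ker` along the image of `σ`.
  let pr : 𝒜 →ₗ[R] 𝔩.ker := (LinearMap.id - σ ∘ₗ r).codRestrict 𝔩.ker fun φ => by
    rw [← hker]; simp [hσ]
  have hpr : ∀ v : 𝔩.ker, pr v = v := fun v => Subtype.ext (by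
    simp [pr, (hker v).2 v.2])
  obtain ⟨ζ, hζ, hζ', h⟩ := exists_sub_dif_apply_eq_zero pr hpr n n ξ hξ
    (fun p q hq => hξ.2 p q (by omega)) hd
  have hb : 𝔩.dif ζ ∈ 𝔩.coboundaries n := by
    cases n with
    | zero =>
      -- No bidegree satisfies `p + 2q + 1 = 0`, matching the zero space of coboundaries in degree
      -- `0`.
      have : ζ = 0 := by
        funext p q
        exact hζ' p q (by omega)
      rw [this, map_zero]
      exact zero_mem _
    | succ n => exact ⟨ζ, ⟨hζ, fun p q hpq => hζ' p q (by omega)⟩, rfl⟩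
  have hc : 𝔩.dif ζ ∈ 𝔩.cochains n := by
    cases n with
    | zero => rw [(Submodule.mem_bot ℝ).1 hb]; exact zero_mem _
    | succ n =>
      obtain ⟨η, hη, he⟩ := hb
      rw [← he]
      exact dif_mem_cochains hη
  refine ⟨ζ, hζ, hb, exists_eq_pull r hker σ hσ (sub_mem hξ hc) h fun p q hq => ?_⟩
  rw [map_sub, dif_dif hζ, sub_zero]
  exact hd p q hq

include hact hbr hker in
theorem pull_mem_cocycles {n : ℕ} {α : (Fin n → 𝓛) → R} (hα : α ∈ closedForms act' br' n) :
    𝔩.pull r n α ∈ 𝔩.cocycles n := by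
  refine ⟨pull_mem_cochains r hα.1, ?_⟩
  have h : koszul act' br' n α = 0 := hα.2
  change 𝔩.dif _ = 0
  rw [dif_pull r hact hbr hker hα.1, h, map_zero]

include hact hbr hker hσ in
/-- The pullback along the anchor is an isomorphism in cohomology. -/
theorem exists_cohomology_equiv (n : ℕ) :
    ∃ e : FormCohomology act' br' n ≃ₗ[ℝ]
        𝔩.cocycles n ⧸ (𝔩.coboundaries n).submoduleOf (𝔩.cocycles n),
      ∀ α : closedForms act' br' n, ∃ hα : 𝔩.pull r n α ∈ 𝔩.cocycles n,
        e (Submodule.Quotient.mk α) = Submodule.Quotient.mk ⟨𝔩.pull r n α, hα⟩ := by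
  let P : closedForms act' br' n →ₗ[ℝ] 𝔩.cocycles n :=
    (𝔩.pull r n).restrict fun α hα => pull_mem_cocycles r hact hbr hker hα
  have hP : (exactForms act' br' n).submoduleOf (closedForms act' br' n) =
      ((𝔩.coboundaries n).submoduleOf (𝔩.cocycles n)).comap P := by
    ext ⟨α, hα⟩
    change α ∈ exactForms act' br' n ↔ 𝔩.pull r n α ∈ 𝔩.coboundaries n
    cases n with
    | zero =>
      change α ∈ (⊥ : Submodule ℝ _) ↔ 𝔩.pull r 0 α ∈ (⊥ : Submodule ℝ _)
      rw [Submodule.mem_bot, Submodule.mem_bot]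
      exact (map_eq_zero_iff _ (pull_injective r hσ 0)).symm
    | succ n =>
      constructor
      · rintro ⟨β, hβ, rfl⟩
        exact ⟨𝔩.pull r n β, pull_mem_cochains r hβ, dif_pull r hact hbr hker hβ⟩
      -- Here `dη` is a pullback, so it lies in `q = 0`, and modulo a coboundary `η` is the pullback
      -- of some `β`. Injectivity of the pullback on cochains turns the equality of pullbacks into
      -- `dβ = α`.
      · rintro ⟨η, hη, he⟩
        obtain ⟨ζ, hζ, -, β, hβ, hηβ⟩ := exists_sub_dif_eq_pull r hker σ hσ hη
          fun p q hq => by rw [he]; exact pull_of_ne r (fun h => hq h.2) _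
        refine ⟨β, hβ, pull_injective (𝔩 := 𝔩) r hσ (n + 1) ?_⟩
        rw [← dif_pull r hact hbr hker hβ, ← hηβ, map_sub, dif_dif hζ, sub_zero, he]
  let Q := Submodule.mapQ _ ((𝔩.coboundaries n).submoduleOf (𝔩.cocycles n)) P hP.le
  have hQ : Function.Bijective Q := by
    constructor
    · rw [← LinearMap.ker_eq_bot, Submodule.ker_mapQ, ← hP, Submodule.mkQ_map_self]
    · intro x
      obtain ⟨⟨η, hη⟩, rfl⟩ := Submodule.Quotient.mk_surjective _ x
      have hd : 𝔩.dif η = 0 := hη.2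
      -- Every cocycle is a pullback modulo a coboundary; the form `β` is closed because its
      -- differential pulls back to zero.
      obtain ⟨ζ, hζ, hb, β, hβ, hηβ⟩ := exists_sub_dif_eq_pull r hker σ hσ hη.1
        fun p q _ => by rw [hd]; rfl
      have hβc : β ∈ closedForms act' br' n := by
        refine ⟨hβ, LinearMap.mem_ker.2 (pull_injective (𝔩 := 𝔩) r hσ (n + 1) ?_)⟩
        rw [← dif_pull r hact hbr hker hβ, ← hηβ, map_sub, dif_dif hζ, hd, map_zero, sub_zero]
      refine ⟨Submodule.Quotient.mk ⟨β, hβc⟩, ?_⟩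
      refine ((Submodule.Quotient.eq _).2 ?_).symm
      change η - 𝔩.pull r n β ∈ 𝔩.coboundaries n
      rwa [← hηβ, sub_sub_cancel]
  exact ⟨LinearEquiv.ofBijective Q hQ, fun α => ⟨_, rfl⟩⟩

end Pull

end AlmostLieRinehart
end

/-! ### Vector fields: extension of tangent vectors and the action on functions -/

noncomputable section

variable {E : Type*} [NormedAddCommGroup E] [NormedSpace ℝ E] [FiniteDimensional ℝ E]
  {M : Type*} [TopologicalSpace M] [ChartedSpace E M] [IsManifold 𝓘(ℝ, E) ∞ M]

/-- A tangent vector at a point extends to a global smooth vector field. -/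
theorem VecField.exists_apply_eq [T2Space M] [SigmaCompactSpace M] (c : M)
    (w : TangentSpace 𝓘(ℝ, E) c) : ∃ X : VecField E M, X c = w := by
  classical
  -- The prescribed value becomes a convex condition in every fibre, void away from `c`, so local
  -- solutions can be glued by a partition of unity.
  suffices h : ∃ X : VecField E M, ∀ x, X x ∈ {u | ∀ h : x = c, u = h ▸ w} by
    obtain ⟨X, hX⟩ := h
    exact ⟨X, hX c rfl⟩
  refine exists_contMDiffSection_forall_mem_convex_of_local (n := ⊤) 𝓘(ℝ, E)
    (F_fiber := E) (fun x : M => TangentSpace 𝓘(ℝ, E) x)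
    (fun x => {u | ∀ h : x = c, u = h ▸ w}) (fun x => ?_) (fun x₀ => ?_)
  · intro u hu v hv a b _ _ hab h
    rw [hu h, hv h, ← add_smul, hab, one_smul]
  · by_cases h : x₀ = c
    · subst h
      let e := trivializationAt E (TangentSpace 𝓘(ℝ, E)) x₀
      refine ⟨e.baseSet, e.open_baseSet.mem_nhds (FiberBundle.mem_baseSet_trivializationAt' x₀),
        fun x => e.symm x (e ⟨x₀, w⟩).2, ?_, ?_⟩
      · rw [e.contMDiffOn_section_baseSet_iff]
        refine (contMDiffOn_const (c := (e ⟨x₀, w⟩).2)).congr fun x hx => ?_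
        rw [e.apply_mk_symm hx]
      · rintro _ - rfl
        exact e.symm_apply_apply_mk (FiberBundle.mem_baseSet_trivializationAt' _) w
    · refine ⟨{c}ᶜ, isOpen_compl_singleton.mem_nhds h, fun _ => 0,
        (contMDiff_zeroSection ℝ _).contMDiffOn, fun y hy h => absurd h hy⟩

theorem VecField.lieD_apply (X : VecField E M) (f : SmoothFun E M) (x : M) :
    lieD X f x = mvfderiv 𝓘(ℝ, E) f x (X x) := rfl

theorem VecField.lieD_mul (X : VecField E M) (f g : SmoothFun E M) :
    lieD X (f * g) = lieD X f * g + f * lieD X g := by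
  ext x
  have h := mvfderiv_mul (f.mdifferentiableAt (x := x)) (g.mdifferentiableAt (x := x))
  refine (congrArg (fun l => l (X x)) h).trans ?_
  change f x * lieD X g x + g x * lieD X f x = lieD X f x * g x + f x * lieD X g x
  ring

theorem VecField.lieD_add_left (X Y : VecField E M) (f : SmoothFun E M) :
    lieD (X + Y) f = lieD X f + lieD Y f := by
  ext x
  exact map_add (mvfderiv 𝓘(ℝ, E) f x) (X x) (Y x)

theorem VecField.lieD_smul_left (g : SmoothFun E M) (X : VecField E M) (f : SmoothFun E M) :
    lieD (g • X) f = g * lieD X f := by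
  ext x
  exact map_smul (mvfderiv 𝓘(ℝ, E) f x) (g x) (X x)

/-- Subtract `f` times the Jacobi identity for `X, Y, Z` from the one for `X, Y, fZ`; only multiples
of `Z` by second derivatives of `f` survive. -/
theorem VecField.lieD_bracket_smul (X Y Z : VecField E M) (f : SmoothFun E M) :
    (lieD (bracket X Y) f) • Z = (lieD X (lieD Y f) - lieD Y (lieD X f)) • Z := by
  have h := bracket_jacobi X Y (f • Z)
  have h0 := congrArg (fun W => f • W) (bracket_jacobi X Y Z)
  have hs : ∀ U V : VecField E M, bracket U (-V) = - bracket U V := fun U V => by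
    rw [← neg_one_smul ℝ, bracket_smul_right, neg_one_smul]
  rw [bracket_swap (f • Z) X, hs, bracket_swap (f • Z) (bracket X Y)] at h
  rw [bracket_swap Z X, hs, bracket_swap Z (bracket X Y)] at h0
  simp only [bracket_fun_smul_right, bracket_add_right, smul_add, smul_zero, smul_neg] at h h0
  rw [sub_smul, ← sub_eq_zero, ← neg_eq_zero]
  have := sub_eq_zero.2 (h.trans h0.symm)
  rw [← this]
  abel

theorem VecField.lieD_bracket [T2Space M] [SigmaCompactSpace M] (X Y : VecField E M)
    (f : SmoothFun E M) :
    lieD (bracket X Y) f = lieD X (lieD Y f) - lieD Y (lieD X f) := by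
  ext x
  -- Removing the factor `Z` needs a vector field nonzero at `x`; if the tangent space is trivial,
  -- all derivatives there are zero.
  rcases subsingleton_or_nontrivial (TangentSpace 𝓘(ℝ, E) x) with hs | hn
  · have h : ∀ (Z : VecField E M) (g : SmoothFun E M), lieD Z g x = 0 := fun Z g => by
      rw [lieD_apply, Subsingleton.elim (Z x) 0, map_zero]
    simp [h]
  · obtain ⟨w, hw⟩ := exists_ne (0 : TangentSpace 𝓘(ℝ, E) x)
    obtain ⟨Z, rfl⟩ := exists_apply_eq x w
    have h := congrArg (fun s => s x) (lieD_bracket_smul X Y Z f)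
    exact smul_left_injective ℝ hw h

end

/-! ### From almost Lie algebroids to the algebraic model -/

noncomputable section

namespace AlmostLieAlgebroid

variable {E : Type*} [NormedAddCommGroup E] [NormedSpace ℝ E] [FiniteDimensional ℝ E]
  {M : Type*} [TopologicalSpace M] [ChartedSpace E M] [IsManifold 𝓘(ℝ, E) ∞ M]
  [T2Space M] [SigmaCompactSpace M]
  {B : Type*} [NormedAddCommGroup B] [NormedSpace ℝ B]
  {A : M → Type*} [TopologicalSpace (TotalSpace B A)] [∀ x, TopologicalSpace (A x)]
  [FiberBundle B A] [∀ x, AddCommGroup (A x)] [∀ x, Module ℝ (A x)] [VectorBundle ℝ B A]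
  (𝔸 : AlmostLieAlgebroid E B A)

/-- The sections of an almost Lie algebroid form an almost Lie–Rinehart algebra. -/
def toAlmostLieRinehart : AlmostLieRinehart (SmoothFun E M) (Sec E B A) where
  act φ := VecField.lieD (𝔸.rho φ)
  br φ ψ := 𝔸.bracket φ ψ
  ker := 𝔸.kerSec
  act_add φ ψ f := by rw [map_add, VecField.lieD_add_left]
  act_smul f φ g := by rw [map_smul, VecField.lieD_smul_left]
  act_mul φ f g := VecField.lieD_mul _ f g
  act_br φ ψ f := by rw [rho_bracket, VecField.lieD_bracket]
  br_add φ ψ χ := map_add _ ψ χ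
  br_swap := 𝔸.skew
  br_smul φ f ψ := ContMDiffSection.ext fun x => 𝔸.leibniz φ f ψ x
  act_ker v hv f := by
    have h : 𝔸.rho v = 0 := hv
    ext x
    rw [h]
    exact map_zero (mvfderiv 𝓘(ℝ, E) f x)
  br_mem_ker φ v hv := 𝔸.bracket_mem_kerSec φ ⟨v, hv⟩
  jac_mem_ker φ ψ χ := (𝔸.jacobiator φ ψ χ).2

theorem d_eq_dif : 𝔸.d = 𝔸.toAlmostLieRinehart.dif := by
  have h1 : 𝔸.totalCovD = 𝔸.toAlmostLieRinehart.cov := by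
    refine LinearMap.ext fun ξ => ?_
    funext p q
    cases p <;> rfl
  have h2 : 𝔸.totalDeltaHat = 𝔸.toAlmostLieRinehart.del := by
    refine LinearMap.ext fun ξ => ?_
    funext p q
    cases q <;> rfl
  have h3 : 𝔸.totalJHat =
      𝔸.toAlmostLieRinehart.ins3 fun φ ψ χ => 𝔸.toAlmostLieRinehart.jac φ ψ χ := by
    refine LinearMap.ext fun ξ => ?_
    funext p q
    match p with
    | 0 | 1 | 2 => rfl
    | p + 3 => rfl
  rw [d, h1, h2, h3]
  rfl

theorem cochains_eq (n : ℕ) : 𝔸.cochains n = 𝔸.toAlmostLieRinehart.cochains n := by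
  ext ξ
  exact ⟨fun h => ⟨fun p q => (h p q).1, fun p q => (h p q).2⟩, fun h p q => ⟨h.1 p q, h.2 p q⟩⟩

theorem cocycles_eq (n : ℕ) : 𝔸.cocycles n = 𝔸.toAlmostLieRinehart.cocycles n := by
  rw [cocycles, cochains_eq, d_eq_dif]
  rfl

theorem coboundaries_eq (n : ℕ) : 𝔸.coboundaries n = 𝔸.toAlmostLieRinehart.coboundaries n := by
  cases n with
  | zero => rfl
  | succ n =>
    rw [coboundaries, cochains_eq, d_eq_dif]
    rfl

theorem d_mem_cochains {n : ℕ} {ξ : 𝔸.Total} (hξ : ξ ∈ 𝔸.cochains n) :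
    𝔸.d ξ ∈ 𝔸.cochains (n + 1) := by
  rw [cochains_eq] at hξ ⊢
  rw [d_eq_dif]
  exact AlmostLieRinehart.dif_mem_cochains hξ

theorem d_d {n : ℕ} {ξ : 𝔸.Total} (hξ : ξ ∈ 𝔸.cochains n) : 𝔸.d (𝔸.d ξ) = 0 := by
  rw [cochains_eq] at hξ
  rw [d_eq_dif]
  exact AlmostLieRinehart.dif_dif hξ.1

/-- If the anchor factors through a split surjection `r` onto a module with an action and a
bracket, then the pullback along `r` is an isomorphism in cohomology. -/
theorem exists_cohomology_equiv {𝓛 : Type*} [AddCommGroup 𝓛] [Module (SmoothFun E M) 𝓛]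
    (r : Sec E B A →ₗ[SmoothFun E M] 𝓛) {act' : 𝓛 → SmoothFun E M →ₗ[ℝ] SmoothFun E M}
    {br' : 𝓛 → 𝓛 → 𝓛} (hact : ∀ φ, act' (r φ) = VecField.lieD (𝔸.rho φ))
    (hbr : ∀ φ ψ, r (𝔸.bracket φ ψ) = br' (r φ) (r ψ)) (hker : ∀ φ, r φ = 0 ↔ 𝔸.rho φ = 0)
    (σ : 𝓛 →ₗ[SmoothFun E M] Sec E B A) (hσ : ∀ X, r (σ X) = X) (n : ℕ) :
    ∃ e : FormCohomology act' br' n ≃ₗ[ℝ] 𝔸.Cohomology n,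
      ∀ α : closedForms act' br' n,
        ∃ hα : 𝔸.ofForm n (fun ψ => α.1 fun i => r (ψ i)) ∈ 𝔸.cocycles n,
          e (Submodule.Quotient.mk α) =
            Submodule.Quotient.mk ⟨𝔸.ofForm n (fun ψ => α.1 fun i => r (ψ i)), hα⟩ := by
  -- The quotient is stated for arbitrary submodules, so that the propositional equalities of
  -- cocycles and coboundaries can be substituted without transport.
  have h : ∀ Z S : Submodule ℝ 𝔸.Total, Z = 𝔸.toAlmostLieRinehart.cocycles n →
      S = 𝔸.toAlmostLieRinehart.coboundaries n →
      ∃ e : FormCohomology act' br' n ≃ₗ[ℝ] Z ⧸ S.submoduleOf Z,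
        ∀ α : closedForms act' br' n, ∃ hα : 𝔸.ofForm n (fun ψ => α.1 fun i => r (ψ i)) ∈ Z,
          e (Submodule.Quotient.mk α) =
            Submodule.Quotient.mk ⟨𝔸.ofForm n (fun ψ => α.1 fun i => r (ψ i)), hα⟩ := by
    rintro _ _ rfl rfl
    exact AlmostLieRinehart.exists_cohomology_equiv (𝔩 := 𝔸.toAlmostLieRinehart) r hact hbr
      hker σ hσ n
  exact h _ _ (𝔸.cocycles_eq n) (𝔸.coboundaries_eq n)

end AlmostLieAlgebroid
end

/-! ### Local splitting of a regular anchor -/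

noncomputable section

section

variable {E : Type*} [NormedAddCommGroup E] [NormedSpace ℝ E]
  {M : Type*} [TopologicalSpace M] [ChartedSpace E M]

/-- A family of continuous linear maps on a finite-dimensional space is smooth if all its values
are. -/
theorem contMDiffOn_clm_of_apply {V W : Type*} [NormedAddCommGroup V] [NormedSpace ℝ V]
    [FiniteDimensional ℝ V] [NormedAddCommGroup W] [NormedSpace ℝ W] {f : M → V →L[ℝ] W}
    {s : Set M} (h : ∀ v, ContMDiffOn 𝓘(ℝ, E) 𝓘(ℝ, W) ∞ (fun x => f x v) s) :
    ContMDiffOn 𝓘(ℝ, E) 𝓘(ℝ, V →L[ℝ] W) ∞ f s := by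
  let e₁ : V ≃L[ℝ] (Fin (Module.finrank ℝ V) → ℝ) :=
    ContinuousLinearEquiv.ofFinrankEq (Module.finrank_fin_fun ℝ).symm
  let e₂ := (e₁.arrowCongr (1 : W ≃L[ℝ] W)).trans
    (ContinuousLinearEquiv.piRing (Fin (Module.finrank ℝ V)))
  rw [← Function.id_comp f, ← e₂.symm_comp_self]
  exact e₂.symm.contDiff.contMDiff.comp_contMDiffOn (contMDiffOn_pi_space.mpr fun i => h _)

variable [FiniteDimensional ℝ E] [IsManifold 𝓘(ℝ, E) ∞ M]

/-- A local frame has a fixed number of members. Local constancy of the rank is the form in which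
regularity is used. -/
theorem IsSubbundle.eventually_finrank_eq {L : ∀ x : M, Submodule ℝ (TangentSpace 𝓘(ℝ, E) x)}
    (hL : IsSubbundle L) (c : M) :
    ∀ᶠ x in 𝓝 c, Module.finrank ℝ (L x) = Module.finrank ℝ (L c) := by
  obtain ⟨U, hU, hc, k, X, -, h⟩ := hL c
  have hk : ∀ x ∈ U, Module.finrank ℝ (L x) = k := fun x hx => by
    rw [← (h x hx).2, finrank_span_eq_card (h x hx).1, Fintype.card_fin]
  filter_upwards [hU.mem_nhds hc] with x hx
  rw [hk x hx, hk c hc]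

end

namespace AlmostLieAlgebroid

variable {E : Type*} [NormedAddCommGroup E] [NormedSpace ℝ E] [FiniteDimensional ℝ E]
  {M : Type*} [TopologicalSpace M] [ChartedSpace E M] [IsManifold 𝓘(ℝ, E) ∞ M]
  {B : Type*} [NormedAddCommGroup B] [NormedSpace ℝ B] [FiniteDimensional ℝ B]
  {A : M → Type*} [TopologicalSpace (TotalSpace B A)] [∀ x, TopologicalSpace (A x)]
  [FiberBundle B A] [∀ x, AddCommGroup (A x)] [∀ x, Module ℝ (A x)] [VectorBundle ℝ B A]
  [ContMDiffVectorBundle ∞ B A 𝓘(ℝ, E)]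
  (𝔸 : AlmostLieAlgebroid E B A)

/-- Locally, the anchor of a regular almost Lie algebroid has a smooth section over its image. -/
theorem exists_local_splitting (h𝔸 : 𝔸.IsRegular) (c : M) :
    ∃ W : Set M, IsOpen W ∧ c ∈ W ∧ ∃ s : ∀ x : M, TangentSpace 𝓘(ℝ, E) x →ₗ[ℝ] A x,
      (∀ X : VecField E M, ContMDiffOn 𝓘(ℝ, E) (𝓘(ℝ, E).prod 𝓘(ℝ, B)) ∞
        (fun x => TotalSpace.mk' B x (s x (X x))) W) ∧
      ∀ x ∈ W, ∀ w ∈ 𝔸.image x, 𝔸.anchor x (s x w) = w := by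
  let eA := trivializationAt B A c
  let eT := trivializationAt E (TangentSpace 𝓘(ℝ, E)) c
  let O := eA.baseSet ∩ eT.baseSet
  have hO : IsOpen O := eA.open_baseSet.inter eT.open_baseSet
  have hcO : c ∈ O := ⟨FiberBundle.mem_baseSet_trivializationAt' c,
    FiberBundle.mem_baseSet_trivializationAt' c⟩
  let T : M → B →ₗ[ℝ] E := fun x => eT.linearMapAt ℝ x ∘ₗ 𝔸.anchor x ∘ₗ eA.symmₗ ℝ x
  let V : Submodule ℝ E := LinearMap.range (T c)
  have hrange : ∀ x ∈ O, LinearMap.range (T x) = (𝔸.image x).map (eT.linearMapAt ℝ x) := by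
    intro x hx
    have h1 : LinearMap.range (eA.symmₗ ℝ x) = ⊤ := LinearMap.range_eq_top.2 fun a =>
      ⟨eA.linearMapAt ℝ x a, eA.symmₗ_linearMapAt hx.1 a⟩
    rw [LinearMap.range_comp, LinearMap.range_comp, h1, ← LinearMap.range_eq_map]
    rfl
  have hrank : ∀ x ∈ O, Module.finrank ℝ (LinearMap.range (T x)) =
      Module.finrank ℝ (𝔸.image x) := by
    intro x hx
    rw [hrange x hx, eT.linearMapAt_def_of_mem hx.2]
    exact LinearEquiv.finrank_map_eq (eT.linearEquivAt ℝ x hx.2) (𝔸.image x)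
  -- With `T` the anchor in trivializations and `V` the range of `T c`, choose a right inverse `β`
  -- of `T c` onto `V` and a projection `P` onto `V`. Then `G = P T β` is the identity at `c`, hence
  -- invertible nearby.
  obtain ⟨β, hβ⟩ := (T c).rangeRestrict.exists_rightInverse_of_surjective
    (LinearMap.range_rangeRestrict _)
  obtain ⟨P, hP⟩ := V.subtype.exists_leftInverse_of_injective V.ker_subtype
  let G : M → V →L[ℝ] V := fun x => (P ∘ₗ T x ∘ₗ β).toContinuousLinearMap
  have hG : ContMDiffOn 𝓘(ℝ, E) 𝓘(ℝ, V →L[ℝ] V) ∞ G O := by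
    refine contMDiffOn_clm_of_apply fun v => ?_
    have h1 : ContMDiffOn 𝓘(ℝ, E) (𝓘(ℝ, E).prod 𝓘(ℝ, B)) ∞
        (fun x => TotalSpace.mk' B x (eA.symm x (β v))) O := by
      rw [eA.contMDiffOn_section_iff hO Set.inter_subset_left]
      refine (contMDiffOn_const (c := β v)).congr fun x hx => ?_
      rw [eA.apply_mk_symm hx.1]
    have h2 := 𝔸.contMDiff_anchor.comp_contMDiffOn h1
    have h3 := (eT.contMDiffOn_section_iff
      (s := fun x => 𝔸.anchor x (eA.symm x (β v))) hO Set.inter_subset_right).1 h2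
    have h4 := P.toContinuousLinearMap.contDiff.contMDiff.comp_contMDiffOn h3
    refine h4.congr fun x hx => ?_
    change P (eT.linearMapAt ℝ x (𝔸.anchor x (eA.symmₗ ℝ x (β v)))) = _
    rw [eT.linearMapAt_apply, if_pos hx.2, eA.symmₗ_apply hx.1]
    rfl
  have hGc : G c = 1 := by
    ext1 v
    have h1 : T c (β v) = v := congrArg Subtype.val (LinearMap.congr_fun hβ v)
    change P (T c (β v)) = v
    rw [h1]
    exact LinearMap.congr_fun hP v
  let D := {x | x ∈ O ∧ IsUnit (G x) ∧
    Module.finrank ℝ (𝔸.image x) = Module.finrank ℝ (𝔸.image c)}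
  have : CompleteSpace V := FiniteDimensional.complete ℝ V
  have hD : D ∈ 𝓝 c := by
    refine inter_mem (hO.mem_nhds hcO) (inter_mem ?_ (IsSubbundle.eventually_finrank_eq h𝔸 c))
    have h1 : ContinuousAt G c := hG.continuousOn.continuousAt (hO.mem_nhds hcO)
    refine h1.eventually_mem ((Units.isOpen (R := V →L[ℝ] V)).mem_nhds ?_)
    rw [hGc]
    exact isUnit_one
  -- In trivializations the splitting is `β G⁻¹ P`; it is smooth because inversion is smooth at
  -- units.
  refine ⟨interior D, isOpen_interior, mem_interior_iff_mem_nhds.2 hD, fun x =>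
    eA.symmₗ ℝ x ∘ₗ β ∘ₗ (Ring.inverse (G x) : V →L[ℝ] V).toLinearMap ∘ₗ P ∘ₗ
      eT.linearMapAt ℝ x, fun X => ?_, fun x hx w hw => ?_⟩
  · have hDO : interior D ⊆ O := fun x hx => (interior_subset hx).1
    rw [eA.contMDiffOn_section_iff isOpen_interior fun x hx => (hDO hx).1]
    have h1 : ContMDiffOn 𝓘(ℝ, E) 𝓘(ℝ, V →L[ℝ] V) ∞ (fun x => Ring.inverse (G x))
        (interior D) := by
      intro x hx
      obtain ⟨u, hu⟩ := (interior_subset hx).2.1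
      have h2 := (contDiffAt_ringInverse ℝ (R := V →L[ℝ] V) (n := ∞) u).contMDiffAt
      rw [hu] at h2
      exact (h2.comp x (hG.contMDiffAt (hO.mem_nhds (hDO hx)))).contMDiffWithinAt
    have h3 := (eT.contMDiffOn_section_iff isOpen_interior fun x hx => (hDO hx).2).1
      (X.contMDiff.contMDiffOn (s := interior D))
    have h4 := P.toContinuousLinearMap.contDiff.contMDiff.comp_contMDiffOn h3
    have h5 := β.toContinuousLinearMap.contDiff.contMDiff.comp_contMDiffOn (h1.clm_apply h4)
    refine h5.congr fun x hx => ?_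
    simp only [LinearMap.comp_apply, eA.symmₗ_apply (hDO hx).1, eA.apply_mk_symm (hDO hx).1,
      eT.linearMapAt_apply, if_pos (hDO hx).2]
    rfl
  · obtain ⟨⟨hxA, hxT⟩, ⟨u, hu⟩, hk⟩ := interior_subset hx
    let f : V →ₗ[ℝ] E := T x ∘ₗ β
    have hPf : ∀ v, P (f v) = G x v := fun v => rfl
    have hinv : ∀ v, Ring.inverse (G x) (G x v) = v := fun v => by
      rw [← hu, Ring.inverse_unit]
      exact congrArg (fun g : V →L[ℝ] V => g v) u.inv_mul
    have hf : Function.Injective f := fun v v' h => by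
      rw [← hinv v, ← hinv v', ← hPf, ← hPf, h]
    -- Invertibility of `G x` makes `T x ∘ β` injective on `V`, and constant rank then makes its
    -- range all of the range of `T x`. So each image vector is `T x (β v)`, with `v` recovered by
    -- `G⁻¹ P`.
    have hr : LinearMap.range f = LinearMap.range (T x) := by
      refine Submodule.eq_of_le_of_finrank_eq (LinearMap.range_comp_le_range β (T x)) ?_
      rw [LinearMap.finrank_range_of_inj hf, hrank x ⟨hxA, hxT⟩, hk, ← hrank c hcO]
    have hw' : eT.linearMapAt ℝ x w ∈ LinearMap.range f := by
      rw [hr, hrange x ⟨hxA, hxT⟩]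
      exact Submodule.mem_map_of_mem hw
    obtain ⟨v, hv⟩ := hw'
    have hT : Function.Injective (eT.linearMapAt ℝ x) := by
      rw [eT.linearMapAt_def_of_mem hxT]
      exact (eT.linearEquivAt ℝ x hxT).injective
    refine hT ?_
    change T x (β (Ring.inverse (G x) (P (eT.linearMapAt ℝ x w)))) = _
    rw [← hv, hPf, hinv]
    rfl

end AlmostLieAlgebroid
end

/-! ### Global splitting and involutivity -/

noncomputable section

namespace AlmostLieAlgebroid

variable {E : Type*} [NormedAddCommGroup E] [NormedSpace ℝ E] [FiniteDimensional ℝ E]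
  {M : Type*} [TopologicalSpace M] [ChartedSpace E M] [IsManifold 𝓘(ℝ, E) ∞ M]
  [T2Space M] [SigmaCompactSpace M]
  {B : Type*} [NormedAddCommGroup B] [NormedSpace ℝ B] [FiniteDimensional ℝ B]
  {A : M → Type*} [TopologicalSpace (TotalSpace B A)] [∀ x, TopologicalSpace (A x)]
  [FiberBundle B A] [∀ x, AddCommGroup (A x)] [∀ x, Module ℝ (A x)] [VectorBundle ℝ B A]
  [ContMDiffVectorBundle ∞ B A 𝓘(ℝ, E)]
  (𝔸 : AlmostLieAlgebroid E B A)

/-- The anchor of a regular almost Lie algebroid has a smooth section over its image. -/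
theorem exists_splitting (h𝔸 : 𝔸.IsRegular) :
    ∃ s : VecField E M →ₗ[SmoothFun E M] Sec E B A,
      ∀ X ∈ distSec 𝔸.image, 𝔸.rho (s X) = X := by
  choose W hW hcW s hs hρ using 𝔸.exists_local_splitting h𝔸
  obtain ⟨χ, hχ⟩ := SmoothPartitionOfUnity.exists_isSubordinate 𝓘(ℝ, E) isClosed_univ W hW
    fun x _ => Set.mem_iUnion_of_mem x (hcW x)
  let S : ∀ x : M, TangentSpace 𝓘(ℝ, E) x →ₗ[ℝ] A x := fun x => ∑ᶠ c, χ c x • s c x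
  have hfin : ∀ x : M, (Function.support fun c => χ c x • s c x).Finite := fun x =>
    (χ.locallyFinite.point_finite x).subset fun c hc => left_ne_zero_of_smul hc
  have hS : ∀ (X : VecField E M) (x : M), S x (X x) = ∑ᶠ c, χ c x • s c x (X x) := fun X x =>
    AddMonoidHom.map_finsum (LinearMap.applyₗ (R := ℝ) (M₂ := A x) (X x)).toAddMonoidHom (hfin x)
  have hsm : ∀ X : VecField E M, ContMDiff 𝓘(ℝ, E) (𝓘(ℝ, E).prod 𝓘(ℝ, B)) ∞
      (fun x => TotalSpace.mk' B x (S x (X x))) := fun X => by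
    simp only [hS]
    refine ContMDiff.finsum_section_of_locallyFinite ?_ fun c => ?_
    · exact χ.locallyFinite.subset fun c x hx => left_ne_zero_of_smul hx
    · exact ContMDiffOn.smul_section_of_tsupport (χ c).contMDiff.contMDiffOn (hW c) (hχ c)
        (hs c X)
  have hSρ : ∀ x, ∀ w ∈ 𝔸.image x, 𝔸.anchor x (S x w) = w := fun x => by
    -- Being a right inverse of the anchor on its image is an affine condition, so it survives
    -- averaging with the partition of unity.
    have hconv : Convex ℝ {g : TangentSpace 𝓘(ℝ, E) x →ₗ[ℝ] A x |
        ∀ w ∈ 𝔸.image x, 𝔸.anchor x (g w) = w} := by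
      intro g hg g' hg' a b _ _ hab w hw
      rw [LinearMap.add_apply, map_add, LinearMap.smul_apply, LinearMap.smul_apply, map_smul,
        map_smul, hg w hw, hg' w hw, ← add_smul, hab, one_smul]
    exact hconv.finsum_mem (χ.nonneg · x) (χ.sum_eq_one (Set.mem_univ x)) fun c hc =>
      hρ c x (hχ c (subset_closure hc))
  exact ⟨
    { toFun := fun X => ⟨fun x => S x (X x), hsm X⟩
      map_add' := fun X Y => ContMDiffSection.ext fun x => map_add (S x) (X x) (Y x)
      map_smul' := fun f X => ContMDiffSection.ext fun x => map_smul (S x) (f x) (X x) },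
    fun X hX => ContMDiffSection.ext fun x => hSρ x (X x) (hX x)⟩

/-- Lift both vector fields to `A`: their commutator is the anchor of the bracket of the lifts. -/
theorem involutive_image (h𝔸 : 𝔸.IsRegular) : Involutive 𝔸.image := by
  obtain ⟨s, hs⟩ := 𝔸.exists_splitting h𝔸
  intro X hX Y hY
  rw [← hs X hX, ← hs Y hY, ← rho_bracket]
  exact (𝔸.rhoImage (𝔸.bracket (s X) (s Y))).2

end AlmostLieAlgebroid
end

theorem propositionp
    {E : Type*} [NormedAddCommGroup E] [NormedSpace ℝ E] [FiniteDimensional ℝ E]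
    {M : Type*} [TopologicalSpace M] [ChartedSpace E M] [IsManifold 𝓘(ℝ, E) ∞ M]
    [T2Space M] [SigmaCompactSpace M]
    {B : Type*} [NormedAddCommGroup B] [NormedSpace ℝ B] [FiniteDimensional ℝ B]
    {A : M → Type*} [TopologicalSpace (TotalSpace B A)] [∀ x, TopologicalSpace (A x)]
    [FiberBundle B A] [∀ x, AddCommGroup (A x)] [∀ x, Module ℝ (A x)] [VectorBundle ℝ B A]
    [ContMDiffVectorBundle ∞ B A 𝓘(ℝ, E)] :
    (∀ 𝔸 : AlmostLieAlgebroid E B A, 𝔸.IsRegular →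
      -- `(C^•, d)` is a cochain complex
      (∀ (n : ℕ), ∀ ξ ∈ 𝔸.cochains n, 𝔸.d ξ ∈ 𝔸.cochains (n + 1) ∧ 𝔸.d (𝔸.d ξ) = 0) ∧
      -- `L = im ρ` is integrable, and `ρ*` induces `H_l^n(L) ≅ H^n(A, d)`
      ∃ hL : Involutive 𝔸.image, ∀ n : ℕ,
        ∃ e : LeafCohomology hL n ≃ₗ[ℝ] 𝔸.Cohomology n,
          ∀ α : leafClosed hL n, ∃ hα : 𝔸.pullback n α ∈ 𝔸.cocycles n,
            e (Submodule.Quotient.mk α) = Submodule.Quotient.mk ⟨𝔸.pullback n α, hα⟩) ∧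
    -- for `A = TM` the cohomology is de Rham cohomology
    (∀ n : ℕ,
      ∃ e : DeRhamCohomology E M n ≃ₗ[ℝ] (AlmostLieAlgebroid.tangent E M).Cohomology n,
        ∀ α : deRhamClosed E M n,
          ∃ hα : (AlmostLieAlgebroid.tangent E M).ofForm n α ∈
              (AlmostLieAlgebroid.tangent E M).cocycles n,
            e (Submodule.Quotient.mk α) =
              Submodule.Quotient.mk ⟨(AlmostLieAlgebroid.tangent E M).ofForm n α, hα⟩) := by
  refine ⟨fun 𝔸 h𝔸 => ⟨fun n ξ hξ => ⟨𝔸.d_mem_cochains hξ, 𝔸.d_d hξ⟩,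
    𝔸.involutive_image h𝔸, fun n => ?_⟩, fun n => ?_⟩
  · obtain ⟨s, hs⟩ := 𝔸.exists_splitting h𝔸
    exact 𝔸.exists_cohomology_equiv (act' := leafAct) (br' := leafBracket (𝔸.involutive_image h𝔸))
      (𝔸.rho.codRestrict (distSec 𝔸.image) fun φ => (𝔸.rhoImage φ).2) (fun _ => rfl)
      (fun φ ψ => Subtype.ext (𝔸.rho_bracket φ ψ)) (fun _ => Subtype.ext_iff)
      (s ∘ₗ (distSec 𝔸.image).subtype) (fun X => Subtype.ext (hs X.1 X.2)) n
  -- The identity anchor is split by the identity, so no regularity argument is needed here.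
  · exact (AlmostLieAlgebroid.tangent E M).exists_cohomology_equiv LinearMap.id (fun _ => rfl)
      (fun _ _ => rfl) (fun _ => Iff.rfl) LinearMap.id (fun _ => rfl) n
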